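/- **Notation.** For $k,\ell\in\mathbb N$, $m\in\mathbb Z$ with $0\le\ell\le k$ and $-\ell\le m\le\ell$, define the spherical harmonic on $\mathbb S^3$, in the coordinates $\xi=(\sin\theta\cos\phi\sin\chi,\ \sin\theta\sin\phi\sin\chi,\ \cos\theta\sin\chi,\ \cos\chi)$, by $$\mathscr Y_{k,\ell,m}(\xi)=\frac{1}{\sqrt{a_{k,\ell}}}(\sin\chi)^\ell\,T_{k+1}^{(\ell+1)}(\cos\chi)\,Y_{\ell,m}(\phi,\theta),\qquad a_{k,\ell}=\frac{(k+1)\pi}{2}\frac{(k+\ell+1)!}{(k-\ell)!},$$ where $T_n$ is the Chebyshev polynomial of the first kind, $T_n^{(j)}$ its $j$-th derivative, and $Y_{\ell,m}(\phi,\theta)=\sqrt{\tfrac{2\ell+1}{2\pi}}\,K_\ell^{|m|}(\cos\theta)\,y_m(\phi)$ with $y_m(\phi)=\cos(m\phi)$ for $m\ge1$, $y_0=1/\sqrt2$, $y_m(\phi)=\sin(|m|\phi)$ for $m\le-1$, and, for $0\le m\le\ell$, $$K_\ell^m(t)=(-1)^m\sqrt{\tfrac{(\ell-m)!}{(\ell+m)!}}\,P_\ell^m(t),\qquad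 P_\ell^m(t)=\frac{(-1)^m}{2^\ell\ell!}(1-t^2)^{m/2}\frac{d^{\ell+m}}{dt^{\ell+m}}(t^2-1)^\ell .$$ The Arar–Boulmezaoud functions on $\mathbb R^3$ are $$\mathscr W_{k,\ell,m}(x)=\Big(\frac{2}{|x|^2+1}\Big)^{1/2}\mathscr Y_{k,\ell,m}\Big(\frac{2x_1}{|x|^2+1},\frac{2x_2}{|x|^2+1},\frac{2x_3}{|x|^2+1},\frac{|x|^2-1}{|x|^2+1}\Big).$$ Let $W^1_0(\mathbb R^3)$ be the space of functions $v$ with $(1+|x|^2)^{-1/2}v\in L^2(\mathbb R^3)$ and distributional gradient $\nabla v\in L^2(\mathbb R^3)^3$, with the norm $|v|_{W^1_0(\mathbb R^3)}=\|\nabla v\|_{L^2(\mathbb R^3)}$. Let $\mu_0$ be a real constant, and put $\mathscr E_{sf}(v)=\frac{\mu_0}{2}\int_{\mathbb R^3}|\nabla v|^2\,dx$ for $v\in W^1_0(\mathbb R^3)$. **Lemma.** Let $\Omega\subset\mathbb R^3$ be an open set (in particular, any connected open set with Lipschitz boundary, bounded or not), and let $M\in L^2(\Omega)^3$. Let $U\in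 W^1_0(\mathbb R^3)$ be the solution of $\Delta U=\operatorname{div}(M\chi_\Omega)$ in the sense of distributions on $\mathbb R^3$, that is, $\int_{\mathbb R^3}\nabla U\cdot\nabla\varphi\,dx=\int_\Omega M\cdot\nabla\varphi\,dx$ for all $\varphi\in C_c^\infty(\mathbb R^3)$. For $N\ge0$ set $$U_N=\sum_{k=0}^N\sum_{\ell=0}^{k}\sum_{m=-\ell}^{\ell}\frac{4}{(2k+1)(2k+3)}\Big(\int_\Omega M\cdot\nabla\mathscr W_{k,\ell,m}\,dx\Big)\mathscr W_{k,\ell,m},$$ $$\mathscr E_{sf}^N=\sum_{k=0}^N\sum_{\ell=0}^{k}\sum_{m=-\ell}^{\ell}\frac{2\mu_0}{(2k+1)(2k+3)}\Big(\int_\Omega M\cdot\nabla\mathscr W_{k,\ell,m}\,dx\Big)^2 .$$ Then, for every $N\ge 0$, $U_N\in W^1_0(\mathbb R^3)$ and $$\mathscr E_{sf}(U)-\mathscr E_{sf}(U_N)=\frac{\mu_0}{2}\,|U-U_N|^2_{W^1_0(\mathbb R^3)}.$$ Moreover, $$\lim_{N\to\infty}\mathscr E_{sf}^N=\mathscr E_{sf}(U)\qquad\text{and}\qquad\lim_{N\to\infty}\mathscr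 E_{sf}(U_N)=\mathscr E_{sf}(U).$$ -/

import Mathlib

namespace StrayField

open MeasureTheory Polynomial
open scoped ContDiff

/-- Three-dimensional Euclidean space. -/
abbrev R3 : Type := EuclideanSpace ℝ (Fin 3)

/-- Four-dimensional Euclidean space, which contains the unit sphere `S³`. -/
abbrev R4 : Type := EuclideanSpace ℝ (Fin 4)

/-! ### Weak gradients, the weighted Sobolev space, the energy -/

/-- `g` is the gradient of `u` on `ℝ³` in the sense of distributions; both are locally
integrable. -/
def HasWeakGrad (u : R3 → ℝ) (g : R3 → R3) : Prop :=
  LocallyIntegrable u volume ∧ LocallyIntegrable g volume ∧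
    ∀ φ : R3 → ℝ, ContDiff ℝ ∞ φ → HasCompactSupport φ →
      ∀ i : Fin 3, ∫ x, u x * gradient φ x i = -∫ x, g x i * φ x

open Classical in
/-- The weak gradient of `u` (a representative of it: it is unique up to a null set).
It is `0` if `u` has none. -/
noncomputable def weakGrad (u : R3 → ℝ) : R3 → R3 :=
  if h : ∃ g, HasWeakGrad u g then h.choose else 0

/-- Membership in the weighted Sobolev space `W¹₀(ℝ³)`: the function `(1 + |x|²)^(-1/2) v` and
the distributional gradient of `v` are square integrable. -/
def MemW10 (v : R3 → ℝ) : Prop :=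
  MemLp (fun x => v x / √(1 + ‖x‖ ^ 2)) 2 volume ∧ ∃ g, HasWeakGrad v g ∧ MemLp g 2 volume

/-- The norm `|v| = ‖∇v‖_{L²(ℝ³)}` of `W¹₀(ℝ³)`. -/
noncomputable def normW10 (v : R3 → ℝ) : ℝ := √(∫ x, ‖weakGrad v x‖ ^ 2)

/-- The stray field energy `(μ₀ / 2) ∫ |∇v|²` of a potential `v`. -/
noncomputable def Esf (μ₀ : ℝ) (v : R3 → ℝ) : ℝ := μ₀ / 2 * ∫ x, ‖weakGrad v x‖ ^ 2

/-- `U ∈ W¹₀(ℝ³)` solves `ΔU = div (M χ_Ω)` in `ℝ³` in the sense of distributions. -/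
def IsPotential (Ω : Set R3) (M : R3 → R3) (U : R3 → ℝ) : Prop :=
  MemW10 U ∧ ∀ φ : R3 → ℝ, ContDiff ℝ ∞ φ → HasCompactSupport φ →
    ∫ x, inner ℝ (weakGrad U x) (gradient φ x) = ∫ x in Ω, inner ℝ (M x) (gradient φ x)

/-! ### Spherical harmonics on `S²` and `S³` -/

/-- The associated Legendre function
`P_ℓ^m (t) = (-1)^m / (2^ℓ ℓ!) (1 - t²)^(m/2) (d/dt)^(ℓ+m) (t² - 1)^ℓ` for `0 ≤ m`. -/
noncomputable def legendreP (l m : ℕ) (t : ℝ) : ℝ :=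
  (-1) ^ m / (2 ^ l * (l.factorial : ℝ)) * √(1 - t ^ 2) ^ m *
    (derivative^[l + m] ((X ^ 2 - 1 : ℝ[X]) ^ l)).eval t

/-- `K_ℓ^m = (-1)^m √((ℓ-m)! / (ℓ+m)!) P_ℓ^m` for `0 ≤ m ≤ ℓ`. -/
noncomputable def legendreK (l m : ℕ) (t : ℝ) : ℝ :=
  (-1) ^ m * √(((l - m).factorial : ℝ) / ((l + m).factorial : ℝ)) * legendreP l m t

/-- The azimuthal factor of the real spherical harmonics. -/
noncomputable def azimuthal (m : ℤ) (φ : ℝ) : ℝ :=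
  if 1 ≤ m then Real.cos (m * φ) else if m = 0 then 1 / √2 else Real.sin (|m| * φ)

/-- The real spherical harmonic `Y_{ℓ,m}(φ, θ)` on `S²`, for `|m| ≤ ℓ`. -/
noncomputable def sphHarm2 (l : ℕ) (m : ℤ) (φ θ : ℝ) : ℝ :=
  √((2 * l + 1) / (2 * Real.pi)) * legendreK l m.natAbs (Real.cos θ) * azimuthal m φ

/-- The normalization constant `a_{k,ℓ} = ((k+1)π/2) (k+ℓ+1)!/(k-ℓ)!` for `ℓ ≤ k`. -/
noncomputable def normConst (k l : ℕ) : ℝ :=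
  (k + 1) * Real.pi / 2 * (((k + l + 1).factorial : ℝ) / ((k - l).factorial : ℝ))

/-- The spherical harmonic of index `(k, ℓ, m)` on `S³` in the spherical coordinates
`(φ, θ, χ)`; here `T_{k+1}^{(ℓ+1)}` is the derivative of order `ℓ + 1` of a Chebyshev polynomial
of the first kind. -/
noncomputable def sphHarm3 (k l : ℕ) (m : ℤ) (φ θ χ : ℝ) : ℝ :=
  1 / √(normConst k l) * Real.sin χ ^ l *
    (derivative^[l + 1] (Chebyshev.T ℝ (k + 1))).eval (Real.cos χ) * sphHarm2 l m φ θ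

/-- The angle `χ ∈ [0, π]` of `ξ ∈ S³`, where
`ξ = (sin θ cos φ sin χ, sin θ sin φ sin χ, cos θ sin χ, cos χ)`. -/
noncomputable def angleChi (ξ : R4) : ℝ := Real.arccos (ξ 3)

/-- The angle `θ ∈ [0, π]` of `ξ ∈ S³`. -/
noncomputable def angleTheta (ξ : R4) : ℝ :=
  Real.arccos (ξ 2 / √(ξ 0 ^ 2 + ξ 1 ^ 2 + ξ 2 ^ 2))

/-- The angle `φ` of `ξ ∈ S³`, taken in `(-π, π]` (the spherical harmonics have period `2π`
in `φ`). -/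
noncomputable def anglePhi (ξ : R4) : ℝ := Complex.arg ⟨ξ 0, ξ 1⟩

/-- The spherical harmonic of index `(k, ℓ, m)` as a function of the point `ξ ∈ S³`. Where the
angles are not unique, the value does not depend on their choice. -/
noncomputable def harmY (k l : ℕ) (m : ℤ) (ξ : R4) : ℝ :=
  sphHarm3 k l m (anglePhi ξ) (angleTheta ξ) (angleChi ξ)

/-! ### The Arar-Boulmezaoud functions -/

/-- The inverse of the stereographic projection of `S³` from `(0, 0, 0, 1)`. -/
noncomputable def invStereo (x : R3) : R4 :=
  !₂[2 * x 0 / (‖x‖ ^ 2 + 1), 2 * x 1 / (‖x‖ ^ 2 + 1), 2 * x 2 / (‖x‖ ^ 2 + 1),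
    (‖x‖ ^ 2 - 1) / (‖x‖ ^ 2 + 1)]

/-- The Arar-Boulmezaoud function of index `(k, ℓ, m)`. -/
noncomputable def abW (k l : ℕ) (m : ℤ) (x : R3) : ℝ :=
  √(2 / (‖x‖ ^ 2 + 1)) * harmY k l m (invStereo x)

/-- The coefficient `∫_Ω M · ∇W_{k,ℓ,m}`. -/
noncomputable def coeff (Ω : Set R3) (M : R3 → R3) (k l : ℕ) (m : ℤ) : ℝ :=
  ∫ x in Ω, inner ℝ (M x) (gradient (abW k l m) x)

/-- The truncated expansion `U_N`; the sums over `ℓ` and `m` run over the indices `(k, ℓ, m)`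
with `0 ≤ ℓ ≤ k` and `-ℓ ≤ m ≤ ℓ`. -/
noncomputable def potentialN (Ω : Set R3) (M : R3 → R3) (N : ℕ) (x : R3) : ℝ :=
  ∑ k ∈ Finset.range (N + 1), ∑ l ∈ Finset.range (k + 1), ∑ m ∈ Finset.Icc (-(l : ℤ)) l,
    4 / ((2 * k + 1) * (2 * k + 3)) * coeff Ω M k l m * abW k l m x

/-- The truncated energy `E_sf^N`. -/
noncomputable def EsfN (μ₀ : ℝ) (Ω : Set R3) (M : R3 → R3) (N : ℕ) : ℝ :=
  ∑ k ∈ Finset.range (N + 1), ∑ l ∈ Finset.range (k + 1), ∑ m ∈ Finset.Icc (-(l : ℤ)) l,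
    2 * μ₀ / ((2 * k + 1) * (2 * k + 3)) * coeff Ω M k l m ^ 2

end StrayField

namespace StrayField

open MeasureTheory Polynomial
open scoped ContDiff

/-! ### Integrals over `[0, π]` of powers of the sine times polynomials in the cosine -/

/-! Put `σ² = 2 / (1 + |x|²)` (`sig`) and `λ_k = (2k+1)(2k+3)/4` (`eig`). Two facts about the
Arar–Boulmezaoud functions `W_j` carry the theorem. They solve `-ΔW = λ_k σ⁴ W` (`laplace_abW`),
which is what the eigenvalue equation of the spherical harmonics becomes under the conformal map
from `S³` to `ℝ³`. And the functions `σ² W_j` form an orthonormal basis of `L²(ℝ³)`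
(`integral_abW_mul`, `ae_eq_zero_of_integral_abW_eq_zero`).

The first fact and a cutoff give Green's identity `∫ ∇u · ∇W_j = λ_k ∫ σ⁴ u W_j` for `u` in `W¹₀`
(`HasWeakGrad.integral_inner_gradient_abW`). For `u = W_i` it shows that the gradients are
orthogonal with squared norms `λ_k`. A cutoff also allows `W_j` as a test function in the equation
of `U`, so `∫_Ω M · ∇W_j` is the inner product of `∇U` and `∇W_j`
(`integral_inner_gradient_abW_eq`). Hence `∇U_N` is the orthogonal projection of `∇U` onto finitely
many of the gradients. The energy identity is Pythagoras' theorem, and `E^N` equals `E(U_N)`.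

For the limits, Bessel's inequality makes the expansion of `∇U` converge in `L²` to some `G'`; it
remains to see that `G' = ∇U` (`hasSum_gradVec`). Paired with `φ eᵢ`, its terms are, up to sign,
products of the coefficients of `σ² U` and of `σ⁻² ∂ᵢφ` in the basis `σ² W_j`. Parseval's identity
then says that `G'` is a weak gradient of `U`, and weak gradients are unique. Density of test
functions in `W¹₀` plays no role.

The facts about `W` rest on the closed formula `abW_eq`, `W = c σ^(2l+1) F(1 - σ²) H(x)`, with `F` a
derivative of a Chebyshev polynomial and `H` a solid harmonic; it removes the angles. The
differential equation reduces to the ultraspherical equation of `F`. Orthonormality separates in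
spherical coordinates into Chebyshev, Legendre and trigonometric integrals. For completeness, the
functions `W / σ` span all polynomials restricted to the sphere, and these are dense by
Stone–Weierstrass. -/

/-- The integral `∫₀^π sinⁿ θ p(cos θ) dθ`. -/
noncomputable def sinInt (n : ℕ) (p : ℝ[X]) : ℝ :=
  ∫ θ in (0 : ℝ)..Real.pi, Real.sin θ ^ n * p.eval (Real.cos θ)

lemma sinInt_smul (n : ℕ) (c : ℝ) (p : ℝ[X]) : sinInt n (C c * p) = c * sinInt n p := by
  simp only [sinInt, eval_mul, eval_C, ← intervalIntegral.integral_const_mul]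
  congr 1; ext; ring

lemma intervalIntegrable_sinInt (n : ℕ) (p : ℝ[X]) :
    IntervalIntegrable (fun θ => Real.sin θ ^ n * p.eval (Real.cos θ)) volume 0 Real.pi := by
  apply Continuous.intervalIntegrable
  fun_prop

lemma sinInt_add (n : ℕ) (p q : ℝ[X]) : sinInt n (p + q) = sinInt n p + sinInt n q := by
  rw [sinInt, sinInt, sinInt, ← intervalIntegral.integral_add (intervalIntegrable_sinInt n p)
    (intervalIntegrable_sinInt n q)]
  congr 1; ext; simp; ring

lemma sinInt_add_two (n : ℕ) (p : ℝ[X]) : sinInt (n + 2) p = sinInt n ((1 - X ^ 2) * p) := by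
  rw [sinInt, sinInt]
  congr 1; ext θ
  rw [eval_mul, eval_sub, eval_one, eval_pow, eval_X, pow_add, Real.sin_sq]; ring

/-- Integration by parts. -/
lemma sinInt_parts (n : ℕ) (p : ℝ[X]) :
    sinInt n (C (n + 1 : ℝ) * X * p - (1 - X ^ 2) * derivative p) = 0 := by
  -- The integrand is the derivative of `sin^(n+1) θ p(cos θ)`, which vanishes at both ends.
  have h : ∀ θ ∈ Set.uIcc (0 : ℝ) Real.pi,
      HasDerivAt (fun θ => Real.sin θ ^ (n + 1) * p.eval (Real.cos θ))
        (Real.sin θ ^ n *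
          (C (n + 1 : ℝ) * X * p - (1 - X ^ 2) * derivative p).eval (Real.cos θ)) θ := by
    intro θ _
    have h1 := (Real.hasDerivAt_sin θ).pow (n + 1)
    have h2 := (p.hasDerivAt (Real.cos θ)).comp θ (Real.hasDerivAt_cos θ)
    refine (h1.mul h2).congr_deriv ?_
    simp only [eval_mul, eval_sub, eval_one, eval_pow, eval_X, eval_C]
    rw [show 1 - Real.cos θ ^ 2 = Real.sin θ ^ 2 from (Real.sin_sq θ).symm]
    simp
    ring
  rw [sinInt, intervalIntegral.integral_eq_sub_of_hasDerivAt h (intervalIntegrable_sinInt n _)]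
  simp

/-- The ultraspherical differential equation `(1 - x²) p'' - a x p' + μ p = 0`. -/
def UltraODE (a μ : ℝ) (p : ℝ[X]) : Prop :=
  (1 - X ^ 2) * derivative (derivative p) - C a * X * derivative p + C μ * p = 0

lemma UltraODE.derivative {a μ : ℝ} {p : ℝ[X]} (h : UltraODE a μ p) :
    UltraODE (a + 2) (μ - a) (derivative p) := by
  have := congrArg Polynomial.derivative h
  unfold UltraODE
  simp only [derivative_add, derivative_sub, derivative_mul, derivative_X, derivative_one,
    derivative_X_pow, derivative_C, derivative_zero, C_add, C_sub] at this ⊢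
  linear_combination (norm := skip) this
  simp
  ring

lemma UltraODE.iterate {a μ : ℝ} {p : ℝ[X]} (h : UltraODE a μ p) (j : ℕ) :
    UltraODE (a + 2 * j) (μ - j * (a + j - 1)) (Polynomial.derivative^[j] p) := by
  induction j with
  | zero => simpa using h
  | succ j ih =>
    rw [Function.iterate_succ_apply']
    convert ih.derivative using 1 <;> push_cast <;> ring

/-- With `a = n + 1` the operator is symmetric for the weight `sinⁿ`. So integrating `p' q` by parts
trades one derivative on each factor for the constant `μ`. All Legendre and Chebyshev integrals
below are recursions built on this. -/
lemma UltraODE.sinInt {n : ℕ} {μ : ℝ} {p : ℝ[X]} (h : UltraODE (n + 1) μ p) (q : ℝ[X]) :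
    sinInt (n + 2) (Polynomial.derivative p * Polynomial.derivative q) =
      μ * sinInt n (p * q) := by
  have h1 := sinInt_parts n (Polynomial.derivative p * q)
  have h2 : (1 - X ^ 2) * (Polynomial.derivative p * Polynomial.derivative q) =
      C μ * (p * q) + C (-1) * (C (n + 1 : ℝ) * X * (Polynomial.derivative p * q) -
        (1 - X ^ 2) * Polynomial.derivative (Polynomial.derivative p * q)) := by
    unfold UltraODE at h
    rw [derivative_mul, C_neg, C_1]
    linear_combination (-q) * h
  rw [sinInt_add_two, h2, sinInt_add, sinInt_smul, sinInt_smul, h1]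
  ring

/-! ### Legendre functions -/

/-- This is the derivative of the first-order equation `(x² - 1) p' = 2 l x p`. -/
lemma ultraODE_X_sq_sub_one_pow (l : ℕ) :
    UltraODE (2 - 2 * l) (2 * l) ((X ^ 2 - 1 : ℝ[X]) ^ l) := by
  unfold UltraODE
  -- The exponent `l - 2` of the second derivative is a truncated subtraction, so `l = 0` and `l =
  -- 1` are separate.
  rcases l with _ | l
  · simp
  rcases l with _ | l
  · simp
    ring_nf
    simp [← C_ofNat]
  simp only [derivative_mul, derivative_pow, derivative_sub, derivative_one,
    derivative_C, derivative_X]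
  simp
  ring_nf

/-- The polynomial factor of the associated Legendre functions, up to normalization. -/
noncomputable def legQ (l m : ℕ) : ℝ[X] := derivative^[l + m] ((X ^ 2 - 1 : ℝ[X]) ^ l)

lemma derivative_legQ (l m : ℕ) : derivative (legQ l m) = legQ l (m + 1) := by
  rw [legQ, legQ, ← add_assoc, Function.iterate_succ_apply']

lemma ultraODE_legQ (l m : ℕ) :
    UltraODE ((2 * m + 1 : ℕ) + 1) ((l - m) * (l + m + 1)) (legQ l m) := by
  change UltraODE _ _ (derivative^[l + m] ((X ^ 2 - 1 : ℝ[X]) ^ l))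
  convert (ultraODE_X_sq_sub_one_pow l).iterate (l + m) using 1
  · push_cast; ring
  · push_cast; ring

lemma sinInt_legQ_succ (l l' m : ℕ) :
    sinInt (2 * (m + 1) + 1) (legQ l (m + 1) * legQ l' (m + 1)) =
      (l - m) * (l + m + 1) * sinInt (2 * m + 1) (legQ l m * legQ l' m) := by
  rw [← derivative_legQ, ← derivative_legQ, ← (ultraODE_legQ l m).sinInt]
  rfl

lemma monic_X_sq_sub_C_pow {R : Type*} [CommRing R] (w : R) (l : ℕ) :
    ((X ^ 2 - C w : R[X]) ^ l).Monic :=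
  (monic_X_pow_sub_C w two_ne_zero).pow l

lemma natDegree_X_sq_sub_C_pow {R : Type*} [CommRing R] [Nontrivial R] (w : R) (l : ℕ) :
    ((X ^ 2 - C w : R[X]) ^ l).natDegree = 2 * l := by
  rw [(monic_X_pow_sub_C w two_ne_zero).natDegree_pow, natDegree_X_pow_sub_C, mul_comm]

lemma natDegree_X_sq_sub_one_pow (l : ℕ) : ((X ^ 2 - 1 : ℝ[X]) ^ l).natDegree = 2 * l := by
  simpa using natDegree_X_sq_sub_C_pow (1 : ℝ) l

lemma legQ_eq_zero {l m : ℕ} (h : l < m) : legQ l m = 0 := by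
  apply iterate_derivative_eq_zero
  rw [natDegree_X_sq_sub_one_pow]; omega

lemma legQ_self (l : ℕ) : legQ l l = C ((2 * l).factorial : ℝ) := by
  have h := natDegree_X_sq_sub_one_pow l
  have h0 : (legQ l l).natDegree = 0 := by
    have := natDegree_iterate_derivative ((X ^ 2 - 1 : ℝ[X]) ^ l) (l + l)
    rw [legQ]; omega
  rw [eq_C_of_natDegree_eq_zero h0, legQ, coeff_iterate_derivative]
  have h1 := monic_X_sq_sub_C_pow (1 : ℝ) l
  rw [Monic, leadingCoeff, natDegree_X_sq_sub_C_pow] at h1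
  simp only [C_1] at h1
  rw [zero_add, ← two_mul, h1, Nat.descFactorial_self]
  simp

/-- The recursion is run downwards in `m`, starting from `legQ l (l + 1) = 0`. It is used with the
factor `(l' - m)(l' + m + 1)` of the larger index, which is nonzero down from `m = l`. -/
lemma sinInt_legQ_of_lt {l l' : ℕ} (h : l < l') (m : ℕ) :
    sinInt (2 * m + 1) (legQ l m * legQ l' m) = 0 := by
  rcases lt_or_ge l m with hm | hm
  · simp [legQ_eq_zero hm, sinInt]
  induction hm using Nat.decreasingInduction with
  | self =>
    have := sinInt_legQ_succ l' l l
    rw [legQ_eq_zero (Nat.lt_succ_self l)] at this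
    have h' : (l : ℝ) < l' := by exact_mod_cast h
    have h0 : sinInt (2 * (l + 1) + 1) (legQ l' (l + 1) * 0) = 0 := by simp [sinInt]
    rw [h0, mul_comm (legQ l' l)] at this
    rcases mul_eq_zero.1 this.symm with h3 | h3
    · have h4 : (0 : ℝ) < (l' - l) * (l' + l + 1) := mul_pos (by linarith) (by positivity)
      exact absurd h3 h4.ne'
    · exact h3
  | of_succ m hm ih =>
    have := sinInt_legQ_succ l' l m
    rw [mul_comm (legQ l' _), mul_comm (legQ l' _), ih] at this
    have h' : (m : ℝ) < l' := by exact_mod_cast (by omega : m < l')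
    have h4 : (0 : ℝ) < (l' - m) * (l' + m + 1) := mul_pos (by linarith) (by positivity)
    rcases mul_eq_zero.1 this.symm with h3 | h3
    · exact absurd h3 h4.ne'
    · exact h3

lemma sinInt_legQ_of_ne {l l' : ℕ} (h : l ≠ l') (m : ℕ) :
    sinInt (2 * m + 1) (legQ l m * legQ l' m) = 0 := by
  rcases h.lt_or_gt with h | h
  · exact sinInt_legQ_of_lt h m
  · rw [mul_comm (legQ l m)]; exact sinInt_legQ_of_lt h m

/-- Wallis' integral, needed for the case `m = l` of the Legendre norms, where `legQ l l` is the
constant `(2l)!`. -/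
lemma factorial_mul_integral_sin_pow_odd (l : ℕ) :
    ((2 * l).factorial : ℝ) * ∫ θ in (0 : ℝ)..Real.pi, Real.sin θ ^ (2 * l + 1) =
      2 * (2 ^ l * (l.factorial : ℝ)) ^ 2 / (2 * l + 1) := by
  rw [integral_sin_pow_odd]
  induction l with
  | zero => simp
  | succ l ih =>
    rw [Finset.prod_range_succ, show 2 * (l + 1) = 2 * l + 1 + 1 by ring, Nat.factorial_succ,
      Nat.factorial_succ, Nat.factorial_succ]
    push_cast
    rw [show ((2 * l + 1 + 1 : ℝ) * ((2 * l + 1) * ((2 * l).factorial : ℝ))) *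
      (2 * ((∏ i ∈ Finset.range l, (2 * (i : ℝ) + 2) / (2 * i + 3)) * ((2 * l + 2) / (2 * l + 3))))
      = ((2 * l).factorial * (2 * ∏ i ∈ Finset.range l, (2 * (i : ℝ) + 2) / (2 * i + 3))) *
        ((2 * l + 2) * (2 * l + 1) * ((2 * l + 2) / (2 * l + 3))) by ring, ih]
    have : (2 * (l : ℝ) + 1) ≠ 0 := by positivity
    field_simp
    ring

lemma sinInt_legQ_self {l m : ℕ} (h : m ≤ l) :
    sinInt (2 * m + 1) (legQ l m * legQ l m) =
      2 * (2 ^ l * (l.factorial : ℝ)) ^ 2 / (2 * l + 1) *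
        ((l + m).factorial / (l - m).factorial) := by
  induction h using Nat.decreasingInduction with
  | self =>
    rw [legQ_self, sinInt_smul, ← factorial_mul_integral_sin_pow_odd, sinInt]
    simp only [eval_C, intervalIntegral.integral_mul_const]
    rw [Nat.sub_self, ← two_mul, Nat.factorial_zero]
    simp; ring
  | of_succ m hm ih =>
    have h1 := sinInt_legQ_succ l l m
    rw [ih, show l + (m + 1) = l + m + 1 by ring, Nat.factorial_succ] at h1
    obtain ⟨d, rfl⟩ := Nat.exists_eq_add_of_lt hm
    rw [show m + d + 1 - (m + 1) = d by omega] at h1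
    rw [show m + d + 1 - m = d + 1 by omega, Nat.factorial_succ d]
    push_cast at h1 ⊢
    have h4 : ((m : ℝ) + d + 1 - m) * (m + d + 1 + m + 1) ≠ 0 := by
      rw [show (m : ℝ) + d + 1 - m = d + 1 by ring]; positivity
    apply mul_left_cancel₀ h4
    rw [← h1]
    have : (d.factorial : ℝ) ≠ 0 := by positivity
    generalize (m + d + 1).factorial = a
    generalize (m + d + 1 + m).factorial = b
    field_simp
    ring

/-! ### Derivatives of Chebyshev polynomials -/

lemma ultraODE_chebyshev (n : ℕ) : UltraODE 1 (n ^ 2) (Chebyshev.T ℝ n) := by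
  have := Chebyshev.one_sub_X_sq_mul_derivative_derivative_T_eq_poly_in_T (R := ℝ) n
  unfold UltraODE
  simp only [Function.iterate_succ, Function.iterate_zero, Function.comp_apply, id] at this
  rw [this]; simp

lemma sinInt_chebyshev_succ (n n' j : ℕ) :
    sinInt (2 * (j + 1)) (derivative^[j + 1] (Chebyshev.T ℝ n) *
        derivative^[j + 1] (Chebyshev.T ℝ n')) =
      (n ^ 2 - j ^ 2) * sinInt (2 * j)
        (derivative^[j] (Chebyshev.T ℝ n) * derivative^[j] (Chebyshev.T ℝ n')) := by
  have h : UltraODE ((2 * j : ℕ) + 1) (n ^ 2 - j ^ 2) (derivative^[j] (Chebyshev.T ℝ n)) := by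
    convert (ultraODE_chebyshev n).iterate j using 1 <;> push_cast <;> ring
  rw [Function.iterate_succ_apply', Function.iterate_succ_apply', ← h.sinInt]
  rfl

lemma sinInt_chebyshev_zero (n n' : ℕ) :
    sinInt 0 (Chebyshev.T ℝ n * Chebyshev.T ℝ n') =
      ∫ x, (Chebyshev.T ℝ n).eval x * (Chebyshev.T ℝ n').eval x ∂Chebyshev.measureT := by
  rw [Chebyshev.integral_measureT_eq_integral_cos, sinInt]
  simp

/-- Unlike for Legendre, the recursion goes upwards in `j`: the case `j = 0` is the orthogonality of
the Chebyshev polynomials. -/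
lemma sinInt_chebyshev_of_ne {n n' : ℕ} (h : n ≠ n') (j : ℕ) :
    sinInt (2 * j) (derivative^[j] (Chebyshev.T ℝ n) * derivative^[j] (Chebyshev.T ℝ n')) = 0 := by
  induction j with
  | zero =>
    rw [mul_zero, Function.iterate_zero, id, id, sinInt_chebyshev_zero,
      Chebyshev.integral_eval_T_real_mul_eval_T_real_measureT_of_ne h]
  | succ j ih => rw [sinInt_chebyshev_succ, ih, mul_zero]

/-- From the value `π / 2` at order `0`, each derivative contributes `(k+1)² - j² = (k+1-j)(k+1+j)`;
the product builds the quotient of factorials in `normConst`. -/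
lemma sinInt_chebyshev_self {k l : ℕ} (h : l ≤ k) :
    sinInt (2 * (l + 1)) (derivative^[l + 1] (Chebyshev.T ℝ (k + 1 : ℕ)) *
      derivative^[l + 1] (Chebyshev.T ℝ (k + 1 : ℕ))) = normConst k l := by
  induction l with
  | zero =>
    rw [sinInt_chebyshev_succ, mul_zero, Function.iterate_zero, id, sinInt_chebyshev_zero,
      Chebyshev.integral_T_real_mul_self_measureT_of_ne_zero (by omega), normConst]
    have : (k.factorial : ℝ) ≠ 0 := by positivity
    simp [Nat.factorial_succ]
    field_simp
  | succ l ih =>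
    rw [sinInt_chebyshev_succ, ih (by omega), normConst, normConst]
    obtain ⟨d, rfl⟩ := Nat.exists_eq_add_of_lt (Nat.lt_of_succ_le h)
    rw [show l + d + 1 - (l + 1) = d by omega, show l + d + 1 - l = d + 1 by omega,
      show l + d + 1 + (l + 1) + 1 = l + d + 1 + l + 1 + 1 by ring,
      Nat.factorial_succ d, Nat.factorial_succ (l + d + 1 + l + 1)]
    push_cast
    have : (d.factorial : ℝ) ≠ 0 := by positivity
    field_simp
    ring

/-! ### The azimuthal factors -/

lemma integral_cos_int_mul (n : ℤ) :
    ∫ φ in (-Real.pi)..Real.pi, Real.cos (n * φ) = if n = 0 then 2 * Real.pi else 0 := by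
  split_ifs with h
  · simp [h]; ring
  · rw [intervalIntegral.integral_comp_mul_left _ (by exact_mod_cast h), integral_cos]
    simp [Real.sin_int_mul_pi]

lemma integral_sin_mul_symm (c : ℝ) :
    ∫ φ in (-Real.pi)..Real.pi, Real.sin (c * φ) = 0 := by
  rcases eq_or_ne c 0 with h | h
  · simp [h]
  · rw [intervalIntegral.integral_comp_mul_left _ h, integral_sin]
    simp

lemma integral_azimuthal (m m' : ℤ) :
    ∫ φ in (-Real.pi)..Real.pi, azimuthal m φ * azimuthal m' φ =
      if m = m' then Real.pi else 0 := by
  have hcc : ∀ a b : ℤ, ∫ φ in (-Real.pi)..Real.pi, Real.cos (a * φ) * Real.cos (b * φ) =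
      (if a - b = 0 then Real.pi else 0) + (if a + b = 0 then Real.pi else 0) := by
    intro a b
    rw [show (fun φ : ℝ => Real.cos (a * φ) * Real.cos (b * φ)) = fun φ : ℝ =>
      (1 / 2) * Real.cos ((a - b : ℤ) * φ) + (1 / 2) * Real.cos ((a + b : ℤ) * φ) by
      ext φ; push_cast; rw [sub_mul, add_mul, Real.cos_sub, Real.cos_add]; ring]
    rw [intervalIntegral.integral_add (Continuous.intervalIntegrable (by fun_prop) _ _)
      (Continuous.intervalIntegrable (by fun_prop) _ _), intervalIntegral.integral_const_mul,
      intervalIntegral.integral_const_mul, integral_cos_int_mul, integral_cos_int_mul]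
    split_ifs <;> ring
  have hss : ∀ a b : ℤ, ∫ φ in (-Real.pi)..Real.pi, Real.sin (a * φ) * Real.sin (b * φ) =
      (if a - b = 0 then Real.pi else 0) - (if a + b = 0 then Real.pi else 0) := by
    intro a b
    rw [show (fun φ : ℝ => Real.sin (a * φ) * Real.sin (b * φ)) = fun φ : ℝ =>
      (1 / 2) * Real.cos ((a - b : ℤ) * φ) - (1 / 2) * Real.cos ((a + b : ℤ) * φ) by
      ext φ; push_cast; rw [sub_mul, add_mul, Real.cos_sub, Real.cos_add]; ring]
    rw [intervalIntegral.integral_sub (Continuous.intervalIntegrable (by fun_prop) _ _)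
      (Continuous.intervalIntegrable (by fun_prop) _ _), intervalIntegral.integral_const_mul,
      intervalIntegral.integral_const_mul, integral_cos_int_mul, integral_cos_int_mul]
    split_ifs <;> ring
  have hsc : ∀ a b : ℤ, ∫ φ in (-Real.pi)..Real.pi, Real.sin (a * φ) * Real.cos (b * φ) = 0 := by
    intro a b
    rw [show (fun φ : ℝ => Real.sin (a * φ) * Real.cos (b * φ)) = fun φ : ℝ =>
      (1 / 2) * Real.sin (((a : ℝ) - b) * φ) + (1 / 2) * Real.sin (((a : ℝ) + b) * φ) by
      ext φ; rw [sub_mul, add_mul, Real.sin_sub, Real.sin_add]; ring]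
    rw [intervalIntegral.integral_add (Continuous.intervalIntegrable (by fun_prop) _ _)
      (Continuous.intervalIntegrable (by fun_prop) _ _), intervalIntegral.integral_const_mul,
      intervalIntegral.integral_const_mul, integral_sin_mul_symm, integral_sin_mul_symm]
    ring
  have hcs : ∀ a b : ℤ, ∫ φ in (-Real.pi)..Real.pi, Real.cos (a * φ) * Real.sin (b * φ) = 0 := by
    intro a b
    simp_rw [mul_comm (Real.cos _)]
    exact hsc b a
  have haz : ∀ m : ℤ, (1 ≤ m ∧ azimuthal m = fun φ => Real.cos (m * φ)) ∨
      (m = 0 ∧ azimuthal m = fun φ => (1 / √2) * Real.cos (m * φ)) ∨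
      (m < 0 ∧ azimuthal m = fun φ => Real.sin ((|m| : ℤ) * φ)) := by
    intro m
    rcases lt_trichotomy m 0 with h | h | h
    · right; right
      refine ⟨h, ?_⟩
      have h1 : ¬ 1 ≤ m := by omega
      ext φ; simp [azimuthal, h.ne, h1]
    · right; left; subst h; refine ⟨rfl, ?_⟩
      ext φ; simp [azimuthal]
    · have h1 : 1 ≤ m := by omega
      left; refine ⟨h, ?_⟩
      ext φ; simp [azimuthal, h1]
  have h2 : (√2)⁻¹ * (√2)⁻¹ = (2 : ℝ)⁻¹ := by rw [← mul_inv, Real.mul_self_sqrt zero_le_two]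
  rcases haz m with ⟨h, e⟩ | ⟨h, e⟩ | ⟨h, e⟩ <;> rcases haz m' with ⟨h', e'⟩ | ⟨h', e'⟩ | ⟨h', e'⟩ <;>
    rw [e, e']
  · have hne : m + m' ≠ 0 := by omega
    rw [hcc]; simp [sub_eq_zero, hne]
  · simp_rw [mul_left_comm (Real.cos _)]
    rw [intervalIntegral.integral_const_mul, hcc]
    have hne : m ≠ 0 := by omega
    simp [h', hne]
  · have hne : m ≠ m' := by omega
    rw [hcs]; simp [hne]
  · simp_rw [mul_assoc]
    rw [intervalIntegral.integral_const_mul, hcc]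
    have hne : m' ≠ 0 := by omega
    simp [h, hne, hne.symm]
  · have hmm : ∀ x y : ℝ, 1 / √2 * x * (1 / √2 * y) = 1 / √2 * (1 / √2) * (x * y) := by
      intros; ring
    simp_rw [hmm]
    rw [intervalIntegral.integral_const_mul, hcc, one_div, h2]
    simp [h, h']
    ring
  · simp_rw [mul_assoc]
    rw [intervalIntegral.integral_const_mul, hcs]
    have hne : 0 ≠ m' := by omega
    simp [h, hne]
  · have hne : m ≠ m' := by omega
    rw [hsc]; simp [hne]
  · simp_rw [mul_left_comm (Real.sin _)]
    rw [intervalIntegral.integral_const_mul, hsc]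
    have hne : m ≠ 0 := by omega
    simp [h', hne]
  · rw [hss, abs_of_neg h, abs_of_neg h', if_neg (by omega : -m + -m' ≠ 0), sub_zero]
    congr 1
    simp only [eq_iff_iff]
    omega

/-! ### The polynomials `∂_z^n (z² - w)^l` -/

section Homogeneous

variable {A B : Type*} [CommRing A] [CommRing B]

/-- The value at `z` of the `n`-th derivative of `(X² - w)^l`. -/
noncomputable def homLeg (l n : ℕ) (z w : A) : A :=
  (derivative^[n] ((X ^ 2 - C w) ^ l)).eval z

lemma map_homLeg (f : A →+* B) (l n : ℕ) (z w : A) :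
    f (homLeg l n z w) = homLeg l n (f z) (f w) := by
  rw [homLeg, homLeg, ← eval_map_apply, ← iterate_derivative_map]
  simp

lemma iterate_derivative_X_mul_derivative (p : A[X]) (n : ℕ) :
    derivative^[n] (X * derivative p) =
      X * derivative^[n + 1] p + (n : A[X]) * derivative^[n] p := by
  rw [mul_comm, iterate_derivative_derivative_mul_X, nsmul_eq_mul, mul_comm X]

/-- For `g(z, w) = ∂_z^(l+m) (z² - w)^l` this reads `g_zz + 4 z g_zw + 4 w g_ww + (6 + 4m) g_w = 0`.
It is the condition for `H(x₀, x₁) g(x₂, |x|²)` to be harmonic when `H` is a plane harmonic of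
degree `m`. -/
lemma homLeg_pde (l m : ℕ) (z w : A) :
    homLeg l (l + m + 2) z w - 4 * l * z * homLeg (l - 1) (l + m + 1) z w
      + 4 * l * ((l - 1 : ℕ) : A) * w * homLeg (l - 2) (l + m) z w
      - (6 + 4 * m) * l * homLeg (l - 1) (l + m) z w = 0 := by
  have c2 : (C 2 : A[X]) = 2 := map_ofNat C 2
  have c4 : (C 4 : A[X]) = 4 := map_ofNat C 4
  have c6 : (C 6 : A[X]) = 6 := map_ofNat C 6
  -- The undifferentiated identity. Applying `∂^(l+m)`, the commutator with `X` adds `4 l (l + m)`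
  -- and turns `(6 - 4l) l` into `(6 + 4m) l`.
  have h0 : derivative (derivative ((X ^ 2 - C w : A[X]) ^ l))
      - C (4 * l : A) * (X * derivative ((X ^ 2 - C w) ^ (l - 1)))
      + C (4 * l * ((l - 1 : ℕ) : A) * w) * (X ^ 2 - C w) ^ (l - 2)
      - C ((6 - 4 * l) * l : A) * (X ^ 2 - C w) ^ (l - 1) = 0 := by
    rcases l with _ | _ | l
    · simp
    · simp [c4, c6]; ring
    · simp only [derivative_mul, derivative_pow, derivative_sub, derivative_C, derivative_X]
      simp [c2, c4, c6]
      ring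
  have h1 := congrArg (fun p => (derivative^[l + m] p).eval z) h0
  simp only [iterate_derivative_sub, iterate_map_add, iterate_derivative_C_mul,
    iterate_derivative_X_mul_derivative, iterate_derivative_zero, eval_sub, eval_add, eval_mul,
    eval_C, eval_X, eval_natCast, eval_zero] at h1
  rw [← Function.iterate_succ_apply, ← Function.iterate_succ_apply] at h1
  change homLeg l (l + m + 2) z w - 4 * l * (z * homLeg (l - 1) (l + m + 1) z w +
    ((l + m : ℕ) : A) * homLeg (l - 1) (l + m) z w) + 4 * l * ((l - 1 : ℕ) : A) * w *
    homLeg (l - 2) (l + m) z w - (6 - 4 * l) * l * homLeg (l - 1) (l + m) z w = 0 at h1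
  rw [← h1]
  push_cast
  ring

/-- Euler's identity `z g_z + 2 w g_w = (2l - n) g` for `z` of weight `1` and `w` of weight `2`. -/
lemma homLeg_euler (l n : ℕ) (z w : A) :
    z * homLeg l (n + 1) z w - 2 * l * w * homLeg (l - 1) n z w =
      (2 * l - n) * homLeg l n z w := by
  have c2 : (C 2 : A[X]) = 2 := map_ofNat C 2
  have h0 : X * derivative ((X ^ 2 - C w : A[X]) ^ l) - C (2 * l * w) * (X ^ 2 - C w) ^ (l - 1)
      - C (2 * l : A) * (X ^ 2 - C w) ^ l = 0 := by
    rcases l with _ | l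
    · simp
    · simp only [derivative_pow, derivative_sub, derivative_C, derivative_X]
      simp [c2]
      ring
  have h1 := congrArg (fun p => (derivative^[n] p).eval z) h0
  simp only [iterate_derivative_sub, iterate_derivative_C_mul,
    iterate_derivative_X_mul_derivative, iterate_derivative_zero, eval_sub, eval_add, eval_mul,
    eval_C, eval_X, eval_natCast, eval_zero] at h1
  change z * homLeg l (n + 1) z w + n * homLeg l n z w - 2 * l * w * homLeg (l - 1) n z w
    - 2 * l * homLeg l n z w = 0 at h1
  linear_combination h1

variable [Algebra ℝ A]

/-- The chain rule when the coefficients vary too: `q` is `p` with `D` applied to each coefficient.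
-/
lemma derivation_eval (D : Derivation ℝ A A) {p q : A[X]} (h : ∀ i, q.coeff i = D (p.coeff i))
    (z : A) : D (p.eval z) = q.eval z + (derivative p).eval z * D z := by
  have hp : p.natDegree < max p.natDegree q.natDegree + 1 := by omega
  have hq : q.natDegree < max p.natDegree q.natDegree + 1 := by omega
  rw [eval_eq_sum_range' hp, eval_eq_sum_range' hq, derivative_eval,
    sum_over_range' _ (by simp) _ hp, map_sum, Finset.sum_mul, ← Finset.sum_add_distrib]
  refine Finset.sum_congr rfl fun i _ => ?_
  rw [h, D.leibniz, D.leibniz_pow]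
  simp only [smul_eq_mul, nsmul_eq_mul]
  ring

lemma coeff_derivative_of_coeff (D : Derivation ℝ A A) {p q : A[X]}
    (h : ∀ i, q.coeff i = D (p.coeff i)) (n i : ℕ) :
    (derivative^[n] q).coeff i = D ((derivative^[n] p).coeff i) := by
  rw [coeff_iterate_derivative, coeff_iterate_derivative, h, map_nsmul]

lemma coeff_X_sq_sub_C_pow (D : Derivation ℝ A A) (w : A) (l i : ℕ) :
    (C (-l * D w) * (X ^ 2 - C w) ^ (l - 1)).coeff i = D (((X ^ 2 - C w) ^ l).coeff i) := by
  induction l generalizing i with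
  | zero =>
    simp only [pow_zero, coeff_one]
    split_ifs <;> simp
  | succ l ih =>
    have h1 : C (-(l + 1 : ℕ) * D w) * (X ^ 2 - C w) ^ (l + 1 - 1) =
        (C (-l * D w) * (X ^ 2 - C w) ^ (l - 1)) * X ^ 2 -
        (C (-l * D w) * (X ^ 2 - C w) ^ (l - 1)) * C w - (X ^ 2 - C w) ^ l * C (D w) := by
      rcases l with _ | l
      · simp
      · simp; ring
    have h2 : (X ^ 2 - C w) ^ (l + 1) = (X ^ 2 - C w) ^ l * X ^ 2 - (X ^ 2 - C w) ^ l * C w := by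
      ring
    rw [h1, h2, coeff_sub, coeff_sub, coeff_sub, coeff_mul_C, coeff_mul_C, coeff_mul_C,
      coeff_mul_X_pow', coeff_mul_X_pow', map_sub, D.leibniz]
    simp only [ih]
    split_ifs
    · simp only [smul_eq_mul]; ring
    · simp only [smul_eq_mul, map_zero]; ring

lemma derivation_homLeg (D : Derivation ℝ A A) (l n : ℕ) (z w : A) :
    D (homLeg l n z w) = homLeg l (n + 1) z w * D z - l * homLeg (l - 1) n z w * D w := by
  rw [homLeg, derivation_eval D (coeff_derivative_of_coeff D (coeff_X_sq_sub_C_pow D w l) n),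
    iterate_derivative_C_mul, homLeg, homLeg, Function.iterate_succ_apply', eval_mul, eval_C]
  ring

/-- The expansion of `∂_z^n (z² - w)^l` in powers of `z`. -/
lemma homLeg_expand (l n : ℕ) (h : n ≤ 2 * l) :
    ∃ (c : ℝ) (q : ℕ → ℝ[X]), c ≠ 0 ∧ ∀ (A : Type) [CommRing A] [Algebra ℝ A] (z w : A),
      homLeg l n z w = algebraMap ℝ A c * z ^ (2 * l - n) +
        ∑ i ∈ Finset.range (2 * l - n), aeval w (q i) * z ^ i := by
  -- The generic case: the inner variable stands for `w` and is specialized by `aeval w`. The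
  -- polynomial `X² - w` is monic, so the leading coefficient of `P` is a constant.
  set P : ℝ[X][X] := derivative^[n] ((X ^ 2 - C X) ^ l) with hP
  refine ⟨(2 * l).descFactorial n, P.coeff, ?_, ?_⟩
  · rw [Nat.cast_ne_zero]
    exact (Nat.descFactorial_pos.2 h).ne'
  · intro A _ _ z w
    have h1 : homLeg l n z w = (P.map (aeval w : ℝ[X] →ₐ[ℝ] A).toRingHom).eval z := by
      rw [hP, ← iterate_derivative_map, homLeg]; simp
    have h2 : (P.map (aeval w : ℝ[X] →ₐ[ℝ] A).toRingHom).natDegree < 2 * l - n + 1 := by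
      refine (natDegree_map_le.trans ((natDegree_iterate_derivative _ n).trans ?_)).trans_lt
        (Nat.lt_succ_self _)
      rw [natDegree_X_sq_sub_C_pow]
    have h3 := monic_X_sq_sub_C_pow (X : ℝ[X]) l
    rw [Monic, leadingCoeff, natDegree_X_sq_sub_C_pow] at h3
    rw [h1, eval_eq_sum_range' h2, Finset.sum_range_succ, add_comm]
    congr 1
    · rw [coeff_map, hP, coeff_iterate_derivative, Nat.sub_add_cancel h, h3]
      simp
    · refine Finset.sum_congr rfl fun i _ => ?_
      rw [coeff_map]; rfl

end Homogeneous

/-- Homogeneity of `∂_z^n (z² - w)^l`. -/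
lemma homLeg_smul (l n : ℕ) (h : n ≤ 2 * l) (a z w : ℝ) :
    homLeg l n (a * z) (a ^ 2 * w) = a ^ (2 * l - n) * homLeg l n z w := by
  have h1 : ∀ (p : ℝ[X]) (n : ℕ), derivative^[n] (p.comp (C a * X)) =
      C (a ^ n) * (derivative^[n] p).comp (C a * X) := by
    intro p n
    induction n with
    | zero => simp
    | succ n ih =>
      rw [Function.iterate_succ_apply', ih, Function.iterate_succ_apply', derivative_C_mul,
        derivative_comp]
      simp; ring
  have h2 : ((X ^ 2 - C (a ^ 2 * w)) ^ l : ℝ[X]).comp (C a * X) =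
      C (a ^ (2 * l)) * (X ^ 2 - C w : ℝ[X]) ^ l := by
    simp only [pow_comp, sub_comp, X_comp, C_comp]
    rw [pow_mul a, C_pow (a := a ^ 2), ← mul_pow, C_mul, C_pow]
    congr 1; ring
  have h3 : a ^ n * homLeg l n (a * z) (a ^ 2 * w) =
      a ^ n * (a ^ (2 * l - n) * homLeg l n z w) := by
    have := congrArg (eval z) (h1 ((X ^ 2 - C (a ^ 2 * w)) ^ l : ℝ[X]) n)
    rw [h2, iterate_derivative_C_mul] at this
    simp only [eval_mul, eval_C, eval_comp, eval_X] at this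
    rw [homLeg, ← this, ← mul_assoc, ← pow_add, Nat.add_sub_cancel' h, homLeg]
  -- The factor `a ^ n` in `h3` cancels only for `a ≠ 0`. For `a = 0` both sides vanish, unless `n =
  -- 2l`, when the polynomial is constant.
  rcases eq_or_ne a 0 with rfl | hr
  · rcases h.eq_or_lt with rfl | h'
    · obtain ⟨c, q, -, hq⟩ := homLeg_expand l (2 * l) le_rfl
      rw [hq, hq]; simp
    · have hl : (X ^ 2 - C ((0 : ℝ) ^ 2 * w) : ℝ[X]) ^ l = X ^ (2 * l) := by simp [pow_mul]
      have h5 : 2 * l - n ≠ 0 := by omega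
      rw [homLeg, hl, iterate_derivative_X_pow_eq_C_mul]
      simp [h5]
  · exact mul_left_cancel₀ (pow_ne_zero n hr) h3

/-- The homogenization of the derivatives of `(t² - 1)^l`. -/
lemma homLeg_mul (l n : ℕ) (h : n ≤ 2 * l) (r t : ℝ) :
    homLeg l n (r * t) (r ^ 2) =
      r ^ (2 * l - n) * (derivative^[n] ((X ^ 2 - 1 : ℝ[X]) ^ l)).eval t := by
  have := homLeg_smul l n h r t 1
  rw [mul_one] at this
  rw [this, homLeg, C_1]

/-! ### Solid harmonics -/

open MvPolynomial in
/-- The real and the imaginary part of `(x₀ + i x₁)^m`. -/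
noncomputable def planePow : ℕ → MvPolynomial (Fin 3) ℝ × MvPolynomial (Fin 3) ℝ
  | 0 => (1, 0)
  | m + 1 => (X 0 * (planePow m).1 - X 1 * (planePow m).2,
      X 0 * (planePow m).2 + X 1 * (planePow m).1)

namespace planePow

open MvPolynomial

lemma pderiv_two (m : ℕ) : pderiv 2 (planePow m).1 = 0 ∧ pderiv 2 (planePow m).2 = 0 := by
  induction m with
  | zero => simp [planePow]
  | succ m ih => simp [planePow, ih.1, ih.2]

lemma cauchy_riemann (m : ℕ) : pderiv 0 (planePow m).1 = pderiv 1 (planePow m).2 ∧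
    pderiv 1 (planePow m).1 = - pderiv 0 (planePow m).2 := by
  induction m with
  | zero => simp [planePow]
  | succ m ih =>
    simp only [planePow, map_add, map_sub, pderiv_mul, ih.1, ih.2]
    rw [pderiv_X_self, pderiv_X_self, pderiv_X_of_ne (by decide), pderiv_X_of_ne (by decide)]
    constructor <;> ring

lemma euler (m : ℕ) :
    X 0 * pderiv 0 (planePow m).1 + X 1 * pderiv 1 (planePow m).1 =
      (m : MvPolynomial (Fin 3) ℝ) * (planePow m).1 ∧
    X 0 * pderiv 0 (planePow m).2 + X 1 * pderiv 1 (planePow m).2 =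
      (m : MvPolynomial (Fin 3) ℝ) * (planePow m).2 := by
  induction m with
  | zero => simp [planePow]
  | succ m ih =>
    simp only [planePow, map_add, map_sub, pderiv_mul]
    rw [pderiv_X_self, pderiv_X_self, pderiv_X_of_ne (by decide), pderiv_X_of_ne (by decide)]
    push_cast
    constructor
    · linear_combination X 0 * ih.1 - X 1 * ih.2
    · linear_combination X 0 * ih.2 + X 1 * ih.1

end planePow

section Solid

open MvPolynomial

/-- The commutator of two derivations is a derivation, and this one kills the variables. -/
lemma pderiv_comm (i j : Fin 3) (p : MvPolynomial (Fin 3) ℝ) :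
    pderiv i (pderiv j p) = pderiv j (pderiv i p) := by
  have h : ⁅pderiv (R := ℝ) i, pderiv (R := ℝ) j⁆ = 0 := by
    apply MvPolynomial.derivation_ext
    intro k
    rw [Derivation.commutator_apply]
    simp only [pderiv_X]
    have : ∀ i j : Fin 3, pderiv i (Pi.single (M := fun _ => MvPolynomial (Fin 3) ℝ) j 1 k) = 0 := by
      intro i j
      by_cases h : k = j
      · subst h; simp
      · simp [h]
    rw [this, this]; simp
  have := congrArg (fun D => D p) h
  simpa [Derivation.commutator_apply, sub_eq_zero] using this

/-- The plane harmonic of index `m`. -/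
noncomputable def planeHarm (m : ℤ) : MvPolynomial (Fin 3) ℝ :=
  if 0 ≤ m then (planePow m.natAbs).1 else (planePow m.natAbs).2

lemma planeHarm_euler (m : ℤ) :
    X 0 * pderiv 0 (planeHarm m) + X 1 * pderiv 1 (planeHarm m) =
      (m.natAbs : MvPolynomial (Fin 3) ℝ) * planeHarm m := by
  unfold planeHarm
  split_ifs
  · exact (planePow.euler _).1
  · exact (planePow.euler _).2

lemma planeHarm_pderiv_two (m : ℤ) : pderiv 2 (planeHarm m) = 0 := by
  unfold planeHarm
  split_ifs
  · exact (planePow.pderiv_two _).1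
  · exact (planePow.pderiv_two _).2

lemma planeHarm_harmonic (m : ℤ) :
    pderiv 0 (pderiv 0 (planeHarm m)) + pderiv 1 (pderiv 1 (planeHarm m)) = 0 := by
  unfold planeHarm
  obtain ⟨h1, h2⟩ := planePow.cauchy_riemann m.natAbs
  split_ifs
  · rw [h1, h2, map_neg, pderiv_comm 0 1]; ring
  · rw [← h1, pderiv_comm 1 0, h2, map_neg]; ring

/-- The polynomial `x₀² + x₁² + x₂²`. -/
noncomputable def normSqPoly : MvPolynomial (Fin 3) ℝ := X 0 ^ 2 + X 1 ^ 2 + X 2 ^ 2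

/-- The solid harmonic of index `(l, m)`, up to normalization. -/
noncomputable def solidHarm (l : ℕ) (m : ℤ) : MvPolynomial (Fin 3) ℝ :=
  planeHarm m * homLeg l (l + m.natAbs) (X 2) normSqPoly

lemma pderiv_normSqPoly (i : Fin 3) : pderiv i normSqPoly = 2 * X i := by
  unfold normSqPoly
  fin_cases i <;> simp [pderiv_X]

lemma pderiv_homLeg (i : Fin 3) (l n : ℕ) : pderiv i (homLeg l n (X 2) normSqPoly) =
    homLeg l (n + 1) (X 2) normSqPoly * (if i = 2 then 1 else 0) -
      2 * (l : MvPolynomial (Fin 3) ℝ) * X i * homLeg (l - 1) n (X 2) normSqPoly := by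
  rw [derivation_homLeg, pderiv_normSqPoly, pderiv_X]
  simp only [Pi.single_apply, eq_comm]
  ring

lemma solidHarm_euler (l : ℕ) (m : ℤ) :
    ∑ i, X i * pderiv i (solidHarm l m) = (l : MvPolynomial (Fin 3) ℝ) * solidHarm l m := by
  have h1 := planeHarm_euler m
  have h2 := homLeg_euler l (l + m.natAbs) (X 2) normSqPoly
  rw [Fin.sum_univ_three]
  simp only [solidHarm, pderiv_mul, pderiv_homLeg, planeHarm_pderiv_two]
  simp only [Fin.reduceEq, if_true, if_false]
  push_cast at h2
  have h3 : normSqPoly = X 0 ^ 2 + X 1 ^ 2 + X 2 ^ 2 := rfl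
  generalize homLeg l (l + m.natAbs) (X 2) normSqPoly = g at *
  generalize homLeg l (l + m.natAbs + 1) (X 2) normSqPoly = g' at *
  generalize homLeg (l - 1) (l + m.natAbs) (X 2) normSqPoly = g'' at *
  rw [h3] at h2
  linear_combination g * h1 + planeHarm m * h2

lemma solidHarm_harmonic (l : ℕ) (m : ℤ) :
    ∑ i, pderiv i (pderiv i (solidHarm l m)) = 0 := by
  have h1 := planeHarm_euler m
  have h2 := planeHarm_harmonic m
  have h3 := homLeg_pde l m.natAbs (X 2) normSqPoly
  have h4 : normSqPoly = X 0 ^ 2 + X 1 ^ 2 + X 2 ^ 2 := rfl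
  have c2 : ∀ i : Fin 3, pderiv i (2 : MvPolynomial (Fin 3) ℝ) = 0 := fun i => by
    exact_mod_cast (pderiv (R := ℝ) i).map_natCast 2
  rw [Fin.sum_univ_three]
  simp only [solidHarm, pderiv_mul, pderiv_homLeg, planeHarm_pderiv_two, map_add, map_sub,
    Derivation.map_natCast, pderiv_X, map_zero, c2]
  simp only [Fin.reduceEq, if_true, if_false, Pi.single_eq_same, pderiv_one, map_zero]
  rw [show l - 1 - 1 = l - 2 by omega]
  generalize homLeg l (l + m.natAbs) (X 2) normSqPoly = g at *
  generalize homLeg l (l + m.natAbs + 1) (X 2) normSqPoly = gz at *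
  generalize homLeg l (l + m.natAbs + 1 + 1) (X 2) normSqPoly = gzz at *
  generalize homLeg (l - 1) (l + m.natAbs) (X 2) normSqPoly = gw at *
  generalize homLeg (l - 1) (l + m.natAbs + 1) (X 2) normSqPoly = gzw at *
  generalize homLeg (l - 2) (l + m.natAbs) (X 2) normSqPoly = gww at *
  rw [h4] at h3
  -- The product rule for `Δ(H g)`. In the cross term `2 ∇H · ∇g`, the plane part of `∇g` is `2 x
  -- g_w` with `g_w = -l gw`, so Euler's identity for `H` evaluates it.
  linear_combination g * h2 + planeHarm m * h3 - 4 * l * gw * h1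

end Solid

/-! ### A closed formula for the Arar-Boulmezaoud functions -/

/-- The square root of the conformal factor `2 / (1 + |x|²)`. -/
noncomputable def sig (x : R3) : ℝ := √(2 / (‖x‖ ^ 2 + 1))

lemma sig_sq (x : R3) : sig x ^ 2 = 2 / (‖x‖ ^ 2 + 1) := Real.sq_sqrt (by positivity)

lemma sig_pos (x : R3) : 0 < sig x := Real.sqrt_pos.2 (by positivity)

lemma sig_sq_mul (x : R3) : sig x ^ 2 * (‖x‖ ^ 2 + 1) = 2 := by
  rw [sig_sq]; field_simp

lemma norm_sq_eq (x : R3) : ‖x‖ ^ 2 = x 0 ^ 2 + x 1 ^ 2 + x 2 ^ 2 := by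
  rw [EuclideanSpace.real_norm_sq_eq, Fin.sum_univ_three]

lemma eval_planePow (m : ℕ) (x : R3) :
    MvPolynomial.eval x.ofLp (planePow m).1 = ((⟨x 0, x 1⟩ : ℂ) ^ m).re ∧
    MvPolynomial.eval x.ofLp (planePow m).2 = ((⟨x 0, x 1⟩ : ℂ) ^ m).im := by
  induction m with
  | zero => simp [planePow]
  | succ m ih =>
    simp only [planePow, map_add, map_sub, map_mul, MvPolynomial.eval_X, ih.1, ih.2, pow_succ',
      Complex.mul_re, Complex.mul_im, and_self]

/-- The constant factor of `azimuthal m` relative to the real or imaginary part of `e^{i|m|φ}`. -/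
noncomputable def azConst (m : ℤ) : ℝ := if m = 0 then 1 / √2 else 1

lemma azConst_pos (m : ℤ) : 0 < azConst m := by
  unfold azConst; split_ifs <;> positivity

lemma azimuthal_mul_pow (m : ℤ) (z : ℂ) (x : R3) (hz : z = ⟨x 0, x 1⟩) :
    ‖z‖ ^ m.natAbs * azimuthal m z.arg =
      azConst m * MvPolynomial.eval x.ofLp (planeHarm m) := by
  have h : z ^ m.natAbs = (‖z‖ ^ m.natAbs : ℝ) *
      (Real.cos (m.natAbs * z.arg) + Real.sin (m.natAbs * z.arg) * Complex.I) := by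
    conv_lhs => rw [← Complex.norm_mul_exp_arg_mul_I z, mul_pow, ← Complex.exp_nat_mul,
      ← mul_assoc, Complex.exp_mul_I]
    push_cast
    rfl
  have hre : (z ^ m.natAbs).re = ‖z‖ ^ m.natAbs * Real.cos (m.natAbs * z.arg) := by
    rw [h, Complex.re_ofReal_mul]; simp [-Complex.ofReal_cos, -Complex.ofReal_sin]
  have him : (z ^ m.natAbs).im = ‖z‖ ^ m.natAbs * Real.sin (m.natAbs * z.arg) := by
    rw [h, Complex.im_ofReal_mul]; simp [-Complex.ofReal_cos, -Complex.ofReal_sin]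
  rw [hz] at hre him
  rcases lt_trichotomy m 0 with h | h | h
  · rw [planeHarm, if_neg (by omega), (eval_planePow _ x).2, him, ← hz, azimuthal,
      if_neg (by omega), if_neg h.ne, azConst, if_neg h.ne, one_mul, Nat.cast_natAbs]
  · subst h; simp [planeHarm, planePow, azimuthal, azConst]
  · rw [planeHarm, if_pos (by omega), (eval_planePow _ x).1, hre, ← hz, azimuthal,
      if_pos (by omega), azConst, if_neg h.ne', one_mul, Nat.cast_natAbs, abs_of_pos h]

/-- The derivative of order `l + 1` of the Chebyshev polynomial `T_{k+1}`. -/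
noncomputable def chebD (k l : ℕ) : ℝ[X] := derivative^[l + 1] (Chebyshev.T ℝ (k + 1 : ℕ))

/-- The constant factor in the closed formula for `abW k l m`. -/
noncomputable def abConst (k l : ℕ) (m : ℤ) : ℝ :=
  1 / √(normConst k l) * √((2 * l + 1) / (2 * Real.pi)) *
    √(((l - m.natAbs).factorial : ℝ) / ((l + m.natAbs).factorial : ℝ)) /
    (2 ^ l * (l.factorial : ℝ)) * azConst m

lemma normConst_pos (k l : ℕ) : 0 < normConst k l := by
  unfold normConst; positivity

lemma abConst_pos (k l : ℕ) (m : ℤ) : 0 < abConst k l m := by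
  have := normConst_pos k l
  have := azConst_pos m
  unfold abConst
  positivity

lemma eval_normSqPoly (x : R3) : MvPolynomial.eval x.ofLp normSqPoly = ‖x‖ ^ 2 := by
  rw [norm_sq_eq]; simp [normSqPoly]

/-- The closed formula for the Arar-Boulmezaoud functions, valid everywhere. -/
lemma abW_eq {k l : ℕ} {m : ℤ} (hm : m.natAbs ≤ l) (x : R3) :
    abW k l m x = abConst k l m * sig x ^ (2 * l + 1) * (chebD k l).eval (1 - sig x ^ 2) *
      MvPolynomial.eval x.ofLp (solidHarm l m) := by
  set r := ‖x‖ with hr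
  set ρ := sig x ^ 2 with hρ
  have hρ' : ρ = 2 / (r ^ 2 + 1) := sig_sq x
  have hρ0 : 0 < ρ := pow_pos (sig_pos x) 2
  have hr0 : 0 ≤ r := norm_nonneg x
  have hρr : ρ * (r ^ 2 + 1) = 2 := sig_sq_mul x
  set t := x 2 / r with ht
  -- At the origin, division by zero gives `t = 0`, and then `r t = x 2` still holds, so no case
  -- distinction survives below.
  have hrt : r * t = x 2 := by
    rcases eq_or_ne r 0 with h | h
    · have := norm_sq_eq x
      rw [← hr, h] at this
      have h2 : x 2 ^ 2 = 0 := by nlinarith [sq_nonneg (x 0), sq_nonneg (x 1), sq_nonneg (x 2)]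
      rw [h, pow_eq_zero_iff two_ne_zero |>.1 h2, zero_mul]
    · rw [ht]; field_simp
  have ht1 : t ^ 2 ≤ 1 := by
    rcases eq_or_ne r 0 with h | h
    · rw [ht, h]; simp
    · rw [ht, div_pow, div_le_one (by positivity), norm_sq_eq]
      nlinarith [sq_nonneg (x 0), sq_nonneg (x 1)]
  have hx0 : invStereo x 0 = ρ * x 0 := by simp [invStereo, hρ']; ring
  have hx1 : invStereo x 1 = ρ * x 1 := by simp [invStereo, hρ']; ring
  have hx2 : invStereo x 2 = ρ * x 2 := by simp [invStereo, hρ']; ring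
  have hx3 : invStereo x 3 = 1 - ρ := by
    have : (r ^ 2 + 1) ≠ 0 := by positivity
    simp [invStereo, hρ']; rw [← hr]; field_simp; ring
  have hρ2 : ρ ≤ 2 := by nlinarith [mul_nonneg hρ0.le (sq_nonneg r)]
  have hcosχ : Real.cos (angleChi (invStereo x)) = 1 - ρ := by
    rw [angleChi, hx3, Real.cos_arccos (by linarith) (by linarith)]
  have hsinχ : Real.sin (angleChi (invStereo x)) = ρ * r := by
    -- Here `1 - (1 - ρ)² = ρ (2 - ρ)`, and `ρ (r² + 1) = 2` gives `2 - ρ = ρ r²`.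
    rw [angleChi, hx3, Real.sin_arccos, show 1 - (1 - ρ) ^ 2 = (ρ * r) ^ 2 by nlinarith,
      Real.sqrt_sq (by positivity)]
  have hcosθ : Real.cos (angleTheta (invStereo x)) = t := by
    have : √(invStereo x 0 ^ 2 + invStereo x 1 ^ 2 + invStereo x 2 ^ 2) = ρ * r := by
      rw [hx0, hx1, hx2, show (ρ * x 0) ^ 2 + (ρ * x 1) ^ 2 + (ρ * x 2) ^ 2 = (ρ * r) ^ 2 by
        rw [mul_pow ρ r, norm_sq_eq]; ring, Real.sqrt_sq (by positivity)]
    have h2 : invStereo x 2 / (ρ * r) = t := by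
      rw [hx2, mul_div_mul_left _ _ hρ0.ne']
    rw [angleTheta, this, h2, Real.cos_arccos (by nlinarith) (by nlinarith)]
  have hφ : anglePhi (invStereo x) = Complex.arg ⟨x 0, x 1⟩ := by
    rw [anglePhi, hx0, hx1, show (⟨ρ * x 0, ρ * x 1⟩ : ℂ) = ρ * ⟨x 0, x 1⟩ by
      apply Complex.ext <;> simp, Complex.arg_real_mul _ hρ0]
  have hnorm : ‖(⟨x 0, x 1⟩ : ℂ)‖ = r * √(1 - t ^ 2) := by
    rw [Complex.norm_def, Complex.normSq_mk, ← Real.sqrt_sq hr0, Real.sqrt_sq hr0]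
    have h1 : x 0 * x 0 + x 1 * x 1 = r ^ 2 * (1 - t ^ 2) := by
      rw [mul_sub, ← mul_pow, hrt, norm_sq_eq]; ring
    rw [h1, Real.sqrt_mul (sq_nonneg r), Real.sqrt_sq hr0]
  have haz := azimuthal_mul_pow m ⟨x 0, x 1⟩ x rfl
  rw [hnorm] at haz
  have hleg := homLeg_mul l (l + m.natAbs) (by omega) r t
  rw [hrt, show 2 * l - (l + m.natAbs) = l - m.natAbs by omega] at hleg
  have hsolid : MvPolynomial.eval x.ofLp (solidHarm l m) =
      MvPolynomial.eval x.ofLp (planeHarm m) * homLeg l (l + m.natAbs) (x 2) (r ^ 2) := by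
    rw [solidHarm, map_mul, map_homLeg, eval_normSqPoly, MvPolynomial.eval_X]
  rw [abW, harmY, sphHarm3, sphHarm2, legendreK, legendreP, hcosχ, hsinχ, hcosθ, hφ, hsolid, hleg]
  change sig x * _ = _
  -- The part `r^|m|` goes with the plane harmonic, the part `r^(l-|m|)` homogenizes the Legendre
  -- polynomial.
  have hrl : r ^ l = r ^ m.natAbs * r ^ (l - m.natAbs) := by
    rw [← pow_add, Nat.add_sub_cancel' hm]
  have hsig : sig x ^ (2 * l + 1) = sig x * ρ ^ l := by rw [hρ, ← pow_mul]; ring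
  have hneg : ((-1 : ℝ) ^ m.natAbs) * (-1) ^ m.natAbs = 1 := by
    rw [← mul_pow]; simp
  rw [hsig, mul_pow, hrl, abConst, chebD]
  push_cast
  rw [mul_pow] at haz
  set e := eval t (derivative^[l + m.natAbs] ((X ^ 2 - 1 : ℝ[X]) ^ l))
  set F := eval (1 - ρ) (derivative^[l + 1] (Chebyshev.T ℝ (k + 1)))
  generalize MvPolynomial.eval x.ofLp (planeHarm m) = H at haz ⊢
  generalize azimuthal m _ = α at haz ⊢
  generalize √(1 - t ^ 2) ^ m.natAbs = s at haz ⊢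
  generalize r ^ m.natAbs = r' at haz ⊢
  generalize r ^ (l - m.natAbs) = r'' at haz ⊢
  generalize √(((l - m.natAbs).factorial : ℝ) / ((l + m.natAbs).factorial : ℝ)) = u
  generalize √((2 * (l : ℝ) + 1) / (2 * Real.pi)) = v
  generalize (2 ^ l * (l.factorial : ℝ)) = y
  generalize 1 / √(normConst k l) = a
  generalize (-1 : ℝ) ^ m.natAbs = ε at hneg ⊢
  linear_combination sig x * a * ρ ^ l * r'' * F * v * u / y * e * ((ε * ε) * haz + azConst m * H * hneg)

/-! ### Partial derivatives -/

/-- The partial derivative of `f` in the direction of the `i`-th coordinate. -/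
noncomputable def pd (i : Fin 3) (f : R3 → ℝ) (x : R3) : ℝ :=
  fderiv ℝ f x (EuclideanSpace.single i 1)

lemma gradient_apply (f : R3 → ℝ) (x : R3) (i : Fin 3) : gradient f x i = pd i f x := by
  have h : inner ℝ (gradient f x) (EuclideanSpace.single i (1 : ℝ)) = pd i f x := by
    rw [gradient, InnerProductSpace.toDual_symm_apply, pd]
  rw [← h, EuclideanSpace.inner_single_right]
  simp

lemma pd_mul {f g : R3 → ℝ} {x : R3} (hf : DifferentiableAt ℝ f x) (hg : DifferentiableAt ℝ g x)
    (i : Fin 3) : pd i (fun y => f y * g y) x = pd i f x * g x + f x * pd i g x := by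
  rw [pd, fderiv_fun_mul hf hg]
  simp [pd]; ring

lemma pd_add {f g : R3 → ℝ} {x : R3} (hf : DifferentiableAt ℝ f x) (hg : DifferentiableAt ℝ g x)
    (i : Fin 3) : pd i (fun y => f y + g y) x = pd i f x + pd i g x := by
  rw [pd, fderiv_fun_add hf hg]
  simp [pd]

lemma pd_const (c : ℝ) (i : Fin 3) (x : R3) : pd i (fun _ => c) x = 0 := by
  simp [pd]

lemma pd_const_mul {f : R3 → ℝ} {x : R3} (hf : DifferentiableAt ℝ f x) (c : ℝ)
    (i : Fin 3) : pd i (fun y => c * f y) x = c * pd i f x := by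
  rw [pd_mul (by fun_prop) hf, pd_const]; ring

lemma pd_coord (i j : Fin 3) (x : R3) : pd i (fun y => y j) x = if j = i then 1 else 0 := by
  have : (fun y : R3 => y j) = EuclideanSpace.proj (𝕜 := ℝ) j := rfl
  rw [pd, this, ContinuousLinearMap.fderiv]
  simp

lemma contDiff_pd {f : R3 → ℝ} (hf : ContDiff ℝ ∞ f) (i : Fin 3) : ContDiff ℝ ∞ (pd i f) := by
  have h : ContDiff ℝ ∞ (fderiv ℝ f) := hf.fderiv_right (by simp)
  exact h.clm_apply contDiff_const

lemma contDiff_coord (j : Fin 3) : ContDiff ℝ ∞ (fun y : R3 => y j) :=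
  (EuclideanSpace.proj (𝕜 := ℝ) j).contDiff

lemma contDiff_mvEval (p : MvPolynomial (Fin 3) ℝ) :
    ContDiff ℝ ∞ (fun x : R3 => MvPolynomial.eval x.ofLp p) := by
  induction p using MvPolynomial.induction_on with
  | C a => simpa using contDiff_const
  | add p q hp hq => simpa using hp.add hq
  | mul_X p i hp => simpa using hp.mul (contDiff_coord i)

lemma pd_mvEval (p : MvPolynomial (Fin 3) ℝ) (i : Fin 3) (x : R3) :
    pd i (fun x : R3 => MvPolynomial.eval x.ofLp p) x =
      MvPolynomial.eval x.ofLp (MvPolynomial.pderiv i p) := by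
  have hd : ∀ q : MvPolynomial (Fin 3) ℝ,
      DifferentiableAt ℝ (fun x : R3 => MvPolynomial.eval x.ofLp q) x :=
    fun q => (contDiff_mvEval q).differentiable (by simp) x
  induction p using MvPolynomial.induction_on with
  | C a => simp [pd_const]
  | add p q hp hq =>
    simp only [map_add]
    rw [pd_add (hd p) (hd q), hp, hq]
  | mul_X p j hp =>
    simp only [map_mul, MvPolynomial.eval_X, MvPolynomial.pderiv_mul, map_add]
    rw [pd_mul (hd p) ((contDiff_coord j).differentiable (by simp) x), hp, pd_coord]
    rw [MvPolynomial.pderiv_X]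
    by_cases h : j = i
    · subst h; simp
    · simp [h]

/-! ### The conformal factor -/

lemma contDiff_sig : ContDiff ℝ ∞ sig := by
  have h : ContDiff ℝ ∞ (fun x : R3 => 2 / (‖x‖ ^ 2 + 1)) :=
    contDiff_const.div ((contDiff_norm_sq ℝ).add contDiff_const) fun x => by positivity
  exact h.sqrt fun x => by positivity

lemma differentiableAt_sig (x : R3) : DifferentiableAt ℝ sig x :=
  contDiff_sig.differentiable (by simp) x

/-- Obtained by differentiating `σ² (|x|² + 1) = 2`, which avoids the square root. -/
lemma pd_sig (i : Fin 3) (x : R3) : pd i sig x = -(1 / 2) * sig x ^ 3 * x i := by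
  have h1 : (fun y : R3 => (sig y * sig y) *
      (MvPolynomial.eval y.ofLp (normSqPoly + 1))) = fun _ => (2 : ℝ) := by
    ext y
    rw [map_add, eval_normSqPoly, map_one, ← sq, sig_sq_mul]
  have h2 := congrArg (fun f => pd i f x) h1
  have hs := differentiableAt_sig x
  simp only at h2
  rw [pd_mul (hs.fun_mul hs) ((contDiff_mvEval _).differentiable (by simp) x), pd_mul hs hs,
    pd_mvEval, pd_const, map_add (MvPolynomial.pderiv i), pderiv_normSqPoly,
    MvPolynomial.pderiv_one] at h2
  simp only [map_add, map_mul, map_ofNat, eval_normSqPoly, map_one, MvPolynomial.eval_X,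
    add_zero] at h2
  have h3 := sig_sq_mul x
  have h4 := sig_pos x
  have h5 : 4 * (pd i sig x) = 4 * (-(1 / 2) * sig x ^ 3 * x i) := by
    linear_combination sig x * h2 - 2 * pd i sig x * h3
  linarith

lemma differentiableAt_polySig (p : ℝ[X]) (x : R3) :
    DifferentiableAt ℝ (fun y => p.eval (sig y)) x :=
  p.differentiableAt.comp x (differentiableAt_sig x)

lemma contDiff_polySig (p : ℝ[X]) : ContDiff ℝ ∞ (fun y => p.eval (sig y)) :=
  (by simpa using p.contDiff_aeval (𝕜 := ℝ) ∞ : ContDiff ℝ ∞ fun x => p.eval x).comp contDiff_sig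

/-- The polynomial `q` with `∂ᵢ (p(σ)) = xᵢ q(σ)`. -/
noncomputable def sigD (p : ℝ[X]) : ℝ[X] := C (-(1 / 2)) * X ^ 3 * derivative p

lemma pd_polySig (p : ℝ[X]) (i : Fin 3) (x : R3) :
    pd i (fun y => p.eval (sig y)) x = x i * (sigD p).eval (sig x) := by
  have h := (p.hasDerivAt (sig x)).comp_hasFDerivAt x (differentiableAt_sig x).hasFDerivAt
  have h' : HasFDerivAt (fun y => p.eval (sig y)) _ x := h
  rw [pd, h'.fderiv]
  have := pd_sig i x
  rw [pd] at this
  simp [this, sigD]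
  ring

/-- The Laplacian of a radial function times a homogeneous harmonic polynomial. -/
lemma laplace_polySig_mul (p : ℝ[X]) (H : MvPolynomial (Fin 3) ℝ) (l : ℕ)
    (hE : ∑ i, MvPolynomial.X i * MvPolynomial.pderiv i H = (l : MvPolynomial (Fin 3) ℝ) * H)
    (hH : ∑ i, MvPolynomial.pderiv i (MvPolynomial.pderiv i H) = 0) (x : R3) :
    ∑ i, pd i (pd i (fun y => p.eval (sig y) * MvPolynomial.eval y.ofLp H)) x =
      ((3 + 2 * l) * (sigD p).eval (sig x) + ‖x‖ ^ 2 * (sigD (sigD p)).eval (sig x)) *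
        MvPolynomial.eval x.ofLp H := by
  have hd : ∀ (q : MvPolynomial (Fin 3) ℝ) (x : R3),
      DifferentiableAt ℝ (fun x : R3 => MvPolynomial.eval x.ofLp q) x :=
    fun q => (contDiff_mvEval q).differentiable (by simp)
  have hc : ∀ (j : Fin 3) (x : R3), DifferentiableAt ℝ (fun x : R3 => x j) x :=
    fun j => (contDiff_coord j).differentiable (by simp)
  have h1 : ∀ i, pd i (fun y => p.eval (sig y) * MvPolynomial.eval y.ofLp H) = fun y =>
      (y i * (sigD p).eval (sig y)) * MvPolynomial.eval y.ofLp H +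
        p.eval (sig y) * MvPolynomial.eval y.ofLp (MvPolynomial.pderiv i H) := by
    intro i; ext y
    rw [pd_mul (differentiableAt_polySig p y) (hd _ y), pd_polySig, pd_mvEval]
  -- The second-order product rule. Summed over `i`, the middle term is evaluated by Euler's
  -- identity and the last one vanishes by harmonicity.
  have h2 : ∀ i, pd i (pd i (fun y => p.eval (sig y) * MvPolynomial.eval y.ofLp H)) x =
      ((sigD p).eval (sig x) + x i ^ 2 * (sigD (sigD p)).eval (sig x)) *
        MvPolynomial.eval x.ofLp H + 2 * (sigD p).eval (sig x) *
        MvPolynomial.eval x.ofLp (MvPolynomial.X i * MvPolynomial.pderiv i H) +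
        p.eval (sig x) *
          MvPolynomial.eval x.ofLp (MvPolynomial.pderiv i (MvPolynomial.pderiv i H)) := by
    intro i
    rw [h1, pd_add (((hc i x).fun_mul (differentiableAt_polySig _ x)).fun_mul (hd _ x))
      ((differentiableAt_polySig _ x).fun_mul (hd _ x)),
      pd_mul ((hc i x).fun_mul (differentiableAt_polySig _ x)) (hd _ x),
      pd_mul (hc i x) (differentiableAt_polySig _ x),
      pd_mul (differentiableAt_polySig _ x) (hd _ x), pd_polySig, pd_polySig, pd_mvEval,
      pd_mvEval, pd_coord, if_pos rfl, map_mul, MvPolynomial.eval_X]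
    ring
  simp only [h2, Finset.sum_add_distrib, ← Finset.mul_sum, ← Finset.sum_mul, ← map_sum, hE, hH]
  simp only [map_mul, map_natCast, map_zero]
  rw [norm_sq_eq]
  simp [Fin.sum_univ_three]
  ring

/-! ### The differential equation of the Arar-Boulmezaoud functions -/

/-- The radial factor of `abW k l m` as a polynomial in `sig`. -/
noncomputable def radial (k l : ℕ) : ℝ[X] := X ^ (2 * l + 1) * (chebD k l).comp (1 - X ^ 2)

/-- The eigenvalue `(2k+1)(2k+3)/4`. -/
noncomputable def eig (k : ℕ) : ℝ := (2 * k + 1) * (2 * k + 3) / 4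

lemma eig_pos (k : ℕ) : 0 < eig k := by unfold eig; positivity

lemma ultraODE_chebD (k l : ℕ) :
    UltraODE (2 * l + 3) ((k + 1) ^ 2 - (l + 1) ^ 2) (chebD k l) := by
  change UltraODE _ _ (derivative^[l + 1] (Chebyshev.T ℝ (k + 1 : ℕ)))
  convert (ultraODE_chebyshev (k + 1)).iterate (l + 1) using 1
  · push_cast; ring
  · push_cast; ring

lemma derivative_comp_one_sub_X_sq (p : ℝ[X]) :
    derivative (p.comp (1 - X ^ 2)) = C (-2) * X * (derivative p).comp (1 - X ^ 2) := by
  have : (C (-2) : ℝ[X]) = -2 := by rw [C_neg, C_ofNat]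
  rw [derivative_comp, this, derivative_sub, derivative_one, derivative_sq, derivative_X, C_ofNat]
  ring

lemma sigD_mul (p q : ℝ[X]) : sigD (p * q) = sigD p * q + p * sigD q := by
  rw [sigD, sigD, sigD, derivative_mul]; ring

lemma sigD_X_pow (n : ℕ) : sigD (X ^ (n + 1)) = C (-(1 / 2) * (n + 1 : ℝ)) * X ^ (n + 3) := by
  rw [sigD, derivative_X_pow, C_mul]
  simp; ring

lemma sigD_comp (p : ℝ[X]) :
    sigD (p.comp (1 - X ^ 2)) = X ^ 4 * (derivative p).comp (1 - X ^ 2) := by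
  have : (C (-(1 / 2)) * C (-2) : ℝ[X]) = 1 := by rw [← C_mul]; norm_num
  rw [sigD, derivative_comp_one_sub_X_sq]
  linear_combination X ^ 4 * (derivative p).comp (1 - X ^ 2) * this

lemma sigD_add (p q : ℝ[X]) : sigD (p + q) = sigD p + sigD q := by
  rw [sigD, sigD, sigD, derivative_add]; ring

lemma sigD_C (c : ℝ) : sigD (C c) = 0 := by
  rw [sigD, derivative_C, mul_zero]

/-- The radial form of `-ΔW = λ_k σ⁴ W`, multiplied by `σ²` and made polynomial in `σ` by `σ² |x|² =
2 - σ²`. It is the ultraspherical equation of `chebD k l` at `1 - σ²`; the eigenvalue appears as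
`(k+1)² - 1/4`. -/
lemma radial_ode (k l : ℕ) :
    X ^ 2 * (C (3 + 2 * l : ℝ) * sigD (radial k l)) + (2 - X ^ 2) * sigD (sigD (radial k l)) =
      C (-eig k) * X ^ 6 * radial k l := by
  have h := congrArg (fun p : ℝ[X] => p.comp (1 - X ^ 2)) (ultraODE_chebD k l)
  simp only [add_comp, sub_comp, mul_comp, pow_comp, one_comp, X_comp, C_comp, zero_comp] at h
  unfold radial eig
  simp only [sigD_mul, sigD_X_pow, sigD_comp, sigD_add, sigD_C, zero_mul]
  generalize (chebD k l).comp (1 - X ^ 2) = F at *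
  generalize (derivative (chebD k l)).comp (1 - X ^ 2) = F' at *
  generalize (derivative (derivative (chebD k l))).comp (1 - X ^ 2) = F'' at *
  apply Polynomial.funext
  intro s
  have h' := congrArg (eval s) h
  simp only [eval_add, eval_mul, eval_sub, eval_C, eval_pow, eval_X, eval_one, eval_zero,
    eval_ofNat] at h' ⊢
  push_cast
  linear_combination s ^ (2 * l + 7) * h'

lemma abW_eq_radial {k l : ℕ} {m : ℤ} (hm : m.natAbs ≤ l) :
    abW k l m = fun x => abConst k l m * ((radial k l).eval (sig x) *
      MvPolynomial.eval x.ofLp (solidHarm l m)) := by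
  ext x
  rw [abW_eq hm, radial]
  simp; ring

lemma contDiff_abW {k l : ℕ} {m : ℤ} (hm : m.natAbs ≤ l) : ContDiff ℝ ∞ (abW k l m) := by
  rw [abW_eq_radial hm]
  exact contDiff_const.mul ((contDiff_polySig _).mul (contDiff_mvEval _))

/-- `-Δ W = λ_k (2 / (1 + |x|²))² W`. -/
lemma laplace_abW {k l : ℕ} {m : ℤ} (hm : m.natAbs ≤ l) (x : R3) :
    ∑ i, pd i (pd i (abW k l m)) x = -eig k * sig x ^ 4 * abW k l m x := by
  have hd : Differentiable ℝ (fun x : R3 => (radial k l).eval (sig x) *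
      MvPolynomial.eval x.ofLp (solidHarm l m)) :=
    ((contDiff_polySig _).mul (contDiff_mvEval _)).differentiable (by simp)
  have hd' : ∀ i, Differentiable ℝ (pd i (fun x : R3 => (radial k l).eval (sig x) *
      MvPolynomial.eval x.ofLp (solidHarm l m))) := fun i =>
    (contDiff_pd ((contDiff_polySig _).mul (contDiff_mvEval _)) i).differentiable (by simp)
  have h1 : ∀ i, pd i (pd i (abW k l m)) x = abConst k l m *
      pd i (pd i (fun x : R3 => (radial k l).eval (sig x) *
        MvPolynomial.eval x.ofLp (solidHarm l m))) x := by
    intro i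
    rw [abW_eq_radial hm, show pd i (fun x => abConst k l m * ((radial k l).eval (sig x) *
      MvPolynomial.eval x.ofLp (solidHarm l m))) = fun x => abConst k l m * pd i (fun x =>
      ((radial k l).eval (sig x) * MvPolynomial.eval x.ofLp (solidHarm l m))) x from
      funext fun y => pd_const_mul (hd y) _ i, pd_const_mul (hd' i x)]
  rw [Finset.sum_congr rfl fun i _ => h1 i, ← Finset.mul_sum,
    laplace_polySig_mul _ _ l (solidHarm_euler l m) (solidHarm_harmonic l m), abW_eq_radial hm]
  have h2 := congrArg (eval (sig x)) (radial_ode k l)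
  simp only [eval_add, eval_mul, eval_pow, eval_X, eval_C, eval_sub, eval_ofNat] at h2
  have h3 := sig_sq_mul x
  have h4 : sig x ^ 2 ≠ 0 := pow_ne_zero 2 (sig_pos x).ne'
  apply mul_left_cancel₀ h4
  linear_combination abConst k l m * MvPolynomial.eval x.ofLp (solidHarm l m) * h2 +
    abConst k l m * MvPolynomial.eval x.ofLp (solidHarm l m) *
      (sigD (sigD (radial k l))).eval (sig x) * h3

/-! ### Bounds -/

lemma contDiff_invStereo_apply (j : Fin 4) : ContDiff ℝ ∞ (fun x => invStereo x j) := by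
  have h : ∀ p : MvPolynomial (Fin 3) ℝ,
      ContDiff ℝ ∞ (fun x : R3 => MvPolynomial.eval x.ofLp p / (‖x‖ ^ 2 + 1)) := fun p =>
    (contDiff_mvEval p).div ((contDiff_norm_sq ℝ).add contDiff_const) fun x => by positivity
  fin_cases j
  · convert h (2 * MvPolynomial.X 0) using 2; simp [invStereo]
  · convert h (2 * MvPolynomial.X 1) using 2; simp [invStereo]
  · convert h (2 * MvPolynomial.X 2) using 2; simp [invStereo]
  · convert h (normSqPoly - 1) using 2; simp [invStereo, eval_normSqPoly]

lemma invStereo_castSucc (x : R3) (j : Fin 3) : invStereo x j.castSucc = sig x ^ 2 * x j := by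
  rw [sig_sq]
  fin_cases j <;> simp [invStereo] <;> ring

lemma invStereo_last (x : R3) : invStereo x 3 = 1 - sig x ^ 2 := by
  rw [sig_sq]
  have : ‖x‖ ^ 2 + 1 ≠ 0 := by positivity
  simp [invStereo]; field_simp; ring

lemma sig_sq_le (x : R3) : sig x ^ 2 ≤ 2 := by
  have := sig_sq_mul x
  nlinarith [sq_nonneg ‖x‖, sq_nonneg (sig x), mul_nonneg (sq_nonneg (sig x)) (sq_nonneg ‖x‖)]

lemma abs_coord_le (x : R3) (j : Fin 3) : |x j| ≤ ‖x‖ := PiLp.norm_apply_le x j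

lemma abs_sig_mul_coord_le (x : R3) (j : Fin 3) : |sig x * x j| ≤ 2 := by
  have h1 := sig_sq_mul x
  have h2 : |x j| ^ 2 ≤ ‖x‖ ^ 2 := pow_le_pow_left₀ (abs_nonneg _) (abs_coord_le x j) 2
  rw [sq_abs] at h2
  apply abs_le_of_sq_le_sq (by nlinarith [mul_le_mul_of_nonneg_left h2 (sq_nonneg (sig x)), sq_nonneg (sig x)])
    zero_le_two

lemma sig_le (x : R3) : sig x ≤ 2 := by
  nlinarith [sig_sq_le x, sig_pos x]

lemma pd_sig_sq (i : Fin 3) (x : R3) : pd i (fun y => sig y ^ 2) x = -(sig x ^ 4 * x i) := by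
  have h := pd_polySig (X ^ 2) i x
  simp [sigD] at h
  rw [h]; ring

/-- The inverse stereographic projection is conformal with factor `σ²`; the constant `6` is crude.
-/
lemma abs_pd_invStereo_le (i : Fin 3) (j : Fin 4) (x : R3) :
    |pd i (fun y => invStereo y j) x| ≤ 6 * sig x ^ 2 := by
  have hs : Differentiable ℝ fun y : R3 => sig y ^ 2 :=
    fun y => (differentiableAt_sig y).pow 2
  have h1 := fun j => abs_sig_mul_coord_le x j
  have h2 := sig_le x
  have h3 := sig_pos x
  refine Fin.lastCases ?_ (fun j => ?_) j
  · have h : (fun y => invStereo y (Fin.last 3)) = fun y => 1 + (-1) * sig y ^ 2 := by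
      ext y; rw [show Fin.last 3 = 3 from rfl, invStereo_last]; ring
    rw [h, pd_add (by fun_prop) ((hs x).const_mul _), pd_const, pd_const_mul (hs x), pd_sig_sq]
    rw [show 0 + -1 * -(sig x ^ 4 * x i) = sig x ^ 2 * (sig x * (sig x * x i)) by ring,
      abs_mul, abs_mul, abs_of_pos h3, abs_of_nonneg (sq_nonneg _)]
    nlinarith [mul_le_mul h2 (h1 i) (abs_nonneg _) zero_le_two, sq_nonneg (sig x)]
  · have h : (fun y => invStereo y j.castSucc) = fun y => sig y ^ 2 * y j := by
      ext y; rw [invStereo_castSucc]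
    rw [h, pd_mul (hs x) ((contDiff_coord j).differentiable (by simp) x), pd_sig_sq, pd_coord]
    have h4 : -(sig x ^ 4 * x i) * x j + sig x ^ 2 * (if j = i then 1 else 0) =
      sig x ^ 2 * (-((sig x * x i) * (sig x * x j)) + (if j = i then 1 else 0)) := by ring
    rw [h4, abs_mul, abs_of_nonneg (sq_nonneg _), mul_comm]
    apply mul_le_mul_of_nonneg_right _ (sq_nonneg _)
    refine (abs_add_le _ _).trans ?_
    rw [abs_neg, abs_mul]
    have h5 : |(if j = i then 1 else 0 : ℝ)| ≤ 1 := by split_ifs <;> simp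
    nlinarith [mul_le_mul (h1 i) (h1 j) (abs_nonneg _) zero_le_two]

lemma abs_invStereo_le (j : Fin 4) (x : R3) : |invStereo x j| ≤ 4 := by
  have h1 := fun j => abs_sig_mul_coord_le x j
  have h2 := sig_le x
  have h3 := sig_pos x
  refine Fin.lastCases ?_ (fun j => ?_) j
  · rw [show Fin.last 3 = 3 from rfl, invStereo_last, abs_le]
    constructor <;> nlinarith
  · rw [invStereo_castSucc, sq, mul_assoc, abs_mul, abs_of_pos h3]
    nlinarith [mul_le_mul h2 (h1 j) (abs_nonneg _) zero_le_two]

/-- The polynomial `P` on `ℝ⁴` as a function on `ℝ³` through the inverse stereographic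
projection. -/
noncomputable def stereoPoly (P : MvPolynomial (Fin 4) ℝ) (x : R3) : ℝ :=
  MvPolynomial.eval (invStereo x).ofLp P

lemma contDiff_stereoPoly (P : MvPolynomial (Fin 4) ℝ) : ContDiff ℝ ∞ (stereoPoly P) := by
  unfold stereoPoly
  induction P using MvPolynomial.induction_on with
  | C a => simpa using contDiff_const
  | add p q hp hq => simpa using hp.add hq
  | mul_X p i hp => simpa using hp.mul (contDiff_invStereo_apply i)

lemma stereoPoly_bound (P : MvPolynomial (Fin 4) ℝ) : ∃ C : ℝ, 0 ≤ C ∧ ∀ x, |stereoPoly P x| ≤ C := by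
  unfold stereoPoly
  induction P using MvPolynomial.induction_on with
  | C a => exact ⟨|a|, abs_nonneg a, fun x => by simp⟩
  | add p q hp hq =>
    obtain ⟨A, hA, hp⟩ := hp
    obtain ⟨B, hB, hq⟩ := hq
    refine ⟨A + B, by positivity, fun x => ?_⟩
    rw [map_add]
    exact (abs_add_le _ _).trans (add_le_add (hp x) (hq x))
  | mul_X p i hp =>
    obtain ⟨A, hA, hp⟩ := hp
    refine ⟨A * 4, by positivity, fun x => ?_⟩
    rw [map_mul, MvPolynomial.eval_X, abs_mul]
    exact mul_le_mul (hp x) (abs_invStereo_le i x) (abs_nonneg _) hA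

lemma stereoPoly_pd_bound (P : MvPolynomial (Fin 4) ℝ) :
    ∃ C : ℝ, 0 ≤ C ∧ ∀ i x, |pd i (stereoPoly P) x| ≤ C * sig x ^ 2 := by
  have hd : ∀ P, Differentiable ℝ (stereoPoly P) := fun P =>
    (contDiff_stereoPoly P).differentiable (by simp)
  induction P using MvPolynomial.induction_on with
  | C a =>
    refine ⟨0, le_rfl, fun i x => ?_⟩
    rw [show stereoPoly (MvPolynomial.C a) = fun _ => a by ext; simp [stereoPoly], pd_const]
    simp
  | add p q hp hq =>
    obtain ⟨A, hA, hp⟩ := hp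
    obtain ⟨B, hB, hq⟩ := hq
    refine ⟨A + B, by positivity, fun i x => ?_⟩
    rw [show stereoPoly (p + q) = fun x => stereoPoly p x + stereoPoly q x by
      ext; simp [stereoPoly], pd_add (hd _ x) (hd _ x), add_mul]
    exact (abs_add_le _ _).trans (add_le_add (hp i x) (hq i x))
  | mul_X p j hp =>
    obtain ⟨A, hA, hp⟩ := hp
    obtain ⟨B, hB, hp'⟩ := stereoPoly_bound p
    refine ⟨A * 4 + B * 6, by positivity, fun i x => ?_⟩
    rw [show stereoPoly (p * MvPolynomial.X j) = fun x => stereoPoly p x * invStereo x j by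
      ext; simp [stereoPoly], pd_mul (hd _ x)
      ((contDiff_invStereo_apply j).differentiable (by simp) x)]
    refine (abs_add_le _ _).trans ?_
    rw [abs_mul, abs_mul]
    have h1 := mul_le_mul (hp i x) (abs_invStereo_le j x) (abs_nonneg _) (by positivity)
    have h2 := mul_le_mul (hp' x) (abs_pd_invStereo_le i j x) (abs_nonneg _) hB
    linarith

/-- The polynomial on `ℝ⁴` that restricts to the spherical harmonic `harmY k l m` on `S³`. -/
noncomputable def abPoly (k l : ℕ) (m : ℤ) : MvPolynomial (Fin 4) ℝ :=
  MvPolynomial.C (abConst k l m) * aeval (MvPolynomial.X 3) (chebD k l) *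
    MvPolynomial.rename Fin.castSucc (solidHarm l m)

/-- The plane harmonic has degree `|m|` and the other factor degree `l - |m|`. -/
lemma eval_solidHarm_smul {l : ℕ} {m : ℤ} (hm : m.natAbs ≤ l) (a : ℝ) (x : R3) :
    MvPolynomial.eval (fun i => a * x i) (solidHarm l m) =
      a ^ l * MvPolynomial.eval x.ofLp (solidHarm l m) := by
  have h1 : ∀ n, MvPolynomial.eval (fun i => a * x i) (planePow n).1 =
      a ^ n * MvPolynomial.eval x.ofLp (planePow n).1 ∧
      MvPolynomial.eval (fun i => a * x i) (planePow n).2 =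
      a ^ n * MvPolynomial.eval x.ofLp (planePow n).2 := by
    intro n
    induction n with
    | zero => simp [planePow]
    | succ n ih =>
      simp only [planePow, map_add, map_sub, map_mul, MvPolynomial.eval_X, ih.1, ih.2]
      constructor <;> ring
  have h2 : MvPolynomial.eval (fun i => a * x i) (planeHarm m) =
      a ^ m.natAbs * MvPolynomial.eval x.ofLp (planeHarm m) := by
    unfold planeHarm
    split_ifs
    · exact (h1 _).1
    · exact (h1 _).2
  have h3 : MvPolynomial.eval (fun i => a * x i) normSqPoly =
      a ^ 2 * MvPolynomial.eval x.ofLp normSqPoly := by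
    simp [normSqPoly]; ring
  rw [solidHarm, map_mul, map_mul, h2, map_homLeg, map_homLeg, h3, MvPolynomial.eval_X,
    MvPolynomial.eval_X, homLeg_smul l _ (by omega),
    show 2 * l - (l + m.natAbs) = l - m.natAbs by omega]
  conv_rhs => rw [← Nat.add_sub_cancel' hm, pow_add]
  rw [Nat.add_sub_cancel' hm]
  ring

/-- Homogeneity absorbs the factor `σ^(2l)` of the closed formula into the argument of the solid
harmonic, leaving a polynomial on the sphere. The bounds `W = O(σ)` and `∇W = O(σ²)` follow. -/
lemma abW_eq_stereoPoly {k l : ℕ} {m : ℤ} (hm : m.natAbs ≤ l) (x : R3) :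
    abW k l m x = sig x * stereoPoly (abPoly k l m) x := by
  have h1 : MvPolynomial.eval (invStereo x).ofLp (MvPolynomial.rename Fin.castSucc (solidHarm l m)) =
      sig x ^ (2 * l) * MvPolynomial.eval x.ofLp (solidHarm l m) := by
    rw [MvPolynomial.eval_rename, pow_mul, ← eval_solidHarm_smul hm]
    congr 2
    ext i
    exact invStereo_castSucc x i
  have h2 : MvPolynomial.eval (invStereo x).ofLp (aeval (MvPolynomial.X 3) (chebD k l)) =
      (chebD k l).eval (1 - sig x ^ 2) := by
    rw [← invStereo_last, ← coe_aeval_eq_eval, ← MvPolynomial.coe_aeval_eq_eval]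
    simp only [RingHom.coe_coe]
    rw [← aeval_algHom_apply, MvPolynomial.aeval_X]
  rw [abW_eq hm, stereoPoly, abPoly, map_mul, map_mul, MvPolynomial.eval_C, h1, h2]
  ring

lemma abW_bound {k l : ℕ} {m : ℤ} (hm : m.natAbs ≤ l) :
    ∃ C : ℝ, 0 ≤ C ∧ ∀ x, |abW k l m x| ≤ C * sig x := by
  obtain ⟨C, hC, h⟩ := stereoPoly_bound (abPoly k l m)
  refine ⟨C, hC, fun x => ?_⟩
  rw [abW_eq_stereoPoly hm, abs_mul, abs_of_pos (sig_pos x), mul_comm]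
  exact mul_le_mul_of_nonneg_right (h x) (sig_pos x).le

lemma abW_pd_bound {k l : ℕ} {m : ℤ} (hm : m.natAbs ≤ l) :
    ∃ C : ℝ, 0 ≤ C ∧ ∀ i x, |pd i (abW k l m) x| ≤ C * sig x ^ 2 := by
  obtain ⟨A, hA, h⟩ := stereoPoly_bound (abPoly k l m)
  obtain ⟨B, hB, h'⟩ := stereoPoly_pd_bound (abPoly k l m)
  refine ⟨A + 2 * B, by positivity, fun i x => ?_⟩
  rw [show abW k l m = fun x => sig x * stereoPoly (abPoly k l m) x from
    funext (abW_eq_stereoPoly hm), pd_mul (differentiableAt_sig x)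
    ((contDiff_stereoPoly _).differentiable (by simp) x), pd_sig]
  refine (abs_add_le _ _).trans ?_
  have h1 := abs_sig_mul_coord_le x i
  rw [show -(1 / 2) * sig x ^ 3 * x i * stereoPoly (abPoly k l m) x =
    -(1 / 2) * sig x ^ 2 * (sig x * x i) * stereoPoly (abPoly k l m) x by ring]
  rw [abs_mul _ (stereoPoly _ x), abs_mul _ (sig x * x i), abs_mul _ (sig x ^ 2),
    abs_mul (sig x) (pd i _ x), abs_of_pos (sig_pos x), abs_of_nonneg (sq_nonneg (sig x))]
  have h2 := mul_le_mul h1 (h x) (abs_nonneg _) zero_le_two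
  have h3 := mul_le_mul (sig_le x) (h' i x) (abs_nonneg _) zero_le_two
  have h4 : |(-(1 / 2) : ℝ)| = 1 / 2 := by norm_num
  rw [h4]
  nlinarith [sq_nonneg (sig x)]

/-! ### Spherical coordinates -/

/-- Spherical coordinates `(r, θ, φ)` on `ℝ³`. -/
noncomputable def sphCoord (p : ℝ × ℝ × ℝ) : R3 :=
  !₂[p.1 * Real.sin p.2.1 * Real.cos p.2.2, p.1 * Real.sin p.2.1 * Real.sin p.2.2,
    p.1 * Real.cos p.2.1]

lemma measurable_vec3 {α : Type*} [MeasurableSpace α] {a b c : α → ℝ} (ha : Measurable a)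
    (hb : Measurable b) (hc : Measurable c) : Measurable (fun p => (!₂[a p, b p, c p] : R3)) := by
  apply (PiLp.volume_preserving_toLp (ι := Fin 3)).measurable.comp
  rw [measurable_pi_iff]
  intro i
  fin_cases i
  · exact ha
  · exact hb
  · exact hc

lemma measurable_sphCoord : Measurable sphCoord :=
  measurable_vec3 (by fun_prop) (by fun_prop) (by fun_prop)

lemma lintegral_R3 {f : R3 → ENNReal} (hf : Measurable f) :
    ∫⁻ x, f x = ∫⁻ z : ℝ, ∫⁻ q : ℝ × ℝ, f !₂[q.1, q.2, z] := by
  have hf2 : Measurable fun v : Fin 3 → ℝ => f (WithLp.toLp 2 v) :=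
    hf.comp (PiLp.volume_preserving_toLp (ι := Fin 3)).measurable
  have he := (volume_preserving_piFinSuccAbove (fun _ : Fin 3 => ℝ) 2).symm
  have he2 := (volume_preserving_finTwoArrow ℝ).symm
  rw [← (PiLp.volume_preserving_toLp (ι := Fin 3)).lintegral_comp hf, ← he.lintegral_comp hf2,
    Measure.volume_eq_prod, lintegral_prod (fun a => f (WithLp.toLp 2
      ((MeasurableEquiv.piFinSuccAbove (fun _ : Fin 3 => ℝ) 2).symm a)))
      (hf2.comp he.measurable).aemeasurable]
  refine lintegral_congr fun z => ?_
  rw [← he2.lintegral_comp (by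
    exact (hf2.comp he.measurable).comp (measurable_const.prodMk measurable_id))]
  refine lintegral_congr fun q => ?_
  congr 2
  ext i
  fin_cases i <;> rfl

lemma lintegral_polar {f : ℝ × ℝ → ENNReal} (hf : Measurable f) :
    ∫⁻ q, f q = ∫⁻ r in Set.Ioi (0 : ℝ), ENNReal.ofReal r *
      ∫⁻ φ in Set.Ioo (-Real.pi) Real.pi, f (r * Real.cos φ, r * Real.sin φ) := by
  rw [← lintegral_comp_polarCoord_symm, polarCoord_target, Measure.volume_eq_prod,
    ← Measure.prod_restrict, lintegral_prod]
  · refine lintegral_congr fun r => ?_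
    rw [← lintegral_const_mul _ (by fun_prop)]
    rfl
  · apply Measurable.aemeasurable
    simp only [smul_eq_mul, polarCoord_symm_apply]
    fun_prop

/-- Polar coordinates are used twice: in the plane of the first two coordinates, then in the half
plane formed by `x₂` and the plane radius. -/
lemma lintegral_spherical {f : R3 → ENNReal} (hf : Measurable f) :
    ∫⁻ x, f x = ∫⁻ r in Set.Ioi (0 : ℝ), ENNReal.ofReal (r ^ 2) *
      ∫⁻ θ in Set.Ioo 0 Real.pi, ENNReal.ofReal (Real.sin θ) *
        ∫⁻ φ in Set.Ioo (-Real.pi) Real.pi, f (sphCoord (r, θ, φ)) := by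
  set g : ℝ × ℝ → ENNReal := fun p =>
    ∫⁻ φ in Set.Ioo (-Real.pi) Real.pi, f !₂[p.2 * Real.cos φ, p.2 * Real.sin φ, p.1] with hg
  have hgm : Measurable g := by
    apply Measurable.lintegral_prod_right' (f := fun p : (ℝ × ℝ) × ℝ =>
      f !₂[p.1.2 * Real.cos p.2, p.1.2 * Real.sin p.2, p.1.1])
    exact hf.comp (measurable_vec3 (by fun_prop) (by fun_prop) (by fun_prop))
  set h : ℝ × ℝ → ENNReal := (Prod.snd ⁻¹' Set.Ioi (0 : ℝ)).indicator
    (fun p => ENNReal.ofReal p.2 * g p) with hh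
  have hhm : Measurable h :=
    (by fun_prop : Measurable fun p : ℝ × ℝ => ENNReal.ofReal p.2 * g p).indicator
      (measurable_snd measurableSet_Ioi)
  have h1 : ∫⁻ x, f x = ∫⁻ p, h p := by
    rw [lintegral_R3 hf, Measure.volume_eq_prod, lintegral_prod _ hhm.aemeasurable]
    refine lintegral_congr fun z => ?_
    rw [← Measure.volume_eq_prod, lintegral_polar (f := fun q => f !₂[q.1, q.2, z])
      (hf.comp (measurable_vec3 measurable_fst measurable_snd measurable_const)),
      ← lintegral_indicator measurableSet_Ioi]
    rfl
  rw [h1, lintegral_polar hhm]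
  refine setLIntegral_congr_fun measurableSet_Ioi fun r (hr : 0 < r) => ?_
  -- The second use runs over the whole `(z, s)` plane; the condition `s > 0` cuts the angle down to
  -- `(0, π)`.
  have h2 : ∀ θ ∈ Set.Ioo (-Real.pi) Real.pi, h (r * Real.cos θ, r * Real.sin θ) =
      (Set.Ioo 0 Real.pi).indicator (fun θ => ENNReal.ofReal r * (ENNReal.ofReal (Real.sin θ) *
        ∫⁻ φ in Set.Ioo (-Real.pi) Real.pi, f (sphCoord (r, θ, φ)))) θ := by
    intro θ hθ
    by_cases h0 : 0 < θ
    · have hs : 0 < Real.sin θ := Real.sin_pos_of_pos_of_lt_pi h0 hθ.2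
      rw [Set.indicator_of_mem (show θ ∈ Set.Ioo 0 Real.pi from ⟨h0, hθ.2⟩), hh,
        Set.indicator_of_mem (show (r * Real.cos θ, r * Real.sin θ) ∈ Prod.snd ⁻¹' Set.Ioi 0 from
          mul_pos hr hs), ENNReal.ofReal_mul hr.le, mul_assoc]
      rfl
    · have hs : Real.sin θ ≤ 0 := Real.sin_nonpos_of_nonpos_of_neg_pi_le (not_lt.1 h0) hθ.1.le
      rw [Set.indicator_of_notMem (fun hm => h0 hm.1), hh, Set.indicator_of_notMem]
      simp only [Set.mem_preimage, Set.mem_Ioi, not_lt]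
      exact mul_nonpos_of_nonneg_of_nonpos hr.le hs
  rw [setLIntegral_congr_fun measurableSet_Ioo h2, setLIntegral_indicator measurableSet_Ioo,
    Set.inter_eq_left.2 (Set.Ioo_subset_Ioo_left (by linarith [Real.pi_pos])),
    lintegral_const_mul' _ _ ENNReal.ofReal_ne_top, ← mul_assoc, ← ENNReal.ofReal_mul hr.le, sq]

/-- The measure `r² sin θ dr dθ dφ`. -/
noncomputable def sphMeasure : Measure (ℝ × ℝ × ℝ) :=
  ((volume.restrict (Set.Ioi (0 : ℝ))).withDensity fun r => ENNReal.ofReal (r ^ 2)).prod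
    (((volume.restrict (Set.Ioo 0 Real.pi)).withDensity fun θ => ENNReal.ofReal (Real.sin θ)).prod
      (volume.restrict (Set.Ioo (-Real.pi) Real.pi)))

lemma map_sphMeasure : sphMeasure.map sphCoord = volume := by
  refine Measure.ext_of_lintegral _ fun f hf => ?_
  have hm : Measurable fun p => f (sphCoord p) := hf.comp measurable_sphCoord
  rw [lintegral_map hf measurable_sphCoord, lintegral_spherical hf, sphMeasure,
    lintegral_prod _ hm.aemeasurable, lintegral_withDensity_eq_lintegral_mul _ (by fun_prop)
      hm.lintegral_prod_right']
  refine lintegral_congr fun r => ?_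
  have hm2 : Measurable fun p : ℝ × ℝ => f (sphCoord (r, p)) :=
    hm.comp (measurable_const.prodMk measurable_id)
  simp only [Pi.mul_apply]
  rw [lintegral_prod _ hm2.aemeasurable, lintegral_withDensity_eq_lintegral_mul _ (by fun_prop)
      hm2.lintegral_prod_right']
  rfl

/-- The change of variables is a pushforward of measures and the integral of a separated product
always factors, so no integrability is required. -/
lemma integral_spherical_mul {F : R3 → ℝ} (hF : Continuous F) {a b c : ℝ → ℝ}
    (h : ∀ r θ φ, F (sphCoord (r, θ, φ)) = a r * (b θ * c φ)) :
    ∫ x, F x = (∫ r in Set.Ioi (0 : ℝ), r ^ 2 * a r) *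
      ((∫ θ in (0 : ℝ)..Real.pi, Real.sin θ * b θ) *
        ∫ φ in (-Real.pi)..Real.pi, c φ) := by
  have h1 : ∫ x, F x = ∫ p, a p.1 * (b p.2.1 * c p.2.2) ∂sphMeasure := by
    conv_lhs => rw [← map_sphMeasure]
    rw [integral_map measurable_sphCoord.aemeasurable hF.aestronglyMeasurable]
    exact integral_congr_ae (Filter.Eventually.of_forall fun p => h p.1 p.2.1 p.2.2)
  rw [h1, sphMeasure, integral_prod_mul (f := a) (g := fun q : ℝ × ℝ => b q.1 * c q.2),
    integral_prod_mul (f := b) (g := c), intervalIntegral.integral_of_le Real.pi_pos.le,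
    intervalIntegral.integral_of_le (by linarith [Real.pi_pos]), integral_Ioc_eq_integral_Ioo,
    integral_Ioc_eq_integral_Ioo]
  congr 1
  · rw [integral_withDensity_eq_integral_toReal_smul (by fun_prop) (by simp)]
    simp [ENNReal.toReal_ofReal, sq_nonneg]
  · congr 1
    rw [integral_withDensity_eq_integral_toReal_smul (by fun_prop) (by simp)]
    refine setIntegral_congr_fun measurableSet_Ioo fun θ hθ => ?_
    simp only [smul_eq_mul]
    rw [ENNReal.toReal_ofReal (Real.sin_pos_of_pos_of_lt_pi hθ.1 hθ.2).le]

/-! ### Orthonormality -/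

lemma norm_sphCoord_sq (r θ φ : ℝ) : ‖sphCoord (r, θ, φ)‖ ^ 2 = r ^ 2 := by
  rw [norm_sq_eq]
  simp only [sphCoord]
  simp
  linear_combination r ^ 2 * Real.sin θ ^ 2 * Real.sin_sq_add_cos_sq φ +
    r ^ 2 * Real.sin_sq_add_cos_sq θ

lemma eval_planeHarm_sphCoord (m : ℤ) (r θ φ : ℝ) :
    azConst m * MvPolynomial.eval (sphCoord (r, θ, φ)).ofLp (planeHarm m) =
      (r * Real.sin θ) ^ m.natAbs * azimuthal m φ := by
  have h : (⟨sphCoord (r, θ, φ) 0, sphCoord (r, θ, φ) 1⟩ : ℂ) ^ m.natAbs =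
      ((r * Real.sin θ) ^ m.natAbs : ℝ) *
      (Real.cos (m.natAbs * φ) + Real.sin (m.natAbs * φ) * Complex.I) := by
    have h1 : (⟨sphCoord (r, θ, φ) 0, sphCoord (r, θ, φ) 1⟩ : ℂ) =
        (r * Real.sin θ : ℝ) * Complex.exp (φ * Complex.I) := by
      apply Complex.ext
      · simp [sphCoord, Complex.exp_ofReal_mul_I_re, Complex.exp_ofReal_mul_I_im, -Complex.ofReal_sin]
      · simp [sphCoord, Complex.exp_ofReal_mul_I_re, Complex.exp_ofReal_mul_I_im, -Complex.ofReal_sin]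
    rw [h1, mul_pow, ← Complex.exp_nat_mul, ← mul_assoc, Complex.exp_mul_I]
    push_cast
    rfl
  rcases lt_trichotomy m 0 with hm | hm | hm
  · rw [planeHarm, if_neg (by omega), (eval_planePow _ _).2, h, Complex.im_ofReal_mul, azimuthal,
      if_neg (by omega), if_neg hm.ne, azConst, if_neg hm.ne, one_mul, Nat.cast_natAbs]
    simp [-Complex.ofReal_cos, -Complex.ofReal_sin]
  · subst hm; simp [planeHarm, planePow, azimuthal, azConst]
  · rw [planeHarm, if_pos (by omega), (eval_planePow _ _).1, h, Complex.re_ofReal_mul, azimuthal,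
      if_pos (by omega), azConst, if_neg hm.ne', one_mul, Nat.cast_natAbs, abs_of_pos hm]
    simp [-Complex.ofReal_cos, -Complex.ofReal_sin]

/-- It comes from the closed formula and not from the angles in the definition, so it holds for all
real `r`, `θ`, `φ`, as separation of variables requires. -/
lemma abW_sphCoord {k l : ℕ} {m : ℤ} (hm : m.natAbs ≤ l) (r θ φ : ℝ) :
    abW k l m (sphCoord (r, θ, φ)) = abConst k l m / azConst m *
      (√(2 / (r ^ 2 + 1)) ^ (2 * l + 1) * r ^ l * (chebD k l).eval (1 - 2 / (r ^ 2 + 1))) *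
      ((Real.sin θ ^ m.natAbs * (legQ l m.natAbs).eval (Real.cos θ)) * azimuthal m φ) := by
  have h1 := eval_planeHarm_sphCoord m r θ φ
  have h2 := homLeg_mul l (l + m.natAbs) (by omega) r (Real.cos θ)
  rw [show 2 * l - (l + m.natAbs) = l - m.natAbs by omega] at h2
  have h3 : sphCoord (r, θ, φ) 2 = r * Real.cos θ := by simp [sphCoord]
  have h4 : r ^ l = r ^ m.natAbs * r ^ (l - m.natAbs) := by
    rw [← pow_add, Nat.add_sub_cancel' hm]
  have h5 := (azConst_pos m).ne'
  rw [abW_eq hm, solidHarm, map_mul, map_homLeg, eval_normSqPoly, MvPolynomial.eval_X, sig_sq, sig,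
    norm_sphCoord_sq, h3, h2, h4, legQ]
  rw [mul_pow] at h1
  generalize (chebD k l).eval (1 - 2 / (r ^ 2 + 1)) = F
  generalize (derivative^[l + m.natAbs] ((X ^ 2 - 1 : ℝ[X]) ^ l)).eval (Real.cos θ) = q
  generalize √(2 / (r ^ 2 + 1)) ^ (2 * l + 1) = s
  field_simp
  linear_combination abConst k l m * s * F * q * r ^ (l - m.natAbs) * h1

/-- The substitution `t = (r² - 1) / (r² + 1)`. -/
lemma integral_radial (n : ℕ) (p : ℝ[X]) :
    ∫ r in Set.Ioi (0 : ℝ), 2 / (r ^ 2 + 1) * ((2 / (r ^ 2 + 1) * r) ^ n *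
      p.eval (1 - 2 / (r ^ 2 + 1))) = sinInt n p := by
  -- The substitution is `χ = π - 2 arctan r`, the angle whose cosine is `(r² - 1)/(r² + 1)`.
  have himg : (fun r => Real.pi - 2 * Real.arctan r) '' Set.Ioi 0 = Set.Ioo 0 Real.pi := by
    ext χ
    simp only [Set.mem_image, Set.mem_Ioi, Set.mem_Ioo]
    constructor
    · rintro ⟨r, hr, rfl⟩
      have h1 := Real.arctan_pos.2 hr
      have h2 := Real.arctan_lt_pi_div_two r
      constructor <;> linarith
    · rintro ⟨h1, h2⟩
      refine ⟨Real.tan ((Real.pi - χ) / 2), Real.tan_pos_of_pos_of_lt_pi_div_two (by linarith)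
        (by linarith), ?_⟩
      rw [Real.arctan_tan (by linarith) (by linarith)]
      ring
  have hderiv : ∀ r ∈ Set.Ioi (0 : ℝ), HasDerivWithinAt
      (fun r => Real.pi - 2 * Real.arctan r) (-(2 * (1 / (1 + r ^ 2)))) (Set.Ioi 0) r := by
    intro r _
    exact (((Real.hasDerivAt_arctan r).const_mul 2).const_sub _).hasDerivWithinAt
  have hinj : Set.InjOn (fun r => Real.pi - 2 * Real.arctan r) (Set.Ioi 0) := by
    intro a _ b _ hab
    exact Real.arctan_injective (by simpa using hab)
  have h := integral_image_eq_integral_abs_deriv_smul measurableSet_Ioi hderiv hinj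
    (fun χ => Real.sin χ ^ n * p.eval (Real.cos χ))
  rw [himg] at h
  rw [sinInt, intervalIntegral.integral_of_le Real.pi_pos.le, integral_Ioc_eq_integral_Ioo, h]
  refine setIntegral_congr_fun measurableSet_Ioi fun r _ => ?_
  have hc : Real.cos (Real.arctan r) ^ 2 = 1 / (1 + r ^ 2) := Real.cos_sq_arctan r
  have hpos : (0 : ℝ) < 1 + r ^ 2 := by positivity
  have hcos : Real.cos (Real.pi - 2 * Real.arctan r) = 1 - 2 / (r ^ 2 + 1) := by
    rw [Real.cos_pi_sub, Real.cos_two_mul, hc]; ring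
  have hsin : Real.sin (Real.pi - 2 * Real.arctan r) = 2 / (r ^ 2 + 1) * r := by
    have h2 : Real.sin (Real.arctan r) = r * Real.cos (Real.arctan r) := by
      rw [Real.sin_arctan, Real.cos_arctan]; ring
    rw [Real.sin_pi_sub, Real.sin_two_mul, h2, mul_assoc, mul_assoc, ← sq, hc]; ring
  simp only [smul_eq_mul]
  rw [hcos, hsin, abs_neg, abs_of_pos (by positivity)]
  ring

/-- The functions `(2 / (1 + |x|²)) W` are orthonormal in `L²(ℝ³)`. -/
lemma integral_abW_mul {k l k' l' : ℕ} {m m' : ℤ} (hl : l ≤ k) (hm : m.natAbs ≤ l)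
    (hm' : m'.natAbs ≤ l') :
    ∫ x, sig x ^ 4 * (abW k l m x * abW k' l' m' x) =
      if k = k' ∧ l = l' ∧ m = m' then 1 else 0 := by
  have hcont : Continuous fun x => sig x ^ 4 * (abW k l m x * abW k' l' m' x) :=
    (contDiff_sig.continuous.pow 4).mul
      ((contDiff_abW hm).continuous.mul (contDiff_abW hm').continuous)
  rw [integral_spherical_mul hcont (a := fun r => √(2 / (r ^ 2 + 1)) ^ 4 *
      (abConst k l m / azConst m *
        (√(2 / (r ^ 2 + 1)) ^ (2 * l + 1) * r ^ l * (chebD k l).eval (1 - 2 / (r ^ 2 + 1)))) *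
      (abConst k' l' m' / azConst m' *
        (√(2 / (r ^ 2 + 1)) ^ (2 * l' + 1) * r ^ l' * (chebD k' l').eval (1 - 2 / (r ^ 2 + 1)))))
    (b := fun θ => (Real.sin θ ^ m.natAbs * (legQ l m.natAbs).eval (Real.cos θ)) *
      (Real.sin θ ^ m'.natAbs * (legQ l' m'.natAbs).eval (Real.cos θ)))
    (c := fun φ => azimuthal m φ * azimuthal m' φ)
    (fun r θ φ => by
      rw [abW_sphCoord hm, abW_sphCoord hm', sig, norm_sphCoord_sq]; ring), integral_azimuthal]
  by_cases hmm : m = m'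
  swap
  · simp [hmm]
  subst hmm
  have hθ : ∫ θ in (0 : ℝ)..Real.pi, Real.sin θ *
      ((Real.sin θ ^ m.natAbs * (legQ l m.natAbs).eval (Real.cos θ)) *
      (Real.sin θ ^ m.natAbs * (legQ l' m.natAbs).eval (Real.cos θ))) =
      sinInt (2 * m.natAbs + 1) (legQ l m.natAbs * legQ l' m.natAbs) := by
    rw [sinInt]
    congr 1; ext θ
    rw [eval_mul]; ring
  rw [hθ]
  by_cases hll : l = l'
  swap
  · simp [hll, sinInt_legQ_of_ne hll]
  subst hll
  -- With `s² = 2/(r²+1)`, the powers `s^(4l+6) r^(2l+2)` regroup as `s² (s² r)^(2l+2)`, the weight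
  -- in `integral_radial`.
  have hr : ∫ r in Set.Ioi (0 : ℝ), r ^ 2 * (√(2 / (r ^ 2 + 1)) ^ 4 * (abConst k l m / azConst m *
      (√(2 / (r ^ 2 + 1)) ^ (2 * l + 1) * r ^ l * (chebD k l).eval (1 - 2 / (r ^ 2 + 1)))) *
      (abConst k' l m / azConst m *
        (√(2 / (r ^ 2 + 1)) ^ (2 * l + 1) * r ^ l * (chebD k' l).eval (1 - 2 / (r ^ 2 + 1))))) =
      (abConst k l m / azConst m) * (abConst k' l m / azConst m) *
        sinInt (2 * (l + 1)) (chebD k l * chebD k' l) := by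
    rw [← integral_radial, ← integral_const_mul]
    refine setIntegral_congr_fun measurableSet_Ioi fun r _ => ?_
    have hs : √(2 / (r ^ 2 + 1)) ^ 2 = 2 / (r ^ 2 + 1) := Real.sq_sqrt (by positivity)
    simp only [eval_mul]
    generalize √(2 / (r ^ 2 + 1)) = s at hs ⊢
    rw [← hs]
    ring
  simp only [hr]
  by_cases hkk : k = k'
  swap
  · rw [chebD, chebD, sinInt_chebyshev_of_ne (by omega)]; simp [hkk]
  subst hkk
  rw [chebD, sinInt_chebyshev_self hl, sinInt_legQ_self hm]
  simp only [and_self, if_true]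
  have h1 := (azConst_pos m).ne'
  have h2 := normConst_pos k l
  have h3 : √(normConst k l) ^ 2 = normConst k l := Real.sq_sqrt h2.le
  have h4 : √((2 * (l : ℝ) + 1) / (2 * Real.pi)) ^ 2 = (2 * l + 1) / (2 * Real.pi) :=
    Real.sq_sqrt (by positivity)
  have h5 : √(((l - m.natAbs).factorial : ℝ) / ((l + m.natAbs).factorial : ℝ)) ^ 2 =
    ((l - m.natAbs).factorial : ℝ) / ((l + m.natAbs).factorial : ℝ) := Real.sq_sqrt (by positivity)
  rw [abConst]
  generalize √(((l - m.natAbs).factorial : ℝ) / ((l + m.natAbs).factorial : ℝ)) = u at *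
  generalize √((2 * (l : ℝ) + 1) / (2 * Real.pi)) = v at *
  have h6 : √(normConst k l) ≠ 0 := (Real.sqrt_pos.2 h2).ne'
  have h7 : (2 ^ l * (l.factorial : ℝ)) ≠ 0 := by positivity
  generalize (2 ^ l * (l.factorial : ℝ)) = y at *
  have h8 := Real.pi_pos.ne'
  calc _ = u ^ 2 * v ^ 2 * (normConst k l / √(normConst k l) ^ 2) * (2 / (2 * l + 1)) *
        ((l + m.natAbs).factorial / (l - m.natAbs).factorial) * Real.pi := by
        field_simp
    _ = 1 := by
        rw [h3, h4, h5]
        have : ((l + m.natAbs).factorial : ℝ) ≠ 0 := by positivity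
        have : ((l - m.natAbs).factorial : ℝ) ≠ 0 := by positivity
        have := h2.ne'
        field_simp

/-- The power `σ⁴` decays like `|x|⁻⁴`, and `4 > 3`; further factors `σ` are bounded by `2`. -/
lemma integrable_sig_pow {n : ℕ} (hn : 4 ≤ n) : Integrable (fun x : R3 => sig x ^ n) := by
  have h := integrable_rpow_neg_one_add_norm_sq (E := R3) (μ := volume) (r := 4)
    (by simp; norm_num)
  refine (h.const_mul (4 * 2 ^ (n - 4))).mono'
    (contDiff_sig.continuous.pow n).aestronglyMeasurable (Filter.Eventually.of_forall fun x => ?_)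
  rw [Real.norm_of_nonneg (pow_nonneg (sig_pos x).le n)]
  have h1 : ((1 : ℝ) + ‖x‖ ^ 2) ^ (-4 / 2 : ℝ) = sig x ^ 4 / 4 := by
    rw [show (-4 / 2 : ℝ) = -(2 : ℕ) by norm_num, Real.rpow_neg (by positivity), Real.rpow_natCast,
      show sig x ^ 4 = (sig x ^ 2) ^ 2 by ring, sig_sq]
    field_simp
    ring
  rw [h1, ← Nat.add_sub_cancel' hn, pow_add, Nat.add_sub_cancel_left]
  have := pow_le_pow_left₀ (sig_pos x).le (sig_le x) (n - 4)
  nlinarith [pow_pos (sig_pos x) 4]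

/-! ### Completeness -/

lemma invStereo_sphere (x : R3) :
    invStereo x 0 ^ 2 + invStereo x 1 ^ 2 + invStereo x 2 ^ 2 + invStereo x 3 ^ 2 = 1 := by
  have h0 : invStereo x 0 = sig x ^ 2 * x 0 := invStereo_castSucc x 0
  have h1 : invStereo x 1 = sig x ^ 2 * x 1 := invStereo_castSucc x 1
  have h2 : invStereo x 2 = sig x ^ 2 * x 2 := invStereo_castSucc x 2
  have h3 := sig_sq_mul x
  rw [norm_sq_eq] at h3
  rw [h0, h1, h2, invStereo_last]
  linear_combination sig x ^ 2 * h3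

lemma chebD_degree (l d : ℕ) : (chebD (l + d) l).degree = d := by
  have hc : (chebD (l + d) l).coeff d ≠ 0 := by
    rw [chebD, coeff_iterate_derivative]
    have h1 : (Chebyshev.T ℝ (l + d + 1 : ℕ)).coeff (d + (l + 1)) ≠ 0 := by
      have h2 := Chebyshev.leadingCoeff_T (R := ℝ) (l + d + 1 : ℕ)
      rw [leadingCoeff, Chebyshev.natDegree_T, Int.natAbs_natCast] at h2
      rw [show d + (l + 1) = l + d + 1 by ring, h2]
      positivity
    have h3 : (d + (l + 1)).descFactorial (l + 1) ≠ 0 := (Nat.descFactorial_pos.2 (by omega)).ne'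
    rw [nsmul_eq_mul]
    exact mul_ne_zero (by exact_mod_cast h3) h1
  refine le_antisymm ?_ (le_degree_of_ne_zero hc)
  refine degree_le_of_natDegree_le ((natDegree_iterate_derivative _ _).trans ?_)
  rw [Chebyshev.natDegree_T, Int.natAbs_natCast]
  omega

lemma span_chebD (l : ℕ) :
    Submodule.span ℝ (Set.range fun d => chebD (l + d) l) = ⊤ := by
  let S : Polynomial.Sequence ℝ := ⟨fun d => chebD (l + d) l, chebD_degree l⟩
  refine S.span fun i => ?_
  rw [isUnit_iff_ne_zero, leadingCoeff_ne_zero]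
  intro h
  have := chebD_degree l i
  change chebD (l + i) l = 0 at h
  simp [h] at this

lemma integrable_mul_stereoPoly {f : R3 → ℝ} (hf : Integrable f) (P : MvPolynomial (Fin 4) ℝ) :
    Integrable fun x => f x * stereoPoly P x := by
  obtain ⟨C, -, hC⟩ := stereoPoly_bound P
  exact hf.mul_bdd (c := C) (contDiff_stereoPoly P).continuous.aestronglyMeasurable
    (Filter.Eventually.of_forall hC)

/-- The moments of `f` against polynomials on the sphere. -/
noncomputable def moment {f : R3 → ℝ} (hf : Integrable f) : MvPolynomial (Fin 4) ℝ →ₗ[ℝ] ℝ where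
  toFun P := ∫ x, f x * stereoPoly P x
  map_add' P Q := by
    rw [← integral_add (integrable_mul_stereoPoly hf P) (integrable_mul_stereoPoly hf Q)]
    congr 1; ext x; simp [stereoPoly]; ring
  map_smul' c P := by
    rw [RingHom.id_apply, smul_eq_mul, ← integral_const_mul]
    congr 1; ext x; simp [stereoPoly, MvPolynomial.smul_eval]; ring

lemma moment_congr {f : R3 → ℝ} (hf : Integrable f) {P Q : MvPolynomial (Fin 4) ℝ}
    (h : ∀ x, stereoPoly P x = stereoPoly Q x) : moment hf P = moment hf Q := by
  change ∫ x, _ = ∫ x, _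
  simp only [h]

/-- The polynomial `q(ξ₃) ξ₂^s A(ξ₀, ξ₁, ξ₂)`. -/
noncomputable def sphGen (A : MvPolynomial (Fin 3) ℝ) (s : ℕ) (q : ℝ[X]) :
    MvPolynomial (Fin 4) ℝ :=
  aeval (MvPolynomial.X 3) q * MvPolynomial.X 2 ^ s * MvPolynomial.rename Fin.castSucc A

lemma eval_aeval_X (v : Fin 4 → ℝ) (q : ℝ[X]) :
    MvPolynomial.eval v (aeval (MvPolynomial.X 3) q) = q.eval (v 3) := by
  rw [← MvPolynomial.coe_aeval_eq_eval, RingHom.coe_coe, ← aeval_algHom_apply,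
    MvPolynomial.aeval_X, coe_aeval_eq_eval]

lemma stereoPoly_sphGen (A : MvPolynomial (Fin 3) ℝ) (s : ℕ) (q : ℝ[X]) (x : R3) :
    stereoPoly (sphGen A s q) x = q.eval (invStereo x 3) * invStereo x 2 ^ s *
      MvPolynomial.eval ((invStereo x).ofLp ∘ Fin.castSucc) A := by
  rw [stereoPoly, sphGen, map_mul, map_mul, eval_aeval_X, map_pow, MvPolynomial.eval_X,
    MvPolynomial.eval_rename]

lemma stereoPoly_mul (P Q : MvPolynomial (Fin 4) ℝ) (x : R3) :
    stereoPoly (P * Q) x = stereoPoly P x * stereoPoly Q x := map_mul _ _ _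

lemma stereoPoly_add (P Q : MvPolynomial (Fin 4) ℝ) (x : R3) :
    stereoPoly (P + Q) x = stereoPoly P x + stereoPoly Q x := map_add _ _ _

lemma stereoPoly_sub (P Q : MvPolynomial (Fin 4) ℝ) (x : R3) :
    stereoPoly (P - Q) x = stereoPoly P x - stereoPoly Q x := map_sub _ _ _

lemma stereoPoly_C (c : ℝ) (x : R3) :
    stereoPoly (MvPolynomial.C c) x = c := by simp [stereoPoly]

lemma stereoPoly_X (i : Fin 4) (x : R3) :
    stereoPoly (MvPolynomial.X i) x = invStereo x i := by simp [stereoPoly]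

/-- For fixed `l` the polynomials `chebD (l + d) l` have degrees `d = 0, 1, 2, …`, so they span all
polynomials in `ξ₃`. -/
lemma moment_solidHarm {f : R3 → ℝ} (hf : Integrable f)
    (h0 : ∀ k l m, l ≤ k → m.natAbs ≤ l → moment hf (abPoly k l m) = 0)
    {l : ℕ} {m : ℤ} (hm : m.natAbs ≤ l) (q : ℝ[X]) :
    moment hf (sphGen (solidHarm l m) 0 q) = 0 := by
  let L : ℝ[X] →ₗ[ℝ] MvPolynomial (Fin 4) ℝ :=
    (LinearMap.mulRight ℝ (MvPolynomial.rename Fin.castSucc (solidHarm l m))).comp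
      (aeval (MvPolynomial.X 3 : MvPolynomial (Fin 4) ℝ)).toLinearMap
  have hL : ∀ q, moment hf (sphGen (solidHarm l m) 0 q) = (moment hf).comp L q := by
    intro q
    simp [sphGen, L]
  have hker : Submodule.span ℝ (Set.range fun d => chebD (l + d) l) ≤
      LinearMap.ker ((moment hf).comp L) := by
    rw [Submodule.span_le]
    rintro _ ⟨d, rfl⟩
    simp only [SetLike.mem_coe, LinearMap.mem_ker]
    have h1 := h0 (l + d) l m (by omega) hm
    rw [abPoly, mul_assoc, ← MvPolynomial.smul_eq_C_mul, map_smul, smul_eq_mul] at h1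
    exact (mul_eq_zero.1 h1).resolve_left (abConst_pos _ _ _).ne'
  rw [span_chebD] at hker
  rw [hL]
  exact hker (Submodule.mem_top : q ∈ ⊤)

/-- On the sphere `ξ₀² + ξ₁² + ξ₂² = 1 - ξ₃²`. So the solid harmonic with `l = |m| + s` is a nonzero
multiple of `ξ₂^s` times the plane harmonic, plus lower powers of `ξ₂` with coefficients in `ξ₃`.
Induction on `s` removes these. -/
lemma moment_planeHarm {f : R3 → ℝ} (hf : Integrable f)
    (h0 : ∀ k l m, l ≤ k → m.natAbs ≤ l → moment hf (abPoly k l m) = 0)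
    (m : ℤ) (s : ℕ) (q : ℝ[X]) :
    moment hf (sphGen (planeHarm m) s q) = 0 := by
  induction s using Nat.strong_induction_on generalizing q with
  | _ s ih =>
    obtain ⟨c, p, hc, hp⟩ := homLeg_expand (m.natAbs + s) (m.natAbs + s + m.natAbs) (by omega)
    rw [show 2 * (m.natAbs + s) - (m.natAbs + s + m.natAbs) = s by omega] at hp
    have h1 := moment_solidHarm hf h0 (l := m.natAbs + s) (m := m) (by omega) q
    have h2 : moment hf (sphGen (solidHarm (m.natAbs + s) m) 0 q) =
        moment hf (c • sphGen (planeHarm m) s q + ∑ i ∈ Finset.range s,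
          sphGen (planeHarm m) i (q * (p i).comp (1 - X ^ 2))) := by
      refine moment_congr hf fun x => ?_
      have hs : ∀ (I : Finset ℕ) (F : ℕ → MvPolynomial (Fin 4) ℝ),
          stereoPoly (∑ i ∈ I, F i) x = ∑ i ∈ I, stereoPoly (F i) x := fun I F => map_sum _ _ _
      have hn : MvPolynomial.eval ((invStereo x).ofLp ∘ Fin.castSucc) normSqPoly =
          1 - invStereo x 3 ^ 2 := by
        have := invStereo_sphere x
        simp only [normSqPoly, map_add, map_pow, MvPolynomial.eval_X, Function.comp_apply]
        change invStereo x 0 ^ 2 + invStereo x 1 ^ 2 + invStereo x 2 ^ 2 = _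
        linarith
      rw [stereoPoly_sphGen, stereoPoly_add, hs, MvPolynomial.smul_eq_C_mul, stereoPoly_mul,
        stereoPoly_C, stereoPoly_sphGen]
      simp only [stereoPoly_sphGen]
      rw [solidHarm, map_mul, map_homLeg, hn, hp, MvPolynomial.eval_X]
      change _ * (_ * (c * invStereo x 2 ^ s + ∑ i ∈ Finset.range s, _ * invStereo x 2 ^ i)) = _
      rw [mul_add, mul_add, Finset.mul_sum, Finset.mul_sum]
      congr 1
      · ring
      · refine Finset.sum_congr rfl fun i _ => ?_
        simp only [eval_mul, eval_comp, eval_sub, eval_one, eval_pow, eval_X, coe_aeval_eq_eval]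
        ring
    rw [h1, map_add, map_sum, map_smul, Finset.sum_eq_zero (fun i hi => ih i (Finset.mem_range.1 hi) _),
      add_zero, smul_eq_mul] at h2
    exact (mul_eq_zero.1 h2.symm).resolve_left hc

lemma moment_planePow {f : R3 → ℝ} (hf : Integrable f)
    (h0 : ∀ k l m, l ≤ k → m.natAbs ≤ l → moment hf (abPoly k l m) = 0)
    (n s : ℕ) (q : ℝ[X]) :
    moment hf (sphGen (planePow n).1 s q) = 0 ∧ moment hf (sphGen (planePow n).2 s q) = 0 := by
  constructor
  · simpa [planeHarm] using moment_planeHarm hf h0 n s q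
  · rcases Nat.eq_zero_or_pos n with rfl | hn
    · simp [planePow, sphGen]
    · have := moment_planeHarm hf h0 (-n) s q
      rwa [planeHarm, if_neg (by omega), Int.natAbs_neg, Int.natAbs_natCast] at this

/-- The functions `q(ξ₃) ξ₂^s Re (ξ₀ + iξ₁)^n`, and those with `Im`, span a space stable under
multiplication by each coordinate, so a polynomial factor `P` can be absorbed one variable at a
time. -/
lemma moment_mul_planePow {f : R3 → ℝ} (hf : Integrable f)
    (h0 : ∀ k l m, l ≤ k → m.natAbs ≤ l → moment hf (abPoly k l m) = 0)
    (P : MvPolynomial (Fin 4) ℝ) (n s : ℕ) (q : ℝ[X]) :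
    moment hf (P * sphGen (planePow n).1 s q) = 0 ∧
      moment hf (P * sphGen (planePow n).2 s q) = 0 := by
  induction P using MvPolynomial.induction_on generalizing n s q with
  | C a =>
    have := moment_planePow hf h0 n s q
    simp only [← MvPolynomial.smul_eq_C_mul, map_smul, this.1, this.2, smul_zero, and_self]
  | add P Q hP hQ =>
    simp only [add_mul, map_add, (hP n s q).1, (hP n s q).2, (hQ n s q).1, (hQ n s q).2, add_zero,
      and_self]
  | mul_X P i hP =>
    -- For `z = ξ₀ + iξ₁`, multiplying `z^(n+1)` by `ξ₀` or `ξ₁` gives combinations of `z^(n+2)` and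
    -- `|z|² z^n`. On the sphere `|z|² = (1 - ξ₃²) - ξ₂²`, which only changes `q` and `s`.
    have key : ∀ {A A₁ A₂ : MvPolynomial (Fin 3) ℝ} {ε₁ ε₂ : ℝ},
        (∀ v : Fin 4 → ℝ, v i * MvPolynomial.eval (v ∘ Fin.castSucc) A =
          ε₁ * MvPolynomial.eval (v ∘ Fin.castSucc) A₁ +
          ε₂ * (v 0 ^ 2 + v 1 ^ 2) * MvPolynomial.eval (v ∘ Fin.castSucc) A₂) →
        (∀ s q, moment hf (P * sphGen A₁ s q) = 0) → (∀ s q, moment hf (P * sphGen A₂ s q) = 0) →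
        moment hf (P * MvPolynomial.X i * sphGen A s q) = 0 := by
      intro A A₁ A₂ ε₁ ε₂ hA h1 h2
      have h3 : moment hf (P * MvPolynomial.X i * sphGen A s q) =
          moment hf (ε₁ • (P * sphGen A₁ s q) + ε₂ • (P * sphGen A₂ s (q * (1 - X ^ 2)))
            - ε₂ • (P * sphGen A₂ (s + 2) q)) := by
        refine moment_congr hf fun x => ?_
        have h4 := hA (invStereo x).ofLp
        have h5 := invStereo_sphere x
        simp only [stereoPoly_mul, stereoPoly_add, stereoPoly_sub, MvPolynomial.smul_eq_C_mul,
          stereoPoly_C, stereoPoly_X, stereoPoly_sphGen, eval_mul, eval_sub, eval_one, eval_pow,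
          eval_X]
        linear_combination stereoPoly P x * eval (invStereo x 3) q * invStereo x 2 ^ s * h4 +
          stereoPoly P x * eval (invStereo x 3) q * invStereo x 2 ^ s * ε₂ *
            MvPolynomial.eval ((invStereo x).ofLp ∘ Fin.castSucc) A₂ * h5
      rw [h3, map_sub, map_add, map_smul, map_smul, map_smul, h1, h2, h2]
      simp
    fin_cases i
    · rcases n with _ | n
      · constructor
        · refine key (A₁ := (planePow 1).1) (A₂ := 0) (ε₁ := 1) (ε₂ := 0) (fun v => ?_)
            (fun s q => (hP 1 s q).1) (fun s q => by simp [sphGen])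
          simp [planePow]
        · simp [planePow, sphGen]
      · constructor
        · refine key (A₁ := (planePow (n + 2)).1) (A₂ := (planePow n).1) (ε₁ := 1 / 2)
            (ε₂ := 1 / 2) (fun v => ?_) (fun s q => (hP _ s q).1) (fun s q => (hP _ s q).1)
          simp [planePow]; ring
        · refine key (A₁ := (planePow (n + 2)).2) (A₂ := (planePow n).2) (ε₁ := 1 / 2)
            (ε₂ := 1 / 2) (fun v => ?_) (fun s q => (hP _ s q).2) (fun s q => (hP _ s q).2)
          simp [planePow]; ring
    · rcases n with _ | n
      · constructor
        · refine key (A₁ := (planePow 1).2) (A₂ := 0) (ε₁ := 1) (ε₂ := 0) (fun v => ?_)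
            (fun s q => (hP 1 s q).2) (fun s q => by simp [sphGen])
          simp [planePow]
        · simp [planePow, sphGen]
      · constructor
        · refine key (A₁ := (planePow (n + 2)).2) (A₂ := (planePow n).2) (ε₁ := 1 / 2)
            (ε₂ := -(1 / 2)) (fun v => ?_) (fun s q => (hP _ s q).2) (fun s q => (hP _ s q).2)
          simp [planePow]; ring
        · refine key (A₁ := (planePow (n + 2)).1) (A₂ := (planePow n).1) (ε₁ := -(1 / 2))
            (ε₂ := 1 / 2) (fun v => ?_) (fun s q => (hP _ s q).1) (fun s q => (hP _ s q).1)
          simp [planePow]; ring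
    · have h : ∀ A, P * MvPolynomial.X 2 * sphGen A s q = P * sphGen A (s + 1) q := by
        intro A; rw [sphGen, sphGen]; ring
      exact ⟨(congrArg _ (h _)).trans (hP n (s + 1) q).1,
        (congrArg _ (h _)).trans (hP n (s + 1) q).2⟩
    · have h : ∀ A, P * MvPolynomial.X 3 * sphGen A s q = P * sphGen A s (X * q) := by
        intro A; rw [sphGen, sphGen, map_mul, aeval_X]; ring
      exact ⟨(congrArg _ (h _)).trans (hP n s _).1, (congrArg _ (h _)).trans (hP n s _).2⟩

lemma moment_eq_zero {f : R3 → ℝ} (hf : Integrable f)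
    (h0 : ∀ k l m, l ≤ k → m.natAbs ≤ l → moment hf (abPoly k l m) = 0)
    (P : MvPolynomial (Fin 4) ℝ) : moment hf P = 0 := by
  have := (moment_mul_planePow hf h0 P 0 0 1).1
  simpa [planePow, sphGen] using this

/-! ### Density of the polynomials on the sphere, seen as a one-point compactification -/

lemma tendsto_sig : Filter.Tendsto sig (Filter.cocompact R3) (nhds 0) := by
  have h1 : Filter.Tendsto (fun x : R3 => ‖x‖ ^ 2 + 1) (Filter.cocompact R3) Filter.atTop :=
    Filter.tendsto_atTop_add_const_right _ _
      ((Filter.tendsto_pow_atTop two_ne_zero).comp (tendsto_norm_cocompact_atTop (E := R3)))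
  have h2 := (h1.const_div_atTop 2).sqrt
  rwa [Real.sqrt_zero] at h2

/-- The components of the inverse stereographic projection on the one-point compactification. -/
noncomputable def stereoOnePoint (j : Fin 4) : C(OnePoint R3, ℝ) :=
  OnePoint.continuousMapMk ⟨fun x => invStereo x j, (contDiff_invStereo_apply j).continuous⟩
    (if j = 3 then 1 else 0) (by
      rw [Filter.coclosedCompact_eq_cocompact]
      refine Fin.lastCases ?_ (fun j => ?_) j
      · have h : (fun x => invStereo x 3) = fun x => 1 - sig x ^ 2 := funext invStereo_last
        simp only [ContinuousMap.coe_mk, show Fin.last 3 = 3 from rfl, if_true]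
        rw [h]
        simpa using (tendsto_sig.pow 2).const_sub 1
      · have h : j.castSucc ≠ (3 : Fin 4) := (Fin.castSucc_lt_last j).ne
        simp only [ContinuousMap.coe_mk, if_neg h]
        refine squeeze_zero_norm (fun x => ?_) (by simpa using tendsto_sig.const_mul 2)
        rw [invStereo_castSucc, sq, mul_assoc, norm_mul, Real.norm_of_nonneg (sig_pos x).le,
          mul_comm]
        exact mul_le_mul_of_nonneg_right (abs_sig_mul_coord_le x j) (sig_pos x).le)

lemma stereoOnePoint_coe (j : Fin 4) (x : R3) : stereoOnePoint j (x : OnePoint R3) = invStereo x j :=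
  rfl

lemma stereoOnePoint_infty : stereoOnePoint 3 OnePoint.infty = 1 := rfl

lemma aeval_stereoOnePoint_coe (P : MvPolynomial (Fin 4) ℝ) (x : R3) :
    MvPolynomial.aeval stereoOnePoint P (x : OnePoint R3) = stereoPoly P x := by
  induction P using MvPolynomial.induction_on with
  | C a => simp [stereoPoly]
  | add P Q hP hQ => rw [map_add, ContinuousMap.add_apply, hP, hQ, stereoPoly_add]
  | mul_X P i hP =>
    rw [map_mul, ContinuousMap.mul_apply, hP, MvPolynomial.aeval_X, stereoOnePoint_coe,
      stereoPoly_mul, stereoPoly_X]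

/-- The last coordinate `1 - σ²` equals `1` only at infinity. At finite points it determines `σ²`,
and the other coordinates `σ² xⱼ` then determine `x`. -/
lemma separatesPoints_stereo :
    (MvPolynomial.aeval stereoOnePoint :
      MvPolynomial (Fin 4) ℝ →ₐ[ℝ] C(OnePoint R3, ℝ)).range.SeparatesPoints := by
  intro x y hxy
  by_contra! hcon
  have hj : ∀ j, stereoOnePoint j x = stereoOnePoint j y := fun j => by
    have := hcon (stereoOnePoint j) ⟨stereoOnePoint j, ⟨MvPolynomial.X j, by simp⟩, rfl⟩
    exact this
  have h3 := hj 3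
  induction x using OnePoint.rec with
  | infty =>
    induction y using OnePoint.rec with
    | infty => exact hxy rfl
    | coe y =>
      rw [stereoOnePoint_infty, stereoOnePoint_coe, invStereo_last] at h3
      nlinarith [pow_pos (sig_pos y) 2]
  | coe x =>
    induction y using OnePoint.rec with
    | infty =>
      rw [stereoOnePoint_infty, stereoOnePoint_coe, invStereo_last] at h3
      nlinarith [pow_pos (sig_pos x) 2]
    | coe y =>
      apply hxy
      rw [stereoOnePoint_coe, stereoOnePoint_coe, invStereo_last, invStereo_last] at h3
      have h4 : sig x ^ 2 = sig y ^ 2 := by linarith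
      congr 1
      ext j
      have h5 := hj j.castSucc
      rw [stereoOnePoint_coe, stereoOnePoint_coe, invStereo_castSucc, invStereo_castSucc, h4] at h5
      exact mul_left_cancel₀ (pow_pos (sig_pos y) 2).ne' h5

/-- A test function extends by `0` to the point at infinity, and by Stone–Weierstrass it is a
uniform limit of polynomials in the stereographic coordinates. Integrability of `f` turns uniform
approximation into `∫ f g = 0`. -/
lemma ae_eq_zero_of_moment_eq_zero {f : R3 → ℝ} (hf : Integrable f)
    (h0 : ∀ P, moment hf P = 0) : f =ᵐ[volume] 0 := by
  refine ae_eq_zero_of_integral_contDiff_smul_eq_zero hf.locallyIntegrable fun g hg hgc => ?_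
  have hgt : Filter.Tendsto g (Filter.coclosedCompact R3) (nhds 0) := by
    rw [Filter.coclosedCompact_eq_cocompact]
    exact hgc.is_zero_at_infty
  let G : C(OnePoint R3, ℝ) := OnePoint.continuousMapMk ⟨g, hg.continuous⟩ 0 hgt
  have hG : G ∈ (MvPolynomial.aeval stereoOnePoint :
      MvPolynomial (Fin 4) ℝ →ₐ[ℝ] C(OnePoint R3, ℝ)).range.topologicalClosure := by
    rw [ContinuousMap.subalgebra_topologicalClosure_eq_top_of_separatesPoints _
      separatesPoints_stereo]
    trivial
  have hG' : G ∈ closure (Set.range (MvPolynomial.aeval stereoOnePoint :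
      MvPolynomial (Fin 4) ℝ →ₐ[ℝ] C(OnePoint R3, ℝ))) := hG
  obtain ⟨B, hB⟩ := hgc.exists_bound_of_continuous hg.continuous
  have hfg : Integrable fun x => f x * g x :=
    hf.mul_bdd (c := B) hg.continuous.aestronglyMeasurable (Filter.Eventually.of_forall hB)
  have hle : ∀ ε > 0, |∫ x, f x * g x| ≤ ε * ∫ x, |f x| := by
    intro ε hε
    obtain ⟨_, ⟨P, rfl⟩, hP⟩ := Metric.mem_closure_iff.1 hG' ε hε
    have h1 : ∫ x, f x * g x = ∫ x, f x * (g x - stereoPoly P x) := by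
      have h2 : ∫ x, f x * stereoPoly P x = 0 := h0 P
      simp only [mul_sub]
      rw [integral_sub hfg (integrable_mul_stereoPoly hf P), h2, sub_zero]
    rw [h1, ← integral_const_mul, ← Real.norm_eq_abs]
    refine norm_integral_le_of_norm_le (hf.abs.const_mul ε) (Filter.Eventually.of_forall fun x => ?_)
    rw [norm_mul, mul_comm, Real.norm_eq_abs (f x)]
    refine mul_le_mul_of_nonneg_right ?_ (abs_nonneg _)
    have h3 := (ContinuousMap.dist_apply_le_dist (f := G) (g := MvPolynomial.aeval stereoOnePoint P)
      (x : OnePoint R3)).trans hP.le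
    rw [aeval_stereoOnePoint_coe] at h3
    exact h3
  have hz : ∫ x, f x * g x = 0 := by
    rw [← abs_nonpos_iff]
    refine le_of_forall_pos_le_add fun δ hδ => ?_
    have hI : 0 ≤ ∫ x, |f x| := integral_nonneg fun x => abs_nonneg _
    refine (hle (δ / (1 + ∫ x, |f x|)) (by positivity)).trans ?_
    rw [zero_add, div_mul_eq_mul_div, div_le_iff₀ (by positivity)]
    nlinarith
  rw [← hz]
  congr 1; ext x; rw [smul_eq_mul, mul_comm]

lemma memLp_sig_pow {n : ℕ} (hn : 2 ≤ n) : MemLp (fun x : R3 => sig x ^ n) 2 volume := by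
  have hm : AEStronglyMeasurable (fun x : R3 => sig x ^ n) volume :=
    (contDiff_sig.continuous.pow n).aestronglyMeasurable
  rw [memLp_two_iff_integrable_sq hm]
  simp only [← pow_mul]
  exact integrable_sig_pow (by omega)

/-- The functions `(2 / (1 + |x|²)) W` are complete in `L²(ℝ³)`. -/
theorem ae_eq_zero_of_integral_abW_eq_zero {h : R3 → ℝ} (hh : MemLp h 2 volume)
    (h0 : ∀ k l m, l ≤ k → m.natAbs ≤ l → ∫ x, h x * (sig x ^ 2 * abW k l m x) = 0) :
    h =ᵐ[volume] 0 := by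
  -- As `W = σ · polynomial`, the product `h σ² W` is `h σ³` times a polynomial, and `σ³` is in
  -- `L²`.
  have hf : Integrable fun x => h x * sig x ^ 3 := hh.integrable_mul (memLp_sig_pow (by norm_num))
  have h1 := ae_eq_zero_of_moment_eq_zero hf (moment_eq_zero hf fun k l m hl hm => by
    rw [← h0 k l m hl hm]
    change ∫ x, _ = _
    congr 1; ext x
    rw [abW_eq_stereoPoly hm]; ring)
  filter_upwards [h1] with x hx
  exact (mul_eq_zero.1 hx).resolve_right (pow_pos (sig_pos x) 3).ne'

/-! ### Weak gradients -/

lemma inner_gradient (v : R3) (f : R3 → ℝ) (x : R3) :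
    inner ℝ v (gradient f x) = ∑ i, v i * pd i f x := by
  rw [PiLp.inner_apply]
  refine Finset.sum_congr rfl fun i _ => ?_
  rw [gradient_apply, real_inner_eq_re_inner, RCLike.inner_apply]
  simp [mul_comm]

lemma norm_le_sum_abs (v : R3) : ‖v‖ ≤ ∑ i, |v i| := by
  rw [EuclideanSpace.norm_eq]
  refine Real.sqrt_le_iff.2 ⟨Finset.sum_nonneg fun i _ => abs_nonneg _, ?_⟩
  simp only [Fin.sum_univ_three, Real.norm_eq_abs]
  nlinarith [mul_nonneg (abs_nonneg (v 0)) (abs_nonneg (v 1)),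
    mul_nonneg (abs_nonneg (v 0)) (abs_nonneg (v 2)),
    mul_nonneg (abs_nonneg (v 1)) (abs_nonneg (v 2))]

lemma continuous_gradient {f : R3 → ℝ} (hf : ContDiff ℝ ∞ f) : Continuous (gradient f) :=
  (InnerProductSpace.toDual ℝ R3).symm.continuous.comp (hf.continuous_fderiv (by simp))

lemma hasCompactSupport_pd {f : R3 → ℝ} (hf : HasCompactSupport f) (i : Fin 3) :
    HasCompactSupport (pd i f) :=
  hf.fderiv_apply ℝ _

lemma integrable_coord_mul {μ : Measure R3} {g : R3 → R3} (hg : LocallyIntegrable g μ)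
    {φ : R3 → ℝ} (hφ : Continuous φ) (hc : HasCompactSupport φ) (i : Fin 3) :
    Integrable (fun x => g x i * φ x) μ := by
  have h := (EuclideanSpace.proj (𝕜 := ℝ) i).integrable_comp
    (hg.integrable_smul_left_of_hasCompactSupport hφ hc)
  refine h.congr (Filter.Eventually.of_forall fun x => ?_)
  simp [mul_comm]

lemma integrable_mul_test {μ : Measure R3} {u : R3 → ℝ} (hu : LocallyIntegrable u μ)
    {φ : R3 → ℝ} (hφ : Continuous φ) (hc : HasCompactSupport φ) :
    Integrable (fun x => u x * φ x) μ := by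
  refine (hu.integrable_smul_left_of_hasCompactSupport hφ hc).congr
    (Filter.Eventually.of_forall fun x => ?_)
  simp [mul_comm]

lemma HasWeakGrad.unique {u : R3 → ℝ} {g g' : R3 → R3} (h : HasWeakGrad u g)
    (h' : HasWeakGrad u g') : g =ᵐ[volume] g' := by
  refine ae_eq_of_integral_contDiff_smul_eq h.2.1 h'.2.1 fun φ hφ hc => ?_
  have key : ∀ f : R3 → R3, LocallyIntegrable f volume → ∀ i,
      (∫ x, φ x • f x) i = ∫ x, f x i * φ x := by
    intro f hf i
    have h1 := (EuclideanSpace.proj (𝕜 := ℝ) i).integral_comp_comm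
      (hf.integrable_smul_left_of_hasCompactSupport hφ.continuous hc)
    refine Eq.trans h1.symm (integral_congr_ae (Filter.Eventually.of_forall fun x => ?_))
    simp [mul_comm]
  ext i
  rw [key g h.2.1, key g' h'.2.1]
  have h1 := h.2.2 φ hφ hc i
  have h2 := h'.2.2 φ hφ hc i
  linarith

lemma HasWeakGrad.weakGrad_ae {u : R3 → ℝ} {g : R3 → R3} (h : HasWeakGrad u g) :
    weakGrad u =ᵐ[volume] g := by
  have hex : ∃ g, HasWeakGrad u g := ⟨g, h⟩
  rw [weakGrad, dif_pos hex]
  exact hex.choose_spec.unique h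

lemma HasWeakGrad.sub {u v : R3 → ℝ} {g h : R3 → R3} (hu : HasWeakGrad u g)
    (hv : HasWeakGrad v h) : HasWeakGrad (fun x => u x - v x) (fun x => g x - h x) := by
  refine ⟨hu.1.sub hv.1, hu.2.1.sub hv.2.1, fun φ hφ hc i => ?_⟩
  have e1 : (fun x => (u x - v x) * gradient φ x i)
      = fun x => u x * pd i φ x - v x * pd i φ x := by
    funext x; rw [gradient_apply]; ring
  have e2 : (fun x => (g x - h x) i * φ x) = fun x => g x i * φ x - h x i * φ x := by
    funext x; simp; ring
  have hp := (contDiff_pd hφ i).continuous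
  have hpc := hasCompactSupport_pd hc i
  have h1 := hu.2.2 φ hφ hc i
  have h2 := hv.2.2 φ hφ hc i
  simp only [gradient_apply] at h1 h2
  rw [e1, e2, integral_sub (integrable_mul_test hu.1 hp hpc) (integrable_mul_test hv.1 hp hpc),
    integral_sub (integrable_coord_mul hu.2.1 hφ.continuous hc i)
      (integrable_coord_mul hv.2.1 hφ.continuous hc i), h1, h2]
  ring

lemma hasWeakGrad_of_contDiff {f : R3 → ℝ} (hf : ContDiff ℝ ∞ f) :
    HasWeakGrad f (gradient f) := by
  refine ⟨hf.continuous.locallyIntegrable, (continuous_gradient hf).locallyIntegrable,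
    fun φ hφ hc i => ?_⟩
  simp only [gradient_apply]
  have hfl : LocallyIntegrable f (volume : Measure R3) := hf.continuous.locallyIntegrable
  refine integral_mul_fderiv_eq_neg_fderiv_mul_of_integrable
    (integrable_mul_test (contDiff_pd hf i).continuous.locallyIntegrable hφ.continuous hc)
    (integrable_mul_test hfl (contDiff_pd hφ i).continuous (hasCompactSupport_pd hc i))
    (integrable_mul_test hfl hφ.continuous hc)
    (fun x _ => (hf.differentiable (by simp)).differentiableAt)
    (fun x _ => (hφ.differentiable (by simp)).differentiableAt)

/-! ### Cutoff functions -/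

lemma one_le_sig_mul (x : R3) : 1 ≤ sig x * (1 + ‖x‖) := by
  have h := sig_sq_mul x
  have h0 : 0 ≤ sig x * (1 + ‖x‖) := mul_nonneg (sig_pos x).le (by positivity)
  have h1 : 0 ≤ sig x ^ 2 * ‖x‖ := by positivity
  nlinarith

/-- Take `b(x / (n+1))` for a bump `b`. Its gradient is at most `C / (1 + |x|)` uniformly in `n`,
hence at most `C σ`. This is the weight under which functions of `W¹₀` are square integrable, so it
supplies the dominating functions below. -/
lemma exists_cutoff : ∃ (η : ℕ → R3 → ℝ) (K : ℝ), 0 ≤ K ∧ (∀ n, ContDiff ℝ ∞ (η n)) ∧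
    (∀ n, HasCompactSupport (η n)) ∧ (∀ n x, |η n x| ≤ 1) ∧
    (∀ x, Filter.Tendsto (fun n => η n x) Filter.atTop (nhds 1)) ∧
    (∀ n i x, |pd i (η n) x| ≤ K * sig x) ∧
    (∀ i x, Filter.Tendsto (fun n => pd i (η n) x) Filter.atTop (nhds 0)) := by
  let b : ContDiffBump (0 : R3) := ⟨1, 2, by norm_num, by norm_num⟩
  have hb : ContDiff ℝ ∞ b := b.contDiff
  have hbound : ∀ i : Fin 3, ∃ C, ∀ y, ‖(1 + ‖y‖) * pd i b y‖ ≤ C := fun i =>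
    ((continuous_const.add continuous_norm).mul
      (contDiff_pd hb i).continuous).bounded_above_of_compact_support
      ((hasCompactSupport_pd b.hasCompactSupport i).mul_left)
  choose C hC using hbound
  have hC0 : ∀ i, 0 ≤ C i := fun i => (norm_nonneg _).trans (hC i 0)
  let c : ℕ → ℝ := fun n => 1 / ((n : ℝ) + 1)
  have hc0 : ∀ n, 0 < c n := fun n => by positivity
  have hc1 : ∀ n, c n ≤ 1 := fun n => by
    simp only [c]
    rw [div_le_one (by positivity)]
    linarith [(Nat.cast_nonneg n : (0 : ℝ) ≤ n)]
  have hct : Filter.Tendsto c Filter.atTop (nhds 0) := tendsto_one_div_add_atTop_nhds_zero_nat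
  have hpd : ∀ n i x, pd i (fun x => b (c n • x)) x = c n * pd i b (c n • x) := by
    intro n i x
    have h1 : HasFDerivAt (fun x : R3 => b (c n • x))
        ((fderiv ℝ b (c n • x)).comp (c n • ContinuousLinearMap.id ℝ R3)) x := by
      have h2 : HasFDerivAt (fun x : R3 => c n • x) (c n • ContinuousLinearMap.id ℝ R3) x :=
        (hasFDerivAt_id x).const_smul (c n)
      exact ((hb.differentiable (by simp)).differentiableAt.hasFDerivAt).comp x h2
    rw [pd, h1.fderiv, pd]
    simp
  have hkey : ∀ i y, |pd i b y| * (1 + ‖y‖) ≤ C i := by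
    intro i y
    have h := hC i y
    rw [norm_mul, Real.norm_eq_abs, Real.norm_eq_abs,
      abs_of_pos (by positivity : 0 < 1 + ‖y‖)] at h
    linarith
  have hkey' : ∀ i y, |pd i b y| ≤ C i := fun i y => by
    have := hkey i y
    nlinarith [mul_nonneg (abs_nonneg (pd i b y)) (norm_nonneg y)]
  refine ⟨fun n x => b (c n • x), ∑ i, C i, Finset.sum_nonneg fun i _ => hC0 i, fun n => ?_,
    fun n => ?_, fun n x => ?_, fun x => ?_, fun n i x => ?_, fun i x => ?_⟩
  · exact hb.comp (contDiff_const_smul (c n))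
  · exact b.hasCompactSupport.comp_smul (hc0 n).ne'
  · rw [abs_of_nonneg b.nonneg]; exact b.le_one
  · have h1 : Filter.Tendsto (fun n => b (c n • x)) Filter.atTop (nhds (b ((0 : ℝ) • x))) :=
      (b.continuous.tendsto _).comp (hct.smul_const x)
    rwa [zero_smul, b.one_of_mem_closedBall (by simp [b])] at h1
  · rw [hpd, abs_mul, abs_of_pos (hc0 n)]
    have h1 := hkey i (c n • x)
    rw [norm_smul, Real.norm_eq_abs, abs_of_pos (hc0 n)] at h1
    have h2 : C i ≤ ∑ i, C i := Finset.single_le_sum (fun i _ => hC0 i) (Finset.mem_univ i)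
    have h3 : c n * |pd i b (c n • x)| * (1 + ‖x‖) ≤ ∑ i, C i := by
      refine le_trans ?_ (h1.trans h2)
      have h4 : c n * (1 + ‖x‖) ≤ 1 + c n * ‖x‖ := by linarith [hc1 n]
      calc _ = |pd i b (c n • x)| * (c n * (1 + ‖x‖)) := by ring
        _ ≤ _ := mul_le_mul_of_nonneg_left h4 (abs_nonneg _)
    have h5 := mul_le_mul_of_nonneg_left h3 (sig_pos x).le
    have h6 := mul_le_mul_of_nonneg_left (one_le_sig_mul x)
      (mul_nonneg (hc0 n).le (abs_nonneg (pd i b (c n • x))))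
    linarith
  · refine squeeze_zero_norm (a := fun n => c n * C i) (fun n => ?_) ?_
    · rw [hpd, norm_mul, Real.norm_eq_abs, abs_of_pos (hc0 n)]
      exact mul_le_mul_of_nonneg_left (hkey' i _) (hc0 n).le
    · simpa using hct.mul_const (C i)

/-! ### Testing weak gradients with the Arar-Boulmezaoud functions -/

lemma norm_gradient_le {f : R3 → ℝ} {x : R3} {B : ℝ} (h : ∀ i, |pd i f x| ≤ B) :
    ‖gradient f x‖ ≤ 3 * B := by
  refine (norm_le_sum_abs _).trans ?_
  simp only [gradient_apply, Fin.sum_univ_three]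
  linarith [h 0, h 1, h 2]

lemma sig_mul_sqrt (x : R3) : sig x * √(1 + ‖x‖ ^ 2) = √2 := by
  rw [sig, ← Real.sqrt_mul (by positivity)]
  congr 1
  field_simp
  ring

lemma eq_sqrt_two_mul_div (u : R3 → ℝ) (x : R3) :
    u x * sig x = √2 * (u x / √(1 + ‖x‖ ^ 2)) := by
  have h : 0 < √(1 + ‖x‖ ^ 2) := Real.sqrt_pos.2 (by positivity)
  rw [← sig_mul_sqrt x]
  field_simp

lemma memLp_mul_sig_iff (u : R3 → ℝ) :
    MemLp (fun x => u x * sig x) 2 volume ↔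
      MemLp (fun x => u x / √(1 + ‖x‖ ^ 2)) 2 volume := by
  have e : (fun x => u x * sig x) = fun x => √2 * (u x / √(1 + ‖x‖ ^ 2)) :=
    funext (eq_sqrt_two_mul_div u)
  have e' : (fun x => u x / √(1 + ‖x‖ ^ 2)) = fun x => (√2)⁻¹ * (u x * sig x) := by
    funext x
    rw [eq_sqrt_two_mul_div, ← mul_assoc, inv_mul_cancel₀ (by positivity), one_mul]
  exact ⟨fun h => e' ▸ h.const_mul _, fun h => e ▸ h.const_mul _⟩

section

variable {k l : ℕ} {m : ℤ}

lemma memLp_gradient_abW (hm : m.natAbs ≤ l) : MemLp (gradient (abW k l m)) 2 volume := by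
  obtain ⟨C, hC, h⟩ := abW_pd_bound (k := k) hm
  refine (memLp_sig_pow (n := 2) le_rfl).of_le_mul (c := 3 * C)
    (continuous_gradient (contDiff_abW hm)).aestronglyMeasurable
    (Filter.Eventually.of_forall fun x => ?_)
  rw [Real.norm_of_nonneg (pow_nonneg (sig_pos x).le 2)]
  calc _ ≤ 3 * (C * sig x ^ 2) := norm_gradient_le fun i => h i x
    _ = _ := by ring

lemma memLp_abW_mul_sig (hm : m.natAbs ≤ l) :
    MemLp (fun x => abW k l m x * sig x) 2 volume := by
  obtain ⟨C, hC, h⟩ := abW_bound (k := k) hm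
  refine (memLp_sig_pow (n := 2) le_rfl).of_le_mul (c := C)
    ((contDiff_abW hm).continuous.mul contDiff_sig.continuous).aestronglyMeasurable
    (Filter.Eventually.of_forall fun x => ?_)
  rw [Real.norm_of_nonneg (pow_nonneg (sig_pos x).le 2), norm_mul, Real.norm_eq_abs,
    Real.norm_of_nonneg (sig_pos x).le]
  calc _ ≤ C * sig x * sig x := mul_le_mul_of_nonneg_right (h x) (sig_pos x).le
    _ = _ := by ring

/-- The gradients of `η_n W` are dominated by a multiple of `σ²`, which is in `L²`. A general `μ ≤
volume` covers both sides of the equation of the potential, on `ℝ³` and on `Ω`. -/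
lemma integral_inner_cutoff_tendsto {μ : Measure R3} (hμ : μ ≤ volume) {g : R3 → R3}
    (hg : MemLp g 2 μ) (hm : m.natAbs ≤ l) {η : ℕ → R3 → ℝ} {K : ℝ}
    (hη : ∀ n, ContDiff ℝ ∞ (η n)) (hη1 : ∀ n x, |η n x| ≤ 1)
    (hηt : ∀ x, Filter.Tendsto (fun n => η n x) Filter.atTop (nhds 1))
    (hK : ∀ n i x, |pd i (η n) x| ≤ K * sig x)
    (hdt : ∀ i x, Filter.Tendsto (fun n => pd i (η n) x) Filter.atTop (nhds 0)) :
    Filter.Tendsto (fun n => ∫ x, inner ℝ (g x) (gradient (fun y => η n y * abW k l m y) x) ∂μ)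
      Filter.atTop (nhds (∫ x, inner ℝ (g x) (gradient (abW k l m) x) ∂μ)) := by
  obtain ⟨C, hC, h⟩ := abW_bound (k := k) hm
  obtain ⟨D, hD, h'⟩ := abW_pd_bound (k := k) hm
  have hW := contDiff_abW (k := k) hm
  have hdiff : ∀ {f : R3 → ℝ}, ContDiff ℝ ∞ f → ∀ x, DifferentiableAt ℝ f x :=
    fun hf x => (hf.differentiable (by simp)).differentiableAt
  have hpd : ∀ n i x, pd i (fun y => η n y * abW k l m y) x
      = pd i (η n) x * abW k l m x + η n x * pd i (abW k l m) x := by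
    intro n i x
    rw [pd_mul (hdiff (hη n) x) (hdiff hW x)]
  have hint : Integrable (fun x => ‖g x‖ * (3 * (K * C + D) * sig x ^ 2)) μ :=
    hg.norm.integrable_mul (((memLp_sig_pow (n := 2) le_rfl).mono_measure hμ).const_mul _)
  refine tendsto_integral_of_dominated_convergence _ (fun n => ?_) hint (fun n => ?_) ?_
  · exact hg.1.inner (continuous_gradient ((hη n).mul hW)).aestronglyMeasurable
  · refine Filter.Eventually.of_forall fun x => ?_
    refine (norm_inner_le_norm _ _).trans (mul_le_mul_of_nonneg_left ?_ (norm_nonneg _))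
    have hb : ∀ i, |pd i (fun y => η n y * abW k l m y) x| ≤ (K * C + D) * sig x ^ 2 := by
      intro i
      rw [hpd]
      refine (abs_add_le _ _).trans ?_
      rw [abs_mul, abs_mul]
      have h1 := mul_le_mul (hK n i x) (h x) (abs_nonneg _) ((abs_nonneg _).trans (hK n i x))
      have h2 := mul_le_mul (hη1 n x) (h' i x) (abs_nonneg _) zero_le_one
      calc _ ≤ _ := add_le_add h1 h2
        _ = _ := by ring
    calc _ ≤ 3 * ((K * C + D) * sig x ^ 2) := norm_gradient_le hb
      _ = _ := by ring
  · refine Filter.Eventually.of_forall fun x => ?_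
    simp only [inner_gradient, hpd]
    refine tendsto_finsetSum _ fun i _ => Filter.Tendsto.const_mul _ ?_
    simpa using ((hdt i x).mul_const (abW k l m x)).add
      ((hηt x).mul_const (pd i (abW k l m) x))

lemma integral_inner_gradient_abW_eq {Ω : Set R3} {g M : R3 → R3} (hg : MemLp g 2 volume)
    (hM : MemLp M 2 (volume.restrict Ω))
    (h : ∀ φ : R3 → ℝ, ContDiff ℝ ∞ φ → HasCompactSupport φ →
      ∫ x, inner ℝ (g x) (gradient φ x) = ∫ x in Ω, inner ℝ (M x) (gradient φ x))
    (hm : m.natAbs ≤ l) :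
    ∫ x, inner ℝ (g x) (gradient (abW k l m) x) = coeff Ω M k l m := by
  obtain ⟨η, K, -, hη, hc, hη1, hηt, hK, hdt⟩ := exists_cutoff
  have h1 := integral_inner_cutoff_tendsto (k := k) le_rfl hg hm hη hη1 hηt hK hdt
  have h2 := integral_inner_cutoff_tendsto (k := k) Measure.restrict_le_self hM hm hη hη1 hηt
    hK hdt
  refine tendsto_nhds_unique h1 (h2.congr fun n => ?_)
  exact (h _ ((hη n).mul (contDiff_abW hm)) (hc n).mul_right).symm

/-- Green's identity: `η_n ∂ᵢW` is used as a test function, the sum over `i` produces `ΔW = -λ_k σ⁴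
W`, and `n → ∞`. The terms with `u` are dominated by a multiple of `|u σ| σ²`, a product of two `L²`
functions. -/
lemma HasWeakGrad.integral_inner_gradient_abW {u : R3 → ℝ} {g : R3 → R3} (hu : HasWeakGrad u g)
    (hg : MemLp g 2 volume) (hus : MemLp (fun x => u x * sig x) 2 volume)
    (hm : m.natAbs ≤ l) :
    ∫ x, inner ℝ (g x) (gradient (abW k l m) x)
      = eig k * ∫ x, sig x ^ 4 * (u x * abW k l m x) := by
  obtain ⟨η, K, hK0, hη, hc, hη1, hηt, hK, hdt⟩ := exists_cutoff
  obtain ⟨C, hC, h⟩ := abW_bound (k := k) hm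
  obtain ⟨D, hD, h'⟩ := abW_pd_bound (k := k) hm
  have hW := contDiff_abW (k := k) hm
  have hdiff : ∀ {f : R3 → ℝ}, ContDiff ℝ ∞ f → ∀ x, DifferentiableAt ℝ f x :=
    fun hf x => (hf.differentiable (by simp)).differentiableAt
  have hφ : ∀ n i, ContDiff ℝ ∞ (fun y => η n y * pd i (abW k l m) y) := fun n i =>
    (hη n).mul (contDiff_pd hW i)
  have hφc : ∀ n i, HasCompactSupport (fun y => η n y * pd i (abW k l m) y) := fun n i =>
    (hc n).mul_right
  have hpd : ∀ n x, ∑ i, pd i (fun y => η n y * pd i (abW k l m) y) x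
      = ∑ i, pd i (η n) x * pd i (abW k l m) x
        - η n x * (eig k * sig x ^ 4 * abW k l m x) := by
    intro n x
    have h1 := laplace_abW (k := k) hm x
    have h2 : ∀ i, pd i (fun y => η n y * pd i (abW k l m) y) x
        = pd i (η n) x * pd i (abW k l m) x + η n x * pd i (pd i (abW k l m)) x := by
      intro i
      rw [pd_mul (hdiff (hη n) x) (hdiff (contDiff_pd hW i) x)]
    simp only [h2]
    rw [Finset.sum_add_distrib, ← Finset.mul_sum, h1]
    ring
  have heq : ∀ n, ∫ x, u x * (∑ i, pd i (η n) x * pd i (abW k l m) x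
        - η n x * (eig k * sig x ^ 4 * abW k l m x))
      = -∫ x, η n x * inner ℝ (g x) (gradient (abW k l m) x) := by
    intro n
    have e1 : ∀ i, ∫ x, u x * pd i (fun y => η n y * pd i (abW k l m) y) x
        = -∫ x, g x i * (η n x * pd i (abW k l m) x) := by
      intro i
      have h3 := hu.2.2 _ (hφ n i) (hφc n i) i
      simpa only [gradient_apply] using h3
    simp only [← hpd, Finset.mul_sum, inner_gradient]
    rw [integral_finsetSum _ fun i _ => integrable_mul_test hu.1
      (contDiff_pd (hφ n i) i).continuous (hasCompactSupport_pd (hφc n i) i)]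
    simp only [e1]
    rw [Finset.sum_neg_distrib, ← integral_finsetSum _ fun i _ =>
      integrable_coord_mul hu.2.1 (hφ n i).continuous (hφc n i) i]
    congr 2
    funext x
    exact Finset.sum_congr rfl fun i _ => by ring
  have hR : Filter.Tendsto (fun n => ∫ x, η n x * inner ℝ (g x) (gradient (abW k l m) x))
      Filter.atTop (nhds (∫ x, inner ℝ (g x) (gradient (abW k l m) x))) := by
    have hG := memLp_gradient_abW (k := k) hm
    refine tendsto_integral_of_dominated_convergence
      (fun x => ‖g x‖ * ‖gradient (abW k l m) x‖) (fun n => ?_)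
      (hg.norm.integrable_mul hG.norm) (fun n => ?_) ?_
    · exact (hη n).continuous.aestronglyMeasurable.mul (hg.1.inner hG.1)
    · refine Filter.Eventually.of_forall fun x => ?_
      rw [norm_mul, Real.norm_eq_abs]
      calc _ ≤ 1 * (‖g x‖ * ‖gradient (abW k l m) x‖) :=
            mul_le_mul (hη1 n x) (norm_inner_le_norm _ _) (norm_nonneg _) zero_le_one
        _ = _ := one_mul _
    · refine Filter.Eventually.of_forall fun x => ?_
      simpa using (hηt x).mul_const (inner ℝ (g x) (gradient (abW k l m) x))
  have hL : Filter.Tendsto (fun n => ∫ x, u x * (∑ i, pd i (η n) x * pd i (abW k l m) x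
        - η n x * (eig k * sig x ^ 4 * abW k l m x)))
      Filter.atTop (nhds (∫ x, u x * (-(eig k * sig x ^ 4 * abW k l m x)))) := by
    have hint : Integrable (fun x => ‖u x * sig x‖ * ((3 * (K * D) + 4 * eig k * C) * sig x ^ 2))
        volume := hus.norm.integrable_mul ((memLp_sig_pow (n := 2) le_rfl).const_mul _)
    refine tendsto_integral_of_dominated_convergence _ (fun n => ?_) hint (fun n => ?_) ?_
    · refine hu.1.aestronglyMeasurable.mul (Continuous.aestronglyMeasurable ?_)
      exact (continuous_finsetSum _ fun i _ => (contDiff_pd (hη n) i).continuous.mul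
        (contDiff_pd hW i).continuous).sub ((hη n).continuous.mul
        ((continuous_const.mul (contDiff_sig.continuous.pow 4)).mul hW.continuous))
    · refine Filter.Eventually.of_forall fun x => ?_
      have hs := sig_pos x
      have b1 : ∀ i, |pd i (η n) x * pd i (abW k l m) x| ≤ K * D * sig x ^ 3 := by
        intro i
        rw [abs_mul]
        calc _ ≤ (K * sig x) * (D * sig x ^ 2) :=
              mul_le_mul (hK n i x) (h' i x) (abs_nonneg _) (by positivity)
          _ = _ := by ring
      have b2 : |η n x * (eig k * sig x ^ 4 * abW k l m x)| ≤ 4 * eig k * C * sig x ^ 3 := by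
        have he := eig_pos k
        rw [abs_mul, abs_mul, abs_of_pos (by positivity : 0 < eig k * sig x ^ 4)]
        calc _ ≤ 1 * (eig k * sig x ^ 4 * (C * sig x)) :=
              mul_le_mul (hη1 n x) (mul_le_mul_of_nonneg_left (h x) (by positivity))
                (by positivity) zero_le_one
          _ = eig k * C * sig x ^ 3 * sig x ^ 2 := by ring
          _ ≤ eig k * C * sig x ^ 3 * 4 :=
              mul_le_mul_of_nonneg_left ((sig_sq_le x).trans (by norm_num)) (by positivity)
          _ = _ := by ring
      have b3 : |∑ i, pd i (η n) x * pd i (abW k l m) x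
          - η n x * (eig k * sig x ^ 4 * abW k l m x)|
            ≤ (3 * (K * D) + 4 * eig k * C) * sig x ^ 3 := by
        refine (abs_sub _ _).trans ?_
        have b4 := Finset.abs_sum_le_sum_abs (fun i => pd i (η n) x * pd i (abW k l m) x)
          Finset.univ
        simp only [Fin.sum_univ_three] at b4 ⊢
        linarith [b1 0, b1 1, b1 2]
      rw [norm_mul, norm_mul, Real.norm_of_nonneg hs.le, Real.norm_eq_abs (_ - _)]
      calc _ ≤ ‖u x‖ * ((3 * (K * D) + 4 * eig k * C) * sig x ^ 3) :=
            mul_le_mul_of_nonneg_left b3 (norm_nonneg _)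
        _ = _ := by ring
    · refine Filter.Eventually.of_forall fun x => Filter.Tendsto.const_mul _ ?_
      have t1 : Filter.Tendsto (fun n => ∑ i, pd i (η n) x * pd i (abW k l m) x) Filter.atTop
          (nhds (∑ i : Fin 3, 0 * pd i (abW k l m) x)) :=
        tendsto_finsetSum _ fun i _ => (hdt i x).mul_const _
      simpa using t1.sub ((hηt x).mul_const (eig k * sig x ^ 4 * abW k l m x))
  have hfin := tendsto_nhds_unique (hL.congr heq) hR.neg
  have e : (fun x => u x * (-(eig k * sig x ^ 4 * abW k l m x)))
      = fun x => -eig k * (sig x ^ 4 * (u x * abW k l m x)) := by funext x; ring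
  rw [e, integral_const_mul] at hfin
  linarith

end

/-! ### The expansion in the Hilbert space of gradients -/

/-- The triples `(k, ℓ, m)` with `0 ≤ ℓ ≤ k` and `-ℓ ≤ m ≤ ℓ`. -/
abbrev Idx : Type := Σ k : ℕ, Σ l : Fin (k + 1), Finset.Icc (-((l : ℕ) : ℤ)) ((l : ℕ) : ℤ)

/-- The triples of index `k ≤ N`. -/
noncomputable def idxUpTo (N : ℕ) : Finset Idx := (Finset.range (N + 1)).sigma fun _ => Finset.univ

/-- The Arar-Boulmezaoud function of a given index triple. -/
noncomputable def idxW (j : Idx) : R3 → ℝ := abW j.1 j.2.1 j.2.2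

lemma Idx.le (j : Idx) : (j.2.1 : ℕ) ≤ j.1 := Nat.lt_succ_iff.1 j.2.1.2

lemma Idx.natAbs_le (j : Idx) : (j.2.2 : ℤ).natAbs ≤ (j.2.1 : ℕ) := by
  have := Finset.mem_Icc.1 j.2.2.2
  omega

lemma Idx.eq_iff (i j : Idx) : i = j ↔ i.1 = j.1 ∧ (i.2.1 : ℕ) = j.2.1 ∧ (i.2.2 : ℤ) = j.2.2 := by
  constructor
  · rintro rfl
    exact ⟨rfl, rfl, rfl⟩
  · obtain ⟨k, l, m⟩ := i
    obtain ⟨k', l', m'⟩ := j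
    rintro ⟨h1, h2, h3⟩
    dsimp only at h1 h2 h3
    subst h1
    obtain rfl := Fin.ext h2
    obtain rfl := Subtype.ext h3
    rfl

lemma sum_idxUpTo {β : Type*} [AddCommMonoid β] (f : ℕ → ℕ → ℤ → β) (N : ℕ) :
    ∑ j ∈ idxUpTo N, f j.1 j.2.1 j.2.2 = ∑ k ∈ Finset.range (N + 1),
      ∑ l ∈ Finset.range (k + 1), ∑ m ∈ Finset.Icc (-(l : ℤ)) l, f k l m := by
  rw [idxUpTo, Finset.sum_sigma]
  refine Finset.sum_congr rfl fun k _ => ?_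
  rw [Fintype.sum_sigma, Finset.sum_range]
  exact Finset.sum_congr rfl fun l _ =>
    Finset.sum_coe_sort (Finset.Icc (-((l : ℕ) : ℤ)) l) fun m => f k l m

/-- It passes from unconditional sums over all triples to the truncations at `k ≤ N`. -/
lemma tendsto_idxUpTo : Filter.Tendsto idxUpTo Filter.atTop Filter.atTop := by
  refine Filter.tendsto_atTop_finset_of_monotone (fun a b hab => ?_) fun j => ⟨j.1, ?_⟩
  · exact Finset.sigma_mono (Finset.range_mono (by omega)) fun _ => le_rfl
  · simp [idxUpTo]

lemma inner_toLp {E : Type*} [NormedAddCommGroup E] [InnerProductSpace ℝ E] {f g : R3 → E}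
    (hf : MemLp f 2 volume) (hg : MemLp g 2 volume) :
    inner ℝ (hf.toLp f) (hg.toLp g) = ∫ x, inner ℝ (f x) (g x) := by
  rw [L2.inner_def]
  refine integral_congr_ae ?_
  filter_upwards [hf.coeFn_toLp, hg.coeFn_toLp] with x h1 h2
  rw [h1, h2]

lemma norm_sq_eq_integral (f : Lp R3 2 (volume : Measure R3)) : ‖f‖ ^ 2 = ∫ x, ‖f x‖ ^ 2 := by
  rw [← real_inner_self_eq_norm_sq, L2.inner_def]
  simp only [real_inner_self_eq_norm_sq]

lemma memLp_sig_sq_mul {u : R3 → ℝ} (h : MemLp (fun x => u x * sig x) 2 volume) :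
    MemLp (fun x => sig x ^ 2 * u x) 2 volume := by
  have e : (fun x => sig x ^ 2 * u x) = fun x => sig x * (u x * sig x) := by funext x; ring
  rw [e]
  refine h.of_le_mul (c := 2) (contDiff_sig.continuous.aestronglyMeasurable.mul h.1)
    (Filter.Eventually.of_forall fun x => ?_)
  rw [norm_mul]
  refine mul_le_mul_of_nonneg_right ?_ (norm_nonneg _)
  rw [Real.norm_of_nonneg (sig_pos x).le]
  exact sig_le x

/-- The gradient of `idxW j` as an element of `L²`. -/
noncomputable def gradVec (j : Idx) : Lp R3 2 (volume : Measure R3) :=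
  (memLp_gradient_abW (k := j.1) j.natAbs_le).toLp

/-- The normalised weight of `idxW j` as an element of `L²`. -/
noncomputable def harmVec (j : Idx) : Lp ℝ 2 (volume : Measure R3) :=
  (memLp_sig_sq_mul (memLp_abW_mul_sig (k := j.1) j.natAbs_le)).toLp

/-- Green's identity with `u = W_i` reduces this to the orthonormality of the functions `σ² W`. -/
lemma inner_gradVec (i j : Idx) :
    inner ℝ (gradVec i) (gradVec j) = if i = j then eig j.1 else 0 := by
  rw [gradVec, gradVec, inner_toLp,
    (hasWeakGrad_of_contDiff (contDiff_abW i.natAbs_le)).integral_inner_gradient_abW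
      (memLp_gradient_abW i.natAbs_le) (memLp_abW_mul_sig i.natAbs_le) j.natAbs_le,
    integral_abW_mul i.le i.natAbs_le j.natAbs_le]
  simp only [← Idx.eq_iff]
  split_ifs <;> simp

lemma inner_harmVec (i j : Idx) : inner ℝ (harmVec i) (harmVec j) = if i = j then (1 : ℝ) else 0 := by
  rw [harmVec, harmVec, inner_toLp]
  simp only [Idx.eq_iff]
  rw [← integral_abW_mul i.le i.natAbs_le j.natAbs_le]
  congr 1
  funext x
  rw [real_inner_eq_re_inner, RCLike.inner_apply]
  simp only [conj_trivial, RCLike.re_to_real]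
  ring

lemma orthonormal_harmVec : Orthonormal ℝ harmVec :=
  orthonormal_iff_ite.2 inner_harmVec

lemma span_harmVec_orthogonal : (Submodule.span ℝ (Set.range harmVec))ᗮ = ⊥ := by
  refine (Submodule.eq_bot_iff _).2 fun f hf => ?_
  rw [Lp.eq_zero_iff_ae_eq_zero]
  refine ae_eq_zero_of_integral_abW_eq_zero (Lp.memLp f) fun k l m hl hm => ?_
  let j : Idx := ⟨k, ⟨l, Nat.lt_succ_iff.2 hl⟩, ⟨m, Finset.mem_Icc.2 (by
    constructor <;> simp only <;> omega)⟩⟩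
  have h1 : inner ℝ (harmVec j) f = 0 :=
    (Submodule.mem_orthogonal _ _).1 hf _ (Submodule.subset_span ⟨j, rfl⟩)
  rw [harmVec, L2.inner_def] at h1
  rw [← h1]
  refine integral_congr_ae ?_
  filter_upwards [(memLp_sig_sq_mul (memLp_abW_mul_sig (k := j.1) j.natAbs_le)).coeFn_toLp]
    with x hx
  rw [hx, real_inner_eq_re_inner, RCLike.inner_apply]
  simp [j]

lemma orthonormal_normalized_gradVec :
    Orthonormal ℝ fun j => (√(eig j.1))⁻¹ • gradVec j := by
  refine orthonormal_iff_ite.2 fun i j => ?_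
  rw [real_inner_smul_left, real_inner_smul_right, inner_gradVec]
  split_ifs with h
  · subst h
    have h1 := eig_pos i.1
    have h2 := Real.sq_sqrt h1.le
    have h3 := Real.sqrt_pos.2 h1
    field_simp
    linarith
  · simp

/-- Bessel's inequality for the normalized gradients. It gives convergence but does not identify the
sum. -/
lemma summable_gradVec (G : Lp R3 2 (volume : Measure R3)) :
    Summable fun j : Idx => (inner ℝ (gradVec j) G / eig j.1) • gradVec j := by
  have h1 := (orthonormal_normalized_gradVec.orthogonalFamily.summable_iff_norm_sq_summable
    fun j => inner ℝ ((√(eig j.1))⁻¹ • gradVec j) G).2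
      (orthonormal_normalized_gradVec.inner_products_summable G)
  refine h1.congr fun j => ?_
  rw [LinearIsometry.toSpanSingleton_apply, real_inner_smul_left, smul_smul]
  congr 1
  have h2 := eig_pos j.1
  have h3 := Real.sq_sqrt h2.le
  have h4 := Real.sqrt_pos.2 h2
  field_simp
  rw [h3, mul_comm]

/-- The gradient of an element of the weighted space is the sum of its expansion. -/
theorem hasSum_gradVec {u : R3 → ℝ} {G : Lp R3 2 (volume : Measure R3)} (hu : HasWeakGrad u G)
    (hus : MemLp (fun x => u x * sig x) 2 volume) :
    HasSum (fun j : Idx => (inner ℝ (gradVec j) G / eig j.1) • gradVec j) G := by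
  obtain ⟨G', hG'⟩ := summable_gradVec G
  -- By uniqueness of weak gradients, it is enough that the sum `G'` of the expansion is one for
  -- `u`.
  suffices h : HasWeakGrad u G' by
    have e : G = G' := Lp.ext (hu.unique h)
    rwa [← e] at hG'
  refine ⟨hu.1, (Lp.memLp G').locallyIntegrable one_le_two, fun φ hφ hc i => ?_⟩
  have huL := memLp_sig_sq_mul hus
  -- Green's identity cancels the eigenvalue: the coefficients are those of `σ² u` in the basis `σ²
  -- W_j`.
  have hcoef : ∀ j, inner ℝ (gradVec j) G / eig j.1 = inner ℝ huL.toLp (harmVec j) := by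
    intro j
    have h1 := hu.integral_inner_gradient_abW (Lp.memLp G) hus (k := j.1) j.natAbs_le
    have h2 : inner ℝ (gradVec j) G
        = ∫ x, inner ℝ (G x) (gradient (abW j.1 j.2.1 j.2.2) x) := by
      rw [real_inner_comm, L2.inner_def]
      refine integral_congr_ae ?_
      filter_upwards [(memLp_gradient_abW (k := j.1) j.natAbs_le).coeFn_toLp] with x hx
      rw [gradVec, hx]
    rw [h2, h1, mul_div_cancel_left₀ _ (eig_pos j.1).ne', harmVec, inner_toLp]
    congr 1
    funext x
    rw [real_inner_eq_re_inner, RCLike.inner_apply]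
    simp only [conj_trivial, RCLike.re_to_real]
    ring
  have hψ : MemLp (fun x => φ x • EuclideanSpace.single i (1 : ℝ) : R3 → R3) 2 volume :=
    (hφ.continuous.smul continuous_const).memLp_of_hasCompactSupport hc.smul_right
  -- Dividing by `σ²` is harmless on the compact support of `φ`.
  have hq : MemLp (fun x => (sig x ^ 2)⁻¹ * pd i φ x) 2 volume :=
    (((contDiff_sig.continuous.pow 2).inv₀ fun x => (pow_pos (sig_pos x) 2).ne').mul
      (contDiff_pd hφ i).continuous).memLp_of_hasCompactSupport
      (hasCompactSupport_pd hc i).mul_left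
  have hsingle : ∀ v : R3, ∀ x, inner ℝ (φ x • EuclideanSpace.single i (1 : ℝ)) v = v i * φ x := by
    intro v x
    rw [real_inner_smul_left, EuclideanSpace.inner_single_left]
    simp [mul_comm]
  have hpair : ∀ j, inner ℝ hψ.toLp (gradVec j) = -inner ℝ (harmVec j) hq.toLp := by
    intro j
    have h1 := (hasWeakGrad_of_contDiff (contDiff_abW (k := j.1) j.natAbs_le)).2.2 φ hφ hc i
    rw [gradVec, harmVec, inner_toLp, inner_toLp]
    simp only [hsingle]
    rw [← neg_eq_iff_eq_neg, ← h1]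
    congr 1
    funext x
    rw [gradient_apply, real_inner_eq_re_inner, RCLike.inner_apply]
    simp only [conj_trivial, RCLike.re_to_real]
    have := (sig_pos x).ne'
    field_simp
  -- The pairing of `G'` with `φ eᵢ`, computed term by term, is compared with Parseval's identity
  -- for `σ² u` and `σ⁻² ∂ᵢφ`.
  have hsum1 := hG'.mapL (innerSL ℝ hψ.toLp)
  have hsum2 := ((HilbertBasis.mkOfOrthogonalEqBot orthonormal_harmVec
    span_harmVec_orthogonal).hasSum_inner_mul_inner huL.toLp hq.toLp).neg
  simp only [HilbertBasis.coe_mkOfOrthogonalEqBot] at hsum2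
  have heq := hsum1.unique (hsum2.congr_fun fun j => by
    rw [innerSL_apply_apply, real_inner_smul_right, hcoef, hpair]; ring)
  rw [innerSL_apply_apply, inner_toLp] at heq
  have hfin1 : inner ℝ hψ.toLp G' = ∫ x, G' x i * φ x := by
    rw [L2.inner_def]
    refine integral_congr_ae ?_
    filter_upwards [hψ.coeFn_toLp] with x hx
    rw [hx, hsingle]
  have hfin2 : ∫ x, inner ℝ (sig x ^ 2 * u x) ((sig x ^ 2)⁻¹ * pd i φ x)
      = ∫ x, u x * gradient φ x i := by
    congr 1
    funext x
    rw [gradient_apply, real_inner_eq_re_inner, RCLike.inner_apply]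
    simp only [conj_trivial, RCLike.re_to_real]
    have := (sig_pos x).ne'
    field_simp
  rw [← hfin2, ← hfin1, heq, neg_neg]

/-! ### Truncated expansions -/

lemma gradient_sum {ι : Type*} (s : Finset ι) (a : ι → ℝ) (f : ι → R3 → ℝ)
    (hf : ∀ j ∈ s, ContDiff ℝ ∞ (f j)) (x : R3) :
    gradient (fun y => ∑ j ∈ s, a j * f j y) x = ∑ j ∈ s, a j • gradient (f j) x := by
  have hd : ∀ j ∈ s, DifferentiableAt ℝ (fun y => a j * f j y) x := fun j hj =>
    ((hf j hj).differentiable (by simp)).differentiableAt.const_mul _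
  have h1 : fderiv ℝ (fun y => ∑ j ∈ s, a j * f j y) x = ∑ j ∈ s, a j • fderiv ℝ (f j) x := by
    rw [fderiv_fun_sum hd]
    exact Finset.sum_congr rfl fun j hj =>
      fderiv_const_mul ((hf j hj).differentiable (by simp)).differentiableAt _
  simp only [gradient, h1, map_sum, map_smul]

/-- The coefficient of index `j` in the truncated expansions. -/
noncomputable def idxCoeff (Ω : Set R3) (M : R3 → R3) (j : Idx) : ℝ :=
  coeff Ω M j.1 j.2.1 j.2.2 / eig j.1

lemma potentialN_eq_sum (Ω : Set R3) (M : R3 → R3) (N : ℕ) :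
    potentialN Ω M N = fun x => ∑ j ∈ idxUpTo N, idxCoeff Ω M j * idxW j x := by
  funext x
  rw [potentialN, ← sum_idxUpTo fun k l m => 4 / ((2 * k + 1) * (2 * k + 3)) * coeff Ω M k l m
    * abW k l m x]
  refine Finset.sum_congr rfl fun j _ => ?_
  rw [idxCoeff, idxW, eig]
  field_simp

lemma EsfN_eq_sum (μ₀ : ℝ) (Ω : Set R3) (M : R3 → R3) (N : ℕ) :
    EsfN μ₀ Ω M N
      = μ₀ / 2 * ∑ j ∈ idxUpTo N, idxCoeff Ω M j * coeff Ω M j.1 j.2.1 j.2.2 := by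
  rw [EsfN, ← sum_idxUpTo fun k l m => 2 * μ₀ / ((2 * k + 1) * (2 * k + 3))
    * coeff Ω M k l m ^ 2, Finset.mul_sum]
  refine Finset.sum_congr rfl fun j _ => ?_
  rw [idxCoeff, eig]
  field_simp
  ring

/-- The gradient of the truncated expansion as an element of `L²`. -/
noncomputable def truncVec (Ω : Set R3) (M : R3 → R3) (N : ℕ) : Lp R3 2 (volume : Measure R3) :=
  ∑ j ∈ idxUpTo N, idxCoeff Ω M j • gradVec j

lemma contDiff_idxW (j : Idx) : ContDiff ℝ ∞ (idxW j) := contDiff_abW j.natAbs_le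

lemma contDiff_potentialN (Ω : Set R3) (M : R3 → R3) (N : ℕ) :
    ContDiff ℝ ∞ (potentialN Ω M N) := by
  rw [potentialN_eq_sum]
  exact ContDiff.sum fun j _ => contDiff_const.mul (contDiff_idxW j)

lemma truncVec_ae (Ω : Set R3) (M : R3 → R3) (N : ℕ) :
    truncVec Ω M N =ᵐ[volume] gradient (potentialN Ω M N) := by
  have h1 := Lp.coeFn_fun_finsetSum (idxUpTo N) fun j => idxCoeff Ω M j • gradVec j
  have h2 : ∀ᵐ x ∂(volume : Measure R3), ∀ j ∈ idxUpTo N,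
      (idxCoeff Ω M j • gradVec j : Lp R3 2 (volume : Measure R3)) x
        = idxCoeff Ω M j • gradient (idxW j) x := by
    refine (Finset.eventually_all _).2 fun j _ => ?_
    filter_upwards [Lp.coeFn_smul (idxCoeff Ω M j) (gradVec j),
      (memLp_gradient_abW (k := j.1) j.natAbs_le).coeFn_toLp] with x h3 h4
    rw [h3, Pi.smul_apply, gradVec, h4]
    rfl
  filter_upwards [h1, h2] with x h3 h4
  rw [truncVec, h3, potentialN_eq_sum, gradient_sum _ _ _ fun j _ => contDiff_idxW j]
  exact Finset.sum_congr rfl h4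

lemma memW10_potentialN (Ω : Set R3) (M : R3 → R3) (N : ℕ) : MemW10 (potentialN Ω M N) := by
  refine ⟨(memLp_mul_sig_iff _).1 ?_, _, hasWeakGrad_of_contDiff (contDiff_potentialN Ω M N),
    (memLp_congr_ae (truncVec_ae Ω M N)).1 (Lp.memLp _)⟩
  have e : (fun x => potentialN Ω M N x * sig x)
      = fun x => ∑ j ∈ idxUpTo N, idxCoeff Ω M j * (idxW j x * sig x) := by
    funext x
    rw [potentialN_eq_sum, Finset.sum_mul]
    exact Finset.sum_congr rfl fun j _ => by ring
  rw [e]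
  exact memLp_finsetSum _ fun j _ => (memLp_abW_mul_sig j.natAbs_le).const_mul _

lemma integral_norm_weakGrad_sq {u : R3 → ℝ} {f : Lp R3 2 (volume : Measure R3)}
    (h : weakGrad u =ᵐ[volume] f) : ∫ x, ‖weakGrad u x‖ ^ 2 = ‖f‖ ^ 2 := by
  rw [norm_sq_eq_integral]
  refine integral_congr_ae ?_
  filter_upwards [h] with x hx
  rw [hx]

lemma inner_truncVec_gradVec (Ω : Set R3) (M : R3 → R3) {N : ℕ} {j : Idx} (hj : j ∈ idxUpTo N) :
    inner ℝ (truncVec Ω M N) (gradVec j) = coeff Ω M j.1 j.2.1 j.2.2 := by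
  rw [truncVec, sum_inner]
  simp only [real_inner_smul_left, inner_gradVec, mul_ite, mul_zero]
  rw [Finset.sum_ite_eq', if_pos hj, idxCoeff, div_mul_cancel₀ _ (eig_pos j.1).ne']

lemma norm_truncVec_sq (Ω : Set R3) (M : R3 → R3) (N : ℕ) :
    ‖truncVec Ω M N‖ ^ 2
      = ∑ j ∈ idxUpTo N, idxCoeff Ω M j * coeff Ω M j.1 j.2.1 j.2.2 := by
  rw [← real_inner_self_eq_norm_sq]
  conv_lhs => rw [truncVec, inner_sum, ← truncVec]
  refine Finset.sum_congr rfl fun j hj => ?_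
  rw [real_inner_smul_right, inner_truncVec_gradVec Ω M hj]

/-- The hypothesis makes `truncVec` the orthogonal projection of `G` onto the gradients with `k ≤
N`; this is Pythagoras' theorem. -/
lemma norm_sq_sub_norm_truncVec_sq {Ω : Set R3} {M : R3 → R3}
    {G : Lp R3 2 (volume : Measure R3)}
    (hG : ∀ j, inner ℝ G (gradVec j) = coeff Ω M j.1 j.2.1 j.2.2) (N : ℕ) :
    ‖G‖ ^ 2 - ‖truncVec Ω M N‖ ^ 2 = ‖G - truncVec Ω M N‖ ^ 2 := by
  have h1 : inner ℝ G (truncVec Ω M N) = ‖truncVec Ω M N‖ ^ 2 := by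
    rw [norm_truncVec_sq, truncVec, inner_sum]
    refine Finset.sum_congr rfl fun j _ => ?_
    rw [real_inner_smul_right, hG]
  rw [norm_sub_sq_real, h1]
  ring

lemma Esf_potentialN (μ₀ : ℝ) (Ω : Set R3) (M : R3 → R3) (N : ℕ) :
    Esf μ₀ (potentialN Ω M N) = μ₀ / 2 * ‖truncVec Ω M N‖ ^ 2 := by
  rw [Esf, integral_norm_weakGrad_sq]
  exact (hasWeakGrad_of_contDiff (contDiff_potentialN Ω M N)).weakGrad_ae.trans
    (truncVec_ae Ω M N).symm

lemma HasWeakGrad.congr {u : R3 → ℝ} {g g' : R3 → R3} (h : HasWeakGrad u g)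
    (hg : g =ᵐ[volume] g') : HasWeakGrad u g' := by
  refine ⟨h.1, h.2.1.congr hg, fun φ hφ hc i => ?_⟩
  rw [h.2.2 φ hφ hc i]
  congr 1
  refine integral_congr_ae ?_
  filter_upwards [hg] with x hx
  rw [hx]

end StrayField

/-! ### The energy identity and the limits of the truncated energies -/

open StrayField MeasureTheory

theorem lemma4p2 (μ₀ : ℝ) (Ω : Set StrayField.R3) (hΩ : IsOpen Ω)
    (M : StrayField.R3 → StrayField.R3)
    (hM : MeasureTheory.MemLp M 2 (MeasureTheory.volume.restrict Ω))
    (U : StrayField.R3 → ℝ) (hU : StrayField.IsPotential Ω M U) :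
    (∀ N : ℕ, StrayField.MemW10 (StrayField.potentialN Ω M N) ∧
      StrayField.Esf μ₀ U - StrayField.Esf μ₀ (StrayField.potentialN Ω M N) =
        μ₀ / 2 * StrayField.normW10 (fun x => U x - StrayField.potentialN Ω M N x) ^ 2) ∧
    Filter.Tendsto (fun N : ℕ => StrayField.EsfN μ₀ Ω M N) Filter.atTop
      (nhds (StrayField.Esf μ₀ U)) ∧
    Filter.Tendsto (fun N : ℕ => StrayField.Esf μ₀ (StrayField.potentialN Ω M N)) Filter.atTop
      (nhds (StrayField.Esf μ₀ U)) := by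
  obtain ⟨⟨hw, g, hg, hg2⟩, hpot⟩ := hU
  -- The chosen representative `weakGrad U` is replaced by the `L²` class of a square integrable
  -- weak gradient.
  have hW : weakGrad U =ᵐ[volume] hg2.toLp g := hg.weakGrad_ae.trans hg2.coeFn_toLp.symm
  have hgrad : HasWeakGrad U (hg2.toLp g) := hg.congr hg2.coeFn_toLp.symm
  have hcoeff : ∀ j, inner ℝ (hg2.toLp g) (gradVec j) = coeff Ω M j.1 j.2.1 j.2.2 := by
    intro j
    rw [gradVec, inner_toLp]
    refine integral_inner_gradient_abW_eq hg2 hM (fun φ hφ hc => ?_) j.natAbs_le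
    rw [← hpot φ hφ hc]
    refine integral_congr_ae ?_
    filter_upwards [hg.weakGrad_ae] with x hx
    rw [hx]
  have hEU : Esf μ₀ U = μ₀ / 2 * ‖hg2.toLp g‖ ^ 2 := by
    rw [Esf, integral_norm_weakGrad_sq hW]
  have hlim : Filter.Tendsto (fun N => Esf μ₀ (potentialN Ω M N)) Filter.atTop
      (nhds (Esf μ₀ U)) := by
    have h1 := (hasSum_gradVec hgrad ((memLp_mul_sig_iff U).2 hw)).comp tendsto_idxUpTo
    have h2 : Filter.Tendsto (truncVec Ω M) Filter.atTop (nhds (hg2.toLp g)) := by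
      refine h1.congr fun N => ?_
      refine Finset.sum_congr rfl fun j _ => ?_
      beta_reduce
      rw [real_inner_comm, hcoeff, idxCoeff]
    simp only [Esf_potentialN, hEU]
    exact (h2.norm.pow 2).const_mul _
  -- The two limits are one, because `E^N` and `E(U_N)` coincide for every `N`.
  refine ⟨fun N => ⟨memW10_potentialN Ω M N, ?_⟩, hlim.congr fun N => ?_, hlim⟩
  · have h1 : weakGrad (fun x => U x - potentialN Ω M N x)
        =ᵐ[volume] (hg2.toLp g - truncVec Ω M N : Lp R3 2 (volume : Measure R3)) := by
      refine (hg.sub (hasWeakGrad_of_contDiff (contDiff_potentialN Ω M N))).weakGrad_ae.trans ?_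
      filter_upwards [Lp.coeFn_sub (hg2.toLp g) (truncVec Ω M N), hg2.coeFn_toLp,
        truncVec_ae Ω M N] with x h2 h3 h4
      rw [h2, Pi.sub_apply, h3, h4]
    rw [hEU, Esf_potentialN, ← mul_sub, norm_sq_sub_norm_truncVec_sq hcoeff, normW10,
      integral_norm_weakGrad_sq h1, Real.sqrt_sq (norm_nonneg _)]
  · rw [Esf_potentialN, EsfN_eq_sum, norm_truncVec_sq]
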